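/- **Conventions.** $\mathbb K\in\{\mathbb R,\mathbb C\}$, all spaces are Banach spaces over $\mathbb K$, $B_X$ is the closed unit ball, $n,m$ denote positive integers. Finite sequences are ordered by $s\le t$ iff $s$ is an initial segment of $t$; $MAX(T)$ is the set of maximal members of a set $T$ of sequences; $\zeta+(\zeta_j)_j=(\zeta+\zeta_j)_j$. **Trees.** Put $\Gamma_{0,1}=\{(0)\}$; $\Gamma_{\xi+1,1}=\bigcup_{n\ge1}\Gamma_{\xi,n}$; $\Gamma_{\xi,1}=\bigcup_{\zeta<\xi}(\omega^\zeta+\Gamma_{\zeta+1,1})$ for limit $\xi$; and $\Gamma_{\xi,n}=\bigcup_{i=1}^n\Lambda_{\xi,n,i}$, where $\Lambda_{\xi,n,i}$ is the set of all $(\omega^\xi(n-1)+t_1)\smallfrown\dots\smallfrown(\omega^\xi(n-i)+t_i)$ with $t_1,\dots,t_i\in\Gamma_{\xi,1}$ and $t_1,\dots,t_{i-1}\in MAX(\Gamma_{\xi,1})$. Define $\mathbb P_{\xi,n}:\Gamma_{\xi,n}\to[0,1]$ by $\mathbb P_{0,1}=1$; $\mathbb P_{\xi+1,1}=n^{-1}\mathbb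 P_{\xi,n}$ on $\Gamma_{\xi,n}$; $\mathbb P_{\xi,1}(\omega^\zeta+t)=\mathbb P_{\zeta+1,1}(t)$ for limit $\xi$, $\zeta<\xi$, $t\in\Gamma_{\zeta+1,1}$; and $\mathbb P_{\xi,n}\bigl((\omega^\xi(n-1)+t_1)\smallfrown\dots\smallfrown(\omega^\xi(n-i)+t_i)\bigr)=\mathbb P_{\xi,1}(t_i)$. For a (non-empty) directed set $D$ and a set $T$ of sequences of ordinals, $T.D$ is the set of sequences $(\zeta_j,u_j)_j$ with $(\zeta_j)_j\in T$, $u_j\in D$; put $\mathbb P_{\xi,n}((\zeta_j,u_j)_j)=\mathbb P_{\xi,n}((\zeta_j)_j)$ and $\zeta+(\zeta_j,u_j)_j=(\zeta+\zeta_j,u_j)_j$. A family $(x_t)_{t\in\Gamma_{\xi,n}.D}$ in $X$ is *weakly null* if $(x_{s\smallfrown(\zeta,u)})_{u\in D}$ is a weakly null net whenever $s$ (possibly empty) and $\zeta$ are such that the sequences $s\smallfrown(\zeta,u)$, $u\in D$, lie in $\Gamma_{\xi,n}.D$. For $t\in MAX(\Gamma_{\xi,n}.D)$ put $z_i^t=\sum_{\Lambda_{\xi,n,i}.D\ni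 s\le t}\mathbb P_{\xi,n}(s)x_s$, $1\le i\le n$. **Cofinal and eventual sets.** Define families $\Omega_{\xi,n}$ of subsets $E$ of $MAX(\Gamma_{\xi,n}.D)$: $E\in\Omega_{0,1}$ iff $\{u:((0,u))\in E\}$ is cofinal in $D$; $E\in\Omega_{\xi+1,1}$ iff $E\cap\Gamma_{\xi,n}.D\in\Omega_{\xi,n}$ for all $n$ in some cofinal $M\subset\mathbb N$; for limit $\xi$, $E\in\Omega_{\xi,1}$ iff $\{s\in MAX(\Gamma_{\zeta+1,1}.D):\omega^\zeta+s\in E\}\in\Omega_{\zeta+1,1}$ for all $\zeta$ in some cofinal $M\subset[0,\xi)$; and $E\in\Omega_{\xi,n+1}$ iff the set of those $u\in MAX(\Gamma_{\xi,1}.D)$ for which $\{s\in MAX(\Gamma_{\xi,n}.D):(\omega^\xi n+u)\smallfrown s\in E\}\in\Omega_{\xi,n}$ belongs to $\Omega_{\xi,1}$. A set $E\subset MAX(\Gamma_{\xi,n}.D)$ is *eventual* if $MAX(\Gamma_{\xi,n}.D)\setminus E\notin\Omega_{\xi,n}$. **The quantities.** For $K\subset X^*$ weak$^*$-compact, let $r_K(x)=\max_{x^*\in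 K}\operatorname{Re}x^*(x)$ ($0$ if $K=\varnothing$). For $1\le\gamma\le\infty$, $\alpha_{\xi,\gamma,n}(K)$ is the infimum of those $\alpha>0$ such that for all directed sets $D$, all $(a_i)_{i=1}^n\in\mathbb K^n$ and all weakly null $(x_t)_{t\in\Gamma_{\xi,n}.D}\subset B_X$, $\inf_{t\in MAX(\Gamma_{\xi,n}.D)}r_K(\sum_{i=1}^na_iz_i^t)\le\alpha\|(a_i)_{i=1}^n\|_{\ell_\gamma^n}$; $\alpha_{\xi,\gamma}(K)=\sup_n\alpha_{\xi,\gamma,n}(K)\in[0,\infty]$; and $\theta_{\xi,n}(K)$ is the infimum of those $\theta>0$ such that for all directed sets $D$ and all weakly null $(x_t)_{t\in\Gamma_{\xi,n}.D}\subset B_X$, $\inf_{t\in MAX(\Gamma_{\xi,n}.D)}r_K(\frac1n\sum_{i=1}^nz_i^t)\le\theta$. For an operator $A:X\to Y$, $\alpha_{\xi,\gamma}(A)=\alpha_{\xi,\gamma}(A^*B_{Y^*})$ and $\theta_{\xi,n}(A)=\theta_{\xi,n}(A^*B_{Y^*})$. **Theorem.** Let $(A_\lambda:X_\lambda\to Y_\lambda)_{\lambda\in\Lambda}$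 be bounded linear operators between Banach spaces, $R\ge0$ with $\|A_\lambda\|\le R$ for all $\lambda\in\Lambda$, and $\Upsilon\subset\Lambda$ finite. Let $1\le p\le r\le\infty$, $1\le\gamma\le\infty$, $E_p=(\oplus_{\lambda\in\Lambda}X_\lambda)_{\ell_p(\Lambda)}$, $F_r=(\oplus_{\lambda\in\Lambda}Y_\lambda)_{\ell_r(\Lambda)}$, and for finite $\Upsilon'\subset\Lambda$ let $D_{\Upsilon'}^{p,r}:E_p\to F_r$, $D^{p,r}_{\Upsilon'}(x_\lambda)_\lambda=(1_{\Upsilon'}(\lambda)A_\lambda x_\lambda)_\lambda$, $D_\lambda^{p,r}=D_{\{\lambda\}}^{p,r}$. Let $P_\lambda$ be the projection of $E_p$ onto the coordinate $\lambda$. (i) Let $1/r+1/s=1$, let $\zeta$ be an ordinal, $m\in\mathbb N$, $\varepsilon\ge0$, and let $\lambda\in\Lambda$ be such that $\theta_{\zeta,m}(D_\lambda^{p,r})\le\varepsilon$. Then for any directed set $D$, any $n\in\mathbb N$, any non-negative $(b_i)_{i=1}^n$, any weakly null $(x_t)_{t\in\Gamma_{\zeta,n}.D}\subset B_{E_p}$,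 any positive $(a_i)_{i=1}^n$ such that $\|P_\lambda x_t\|\le a_i$ for all $1\le i\le n$ and $t\in\Lambda_{\zeta,n,i}.D$, and any $\varepsilon'>\varepsilon\|(b_ia_i)_{i=1}^n\|_{\ell_1^n}+Rm^{1/s}\|(b_ia_i)_{i=1}^n\|_{\ell_r^n}$, the set $$\Bigl\{t\in MAX(\Gamma_{\zeta,n}.D):\Bigl\|D_\lambda^{p,r}\sum_{i=1}^nb_iz_i^t\Bigr\|\le\varepsilon'\Bigr\}$$ is eventual. (ii) Let $1/r+1/s=1$, let $\zeta$ be an ordinal, $m\in\mathbb N$, $\varepsilon\ge0$, and suppose $\theta_{\zeta,m}(A_\lambda)\le\varepsilon$ for all $\lambda\in\Upsilon$. Then for any directed set $D$, any $n\in\mathbb N$, any weakly null $(x_t)_{t\in\Gamma_{\zeta,n}.D}\subset B_{E_p}$ and any non-negative $(b_i)_{i=1}^n$, $$\inf_{t\in MAX(\Gamma_{\zeta,n}.D)}\Bigl\|D_\Upsilon^{p,r}\sum_{i=1}^nb_iz_i^t\Bigr\|\le\varepsilon\|(b_i)_{i=1}^n\|_{\ell_1^n}+Rm^{1/s}\|(b_i)_{i=1}^n\|_{\ell_r^n},$$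 and for any $\varepsilon_1>\varepsilon\|(b_i)_{i=1}^n\|_{\ell_1^n}+Rm^{1/s}\|(b_i)_{i=1}^n\|_{\ell_r^n}$ the set $\{t\in MAX(\Gamma_{\zeta,n}.D):\|D_\Upsilon^{p,r}\sum_{i=1}^nb_iz_i^t\|\le\varepsilon_1\}$ is eventual. (iii) For every ordinal $\xi$, as an equality in $[0,\infty]$, $$\alpha_{\xi,\gamma}(D_\Upsilon^{p,r})=\begin{cases}\max_{\lambda\in\Upsilon}\alpha_{\xi,\gamma}(A_\lambda)&\text{if }\gamma\le r,\\ \bigl(\sum_{\lambda\in\Upsilon}\alpha_{\xi,\gamma}(A_\lambda)^s\bigr)^{1/s}&\text{if }\gamma>r\text{ and }\frac1\gamma+\frac1s=\frac1r,\end{cases}$$ where the maximum over the empty set is $0$. -/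

import Mathlib

open Set Filter Topology
open scoped ENNReal

universe u v w

noncomputable section

namespace SzTree

/-! ### The trees of decreasing sequences of ordinals

A tree is a set of finite sequences (lists), ordered by `s <+: t` (`s` is an initial segment
of `t`); the empty sequence is not a member of the trees below. -/

/-- `a + (ζ₁, …, ζₖ) = (a + ζ₁, …, a + ζₖ)`. -/
def shift (a : Ordinal.{w}) (t : List Ordinal.{w}) : List Ordinal.{w} := t.map (a + ·)

/-- The inverse operation of `shift a`, on sequences of ordinals that are at least `a`. -/
def unshift (a : Ordinal.{w}) (t : List Ordinal.{w}) : List Ordinal.{w} := t.map (· - a)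

/-- The maximal members of a tree, with respect to the initial segment ordering. -/
def maxNodes {α : Type*} (T : Set (List α)) : Set (List α) :=
  {t | t ∈ T ∧ ∀ s ∈ T, t <+: s → s = t}

/-- `levelOf ξ G n i` is the `i`-th level `Λ_{ξ,n,i}`, if `G` is `Γ_{ξ,1}`: the set of all
`(ω ^ ξ (n-1) + t₁) ⌢ … ⌢ (ω ^ ξ (n-i) + tᵢ)` with `t₁, …, tᵢ ∈ G`, and `t₁, …, tᵢ₋₁` maximal. -/
def levelOf (ξ : Ordinal.{w}) (G : Set (List Ordinal.{w})) : ℕ → ℕ → Set (List Ordinal.{w})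
  | 0, _ => ∅
  | _ + 1, 0 => ∅
  | n + 1, 1 => {t | ∃ u ∈ G, t = shift (Ordinal.omega0 ^ ξ * n) u}
  | n + 1, i + 2 => {t | ∃ u ∈ maxNodes G, ∃ s ∈ levelOf ξ G n (i + 1),
      t = shift (Ordinal.omega0 ^ ξ * n) u ++ s}

/-- `Γ_{ξ,n}`, the union of its levels, if `G` is `Γ_{ξ,1}`. -/
def treeOf (ξ : Ordinal.{w}) (G : Set (List Ordinal.{w})) (n : ℕ) : Set (List Ordinal.{w}) :=
  {t | ∃ i, 1 ≤ i ∧ i ≤ n ∧ t ∈ levelOf ξ G n i}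

/-- `Γ_{ξ,1}`: it is `{(0)}` for `ξ = 0`, the union of the `Γ_{η,n}`, `n ≥ 1`, for `ξ = η + 1`, and
the union of the `ω ^ ζ + Γ_{ζ+1,1}`, `ζ < ξ`, for a limit ordinal `ξ`. -/
def Gamma1 (ξ : Ordinal.{w}) : Set (List Ordinal.{w}) :=
  Ordinal.limitRecOn (motive := fun _ => Set (List Ordinal.{w})) ξ
    {[0]}
    (fun η G => {t | ∃ n : ℕ, 1 ≤ n ∧ t ∈ treeOf η G n})
    (fun ξ hξ G => {t | ∃ (ζ : Ordinal.{w}) (h : ζ < ξ), ∃ s ∈ G (Order.succ ζ) (hξ.succ_lt h),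
      t = shift (Ordinal.omega0 ^ ζ) s})

/-- `Γ_{ξ,n}`, for `n ≥ 1`. -/
def Gamma (ξ : Ordinal.{w}) (n : ℕ) : Set (List Ordinal.{w}) := treeOf ξ (Gamma1 ξ) n

/-- The `i`-th level `Λ_{ξ,n,i}` of `Γ_{ξ,n}`, for `1 ≤ i ≤ n`. -/
def Lambda (ξ : Ordinal.{w}) (n i : ℕ) : Set (List Ordinal.{w}) := levelOf ξ (Gamma1 ξ) n i

/-! ### The coefficients of the special convex combinations -/

/-- `ℙ_{ξ,n}`, if `W` is `ℙ_{ξ,1}`: if `t` is in the first level of `Γ_{ξ,n+1}`, i.e. of the form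
`ω ^ ξ n + u`, then `ℙ_{ξ,n+1}(t) = ℙ_{ξ,1}(u)`; and if `t = (ω ^ ξ n + u) ⌢ s` with `s ∈ Γ_{ξ,n}`,
then `ℙ_{ξ,n+1}(t) = ℙ_{ξ,n}(s)`. -/
def weightOf (ξ : Ordinal.{w}) (W : List Ordinal.{w} → ℝ) : ℕ → List Ordinal.{w} → ℝ
  | 0, _ => 0
  | n + 1, t =>
    open Classical in
    if ∀ a ∈ t, Ordinal.omega0 ^ ξ * n ≤ a then W (unshift (Ordinal.omega0 ^ ξ * n) t)
    else weightOf ξ W n (t.filter (· < Ordinal.omega0 ^ ξ * n))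

/-- `ℙ_{ξ,1}`: it is `1` for `ξ = 0`; it is `n⁻¹ ℙ_{η,n}` on the part `Γ_{η,n}` of `Γ_{η+1,1}`; and
`ℙ_{ξ,1}(ω ^ ζ + s) = ℙ_{ζ+1,1}(s)` for `ζ < ξ`, `s ∈ Γ_{ζ+1,1}`, if `ξ` is a limit ordinal. -/
def weight1 (ξ : Ordinal.{w}) : List Ordinal.{w} → ℝ :=
  Ordinal.limitRecOn (motive := fun _ => List Ordinal.{w} → ℝ) ξ
    (fun _ => 1)
    (fun η W t =>
      let n : ℕ := sInf {n : ℕ | t ∈ Gamma η n}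
      weightOf η W n t / n)
    (fun ξ hξ W t =>
      let ζ : Ordinal.{w} := sInf {ζ | ∃ s ∈ Gamma1 (Order.succ ζ), t = shift (Ordinal.omega0 ^ ζ) s}
      open Classical in
      if h : ζ < ξ then W (Order.succ ζ) (hξ.succ_lt h) (unshift (Ordinal.omega0 ^ ζ) t) else 0)

/-- The function `ℙ_{ξ,n}` on `Γ_{ξ,n}`; see `weight_zero`, `weight_add_one`, `weight_limit`,
`weight_first`, `weight_next` for the rules that determine it. -/
def weight (ξ : Ordinal.{w}) (n : ℕ) (t : List Ordinal.{w}) : ℝ := weightOf ξ (weight1 ξ) n t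


/-! Rules for `Γ_{ξ,1}` and `ℙ_{ξ,n}`. -/

theorem shift_zero (t : List Ordinal.{w}) : shift 0 t = t := by simp [shift]

theorem unshift_shift (a : Ordinal.{w}) (t : List Ordinal.{w}) : unshift a (shift a t) = t := by
  simp [shift, unshift, Function.comp_def]

theorem Gamma1_zero : Gamma1 (0 : Ordinal.{w}) = {[0]} := by
  simp [Gamma1]

theorem Gamma1_add_one (η : Ordinal.{w}) :
    Gamma1 (η + 1) = {t | ∃ n : ℕ, 1 ≤ n ∧ t ∈ Gamma η n} := by
  simp only [Gamma1, Ordinal.limitRecOn_add_one, Gamma]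

theorem Gamma1_limit (ξ : Ordinal.{w}) (hξ : Order.IsSuccLimit ξ) :
    Gamma1 ξ = {t | ∃ ζ < ξ, ∃ s ∈ Gamma1 (ζ + 1), t = shift (Ordinal.omega0 ^ ζ) s} := by
  conv_lhs => rw [Gamma1, Ordinal.limitRecOn_limit _ _ _ _ hξ]
  simp only [exists_prop]
  rfl

theorem levelOf_bounds (ξ : Ordinal.{w}) (G : Set (List Ordinal.{w}))
    (hG : ∀ t ∈ G, t ≠ [] ∧ ∀ a ∈ t, a < Ordinal.omega0 ^ ξ) (n : ℕ) :
    ∀ (i : ℕ) (t : List Ordinal.{w}), t ∈ levelOf ξ G n i →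
      (∃ a ∈ t, Ordinal.omega0 ^ ξ * (n - 1 : ℕ) ≤ a) ∧ ∀ a ∈ t, a < Ordinal.omega0 ^ ξ * n := by
  have key : ∀ (n : ℕ), ∀ u ∈ G, (∃ a ∈ shift (Ordinal.omega0 ^ ξ * n) u,
      Ordinal.omega0 ^ ξ * n ≤ a) ∧
      ∀ a ∈ shift (Ordinal.omega0 ^ ξ * n) u, a < Ordinal.omega0 ^ ξ * (n + 1 : ℕ) := by
    intro n u hu
    obtain ⟨h1, h2⟩ := hG u hu
    obtain ⟨b, hb⟩ := List.exists_mem_of_ne_nil u h1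
    refine ⟨⟨Ordinal.omega0 ^ ξ * n + b, by simp [shift]; exact hb, by simp⟩, ?_⟩
    intro a ha
    simp only [shift, List.mem_map] at ha
    obtain ⟨c, hc, rfl⟩ := ha
    push_cast
    rw [mul_add_one]
    exact (add_lt_add_iff_left _).2 (h2 c hc)
  induction n with
  | zero => intro i t ht; simp [levelOf] at ht
  | succ n ih =>
    intro i t ht
    match i, ht with
    | 0, ht => simp [levelOf] at ht
    | 1, ht =>
      simp only [levelOf, mem_ofPred_eq] at ht
      obtain ⟨u, hu, rfl⟩ := ht
      simpa using key n u hu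
    | i + 2, ht =>
      simp only [levelOf, mem_ofPred_eq] at ht
      obtain ⟨u, hu, s, hs, rfl⟩ := ht
      obtain ⟨⟨a, ha, ha'⟩, h2⟩ := key n u hu.1
      refine ⟨⟨a, List.mem_append_left _ ha, by simpa using ha'⟩, ?_⟩
      intro b hb
      rcases List.mem_append.1 hb with hb | hb
      · exact h2 b hb
      · refine ((ih _ _ hs).2 b hb).trans_le ?_
        gcongr
        simp

theorem Gamma1_bounds (ξ : Ordinal.{w}) :
    ∀ t ∈ Gamma1 ξ, t ≠ [] ∧ ∀ a ∈ t, a < Ordinal.omega0 ^ ξ := by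
  induction ξ using Ordinal.limitRecOn with
  | zero => simp [Gamma1_zero]
  | add_one η ih =>
    intro t ht
    rw [Gamma1_add_one] at ht
    obtain ⟨n, hn, i, h1, h2, ht⟩ := ht
    obtain ⟨⟨a, ha, -⟩, h⟩ := levelOf_bounds η _ ih n i t ht
    refine ⟨List.ne_nil_of_mem ha, fun b hb => (h b hb).trans ?_⟩
    rw [Ordinal.opow_add, Ordinal.opow_one]
    gcongr
    · exact Ordinal.opow_pos _ Ordinal.omega0_pos
    · exact Ordinal.natCast_lt_omega0 n
  | limit ξ hξ ih =>
    intro t ht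
    rw [Gamma1_limit ξ hξ] at ht
    obtain ⟨ζ, hζ, s, hs, rfl⟩ := ht
    have hζ' : ζ + 1 < ξ := hξ.succ_lt hζ
    obtain ⟨h1, h2⟩ := ih _ hζ' s hs
    refine ⟨by simpa [shift] using h1, ?_⟩
    intro a ha
    simp only [shift, List.mem_map] at ha
    obtain ⟨b, hb, rfl⟩ := ha
    have hlt : Ordinal.omega0 ^ (ζ + 1) ≤ Ordinal.omega0 ^ ξ :=
      Ordinal.opow_le_opow_right Ordinal.omega0_pos hζ'.le
    refine lt_of_lt_of_le ?_ hlt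
    exact Ordinal.isPrincipal_add_omega0_opow (ζ + 1)
      ((Ordinal.opow_lt_opow_iff_right Ordinal.one_lt_omega0).2 (lt_add_one ζ)) (h2 b hb)

theorem Gamma_bounds (ξ : Ordinal.{w}) (n : ℕ) (t : List Ordinal.{w}) (ht : t ∈ Gamma ξ n) :
    (∃ a ∈ t, Ordinal.omega0 ^ ξ * (n - 1 : ℕ) ≤ a) ∧ ∀ a ∈ t, a < Ordinal.omega0 ^ ξ * n := by
  obtain ⟨i, -, -, ht⟩ := ht
  exact levelOf_bounds ξ _ (Gamma1_bounds ξ) n i t ht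

theorem Gamma_one (ξ : Ordinal.{w}) : Gamma ξ 1 = Gamma1 ξ := by
  ext t
  constructor
  · rintro ⟨i, h1, h2, ht⟩
    obtain rfl : i = 1 := by omega
    obtain ⟨u, hu, rfl⟩ := ht
    simpa [shift_zero] using hu
  · intro ht
    exact ⟨1, le_rfl, le_rfl, t, ht, by simp [shift_zero]⟩

theorem Gamma_unique (ξ : Ordinal.{w}) {m n : ℕ} {t : List Ordinal.{w}} (hm : 1 ≤ m) (hn : 1 ≤ n)
    (h : t ∈ Gamma ξ m) (h' : t ∈ Gamma ξ n) : m = n := by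
  have key : ∀ {m n : ℕ}, 1 ≤ m → t ∈ Gamma ξ m → t ∈ Gamma ξ n → m ≤ n := by
    intro m n hm h h'
    obtain ⟨a, ha, h1⟩ := (Gamma_bounds ξ m t h).1
    have h2 := (Gamma_bounds ξ n t h').2 a ha
    have h3 := h1.trans_lt h2
    rw [mul_lt_mul_iff_right₀ (Ordinal.opow_pos _ Ordinal.omega0_pos), Nat.cast_lt] at h3
    omega
  exact le_antisymm (key hm h h') (key hn h' h)

theorem weight_one (ξ : Ordinal.{w}) (t : List Ordinal.{w}) : weight ξ 1 t = weight1 ξ t := by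
  simp [weight, weightOf, unshift]

theorem weight_zero : weight (0 : Ordinal.{w}) 1 [0] = 1 := by
  simp [weight_one, weight1]

theorem weight_add_one (η : Ordinal.{w}) (n : ℕ) (hn : 1 ≤ n) (t : List Ordinal.{w})
    (ht : t ∈ Gamma η n) : weight (η + 1) 1 t = (n : ℝ)⁻¹ * weight η n t := by
  have h : sInf {k : ℕ | t ∈ Gamma η k} = n := by
    have hs : {k : ℕ | t ∈ Gamma η k} = {n} := by
      ext k
      constructor
      · intro hk
        have hk1 : 1 ≤ k := by obtain ⟨i, h1, h2, -⟩ := hk; omega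
        exact Gamma_unique η hk1 hn hk ht
      · rintro rfl
        exact ht
    rw [hs]
    simp
  rw [weight_one, weight1, Ordinal.limitRecOn_add_one]
  simp only [h]
  rw [weight, div_eq_inv_mul]
  rfl

theorem weight_limit (ξ : Ordinal.{w}) (hξ : Order.IsSuccLimit ξ) (ζ : Ordinal.{w}) (hζ : ζ < ξ)
    (s : List Ordinal.{w}) (hs : s ∈ Gamma (ζ + 1) 1) :
    weight ξ 1 (shift (Ordinal.omega0 ^ ζ) s) = weight (ζ + 1) 1 s := by
  rw [Gamma_one] at hs
  have key : ∀ {ζ ζ' : Ordinal.{w}} {s s' : List Ordinal.{w}}, s ∈ Gamma1 (ζ + 1) →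
      s' ∈ Gamma1 (ζ' + 1) →
      shift (Ordinal.omega0 ^ ζ) s = shift (Ordinal.omega0 ^ ζ') s' → ζ ≤ ζ' := by
    intro ζ ζ' s s' hs hs' h
    obtain ⟨b, hb⟩ := List.exists_mem_of_ne_nil s (Gamma1_bounds _ s hs).1
    have hb' : Ordinal.omega0 ^ ζ + b ∈ shift (Ordinal.omega0 ^ ζ') s' := by
      rw [← h]
      exact List.mem_map.2 ⟨b, hb, rfl⟩
    obtain ⟨c, hc, hbc⟩ := List.mem_map.1 hb'
    have h1 : Ordinal.omega0 ^ ζ' + c < Ordinal.omega0 ^ (ζ' + 1) :=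
      Ordinal.isPrincipal_add_omega0_opow (ζ' + 1)
        ((Ordinal.opow_lt_opow_iff_right Ordinal.one_lt_omega0).2 (lt_add_one ζ'))
        ((Gamma1_bounds _ s' hs').2 c hc)
    rw [hbc] at h1
    have h2 : Ordinal.omega0 ^ ζ < Ordinal.omega0 ^ (ζ' + 1) :=
      lt_of_le_of_lt (by simp) h1
    rw [Ordinal.opow_lt_opow_iff_right Ordinal.one_lt_omega0] at h2
    exact Order.lt_add_one_iff.1 h2
  have h : sInf {η | ∃ s' ∈ Gamma1 (Order.succ η),
      shift (Ordinal.omega0 ^ ζ) s = shift (Ordinal.omega0 ^ η) s'} = ζ := by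
    have hss : {η | ∃ s' ∈ Gamma1 (Order.succ η),
      shift (Ordinal.omega0 ^ ζ) s = shift (Ordinal.omega0 ^ η) s'} = {ζ} := by
      ext η
      constructor
      · rintro ⟨s', hs', h⟩
        exact le_antisymm (key hs' hs h.symm) (key hs hs' h)
      · rintro rfl
        exact ⟨s, hs, rfl⟩
    rw [hss]
    simp
  rw [weight_one, weight_one, weight1, Ordinal.limitRecOn_limit _ _ _ _ hξ]
  simp only [h]
  rw [dif_pos hζ, unshift_shift]
  rfl

theorem weight_first (ξ : Ordinal.{w}) (n : ℕ) (u : List Ordinal.{w}) :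
    weight ξ (n + 1) (shift (Ordinal.omega0 ^ ξ * n) u) = weight ξ 1 u := by
  rw [weight_one, weight, weightOf, if_pos (by simp [shift]), unshift_shift]

theorem weight_next (ξ : Ordinal.{w}) (n : ℕ) (u s : List Ordinal.{w}) (hs : s ∈ Gamma ξ n) :
    weight ξ (n + 1) (shift (Ordinal.omega0 ^ ξ * n) u ++ s) = weight ξ n s := by
  obtain ⟨⟨a, ha, -⟩, hb⟩ := Gamma_bounds ξ n s hs
  rw [weight, weightOf, if_neg, weight]
  · congr 1
    rw [List.filter_append, List.filter_eq_nil_iff.2, List.filter_eq_self.2]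
    · simp
    · simpa using hb
    · simp [shift]
  · intro h
    exact absurd (h a (List.mem_append_right _ ha)) (not_le.2 (hb a ha))


/-! ### The trees `Γ_{ξ,n}.D` and their cofinal and eventual sets -/

/-- `T.D`: the sequences `(ζ_j, u_j)_j` with `(ζ_j)_j ∈ T` and `u_j ∈ D`. -/
def dot (D : Type u) (T : Set (List Ordinal.{w})) : Set (List (Ordinal.{w} × D)) :=
  {t | t.map Prod.fst ∈ T}

/-- `a + (ζ_j, u_j)_j = (a + ζ_j, u_j)_j`. -/
def shiftD {D : Type u} (a : Ordinal.{w}) (t : List (Ordinal.{w} × D)) :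
    List (Ordinal.{w} × D) :=
  t.map fun q => (a + q.1, q.2)

/-- `MAX(Γ_{ξ,n}.D)`. -/
def maxDot (D : Type u) (ξ : Ordinal.{w}) (n : ℕ) : Set (List (Ordinal.{w} × D)) :=
  maxNodes (dot D (Gamma ξ n))

/-- Membership in `Ω_{ξ,n}`, if `C` is membership in `Ω_{ξ,1}`: `E` is in `Ω_{ξ,n+1}` if the set of
those maximal `u` of `Γ_{ξ,1}.D` such that `{s ∈ MAX(Γ_{ξ,n}.D) | (ω ^ ξ n + u) ⌢ s ∈ E}` is in
`Ω_{ξ,n}`, is in `Ω_{ξ,1}`. -/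
def cofinalOf {D : Type u} (ξ : Ordinal.{w}) (C : Set (List (Ordinal.{w} × D)) → Prop) :
    ℕ → Set (List (Ordinal.{w} × D)) → Prop
  | 0, _ => False
  | 1, E => C E
  | n + 2, E => C {u | u ∈ maxDot D ξ 1 ∧ cofinalOf ξ C (n + 1)
      {s | s ∈ maxDot D ξ (n + 1) ∧ shiftD (Ordinal.omega0 ^ ξ * (n + 1 : ℕ)) u ++ s ∈ E}}

/-- Membership in `Ω_{ξ,1}`, for sets `E` of maximal members of `Γ_{ξ,1}.D`. -/
def cofinal1 (D : Type u) [Preorder D] (ξ : Ordinal.{w}) : Set (List (Ordinal.{w} × D)) → Prop :=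
  Ordinal.limitRecOn (motive := fun _ => Set (List (Ordinal.{w} × D)) → Prop) ξ
    (fun E => IsCofinal {u : D | [((0 : Ordinal.{w}), u)] ∈ E})
    (fun η C E => ∃ M : Set ℕ, IsCofinal M ∧
      ∀ n ∈ M, 1 ≤ n → cofinalOf η C n (E ∩ dot D (Gamma η n)))
    (fun ξ hξ C E => ∃ M : Set Ordinal.{w}, (∀ η < ξ, ∃ ζ ∈ M, η ≤ ζ ∧ ζ < ξ) ∧
      ∀ ζ ∈ M, ∀ h : ζ < ξ, C (Order.succ ζ) (hξ.succ_lt h)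
        {s | s ∈ maxDot D (Order.succ ζ) 1 ∧ shiftD (Ordinal.omega0 ^ ζ) s ∈ E})

/-- `E` is a cofinal subset of `MAX(Γ_{ξ,n}.D)`, i.e. `E ∈ Ω_{ξ,n}`. -/
def IsCofinalIn (D : Type u) [Preorder D] (ξ : Ordinal.{w}) (n : ℕ)
    (E : Set (List (Ordinal.{w} × D))) : Prop :=
  E ⊆ maxDot D ξ n ∧ cofinalOf ξ (cofinal1 D ξ) n E

/-- `E` is an eventual subset of `MAX(Γ_{ξ,n}.D)`: its complement is not cofinal. -/
def IsEventualIn (D : Type u) [Preorder D] (ξ : Ordinal.{w}) (n : ℕ)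
    (E : Set (List (Ordinal.{w} × D))) : Prop :=
  E ⊆ maxDot D ξ n ∧ ¬ IsCofinalIn D ξ n (maxDot D ξ n \ E)

/-! ### Weakly null trees and the quantities `α` and `θ` -/

section Quantities

variable (𝕜 : Type v) [RCLike 𝕜] {X : Type u} [NormedAddCommGroup X] [NormedSpace 𝕜 X]

/-- `(x_t)_{t ∈ Γ_{ξ,n}.D}` is weakly null: whenever the sequences `s ⌢ (ζ, u)`, `u ∈ D`, are
members of the tree, `(x_{s ⌢ (ζ, u)})_{u ∈ D}` is a weakly null net. -/
def IsWeaklyNull {D : Type u} [Preorder D] (ξ : Ordinal.{w}) (n : ℕ)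
    (x : List (Ordinal.{w} × D) → X) : Prop :=
  ∀ (s : List (Ordinal.{w} × D)) (ζ : Ordinal.{w}), s.map Prod.fst ++ [ζ] ∈ Gamma ξ n →
    ∀ f : StrongDual 𝕜 X, Tendsto (fun u : D => f (x (s ++ [(ζ, u)]))) atTop (𝓝 0)

/-- `(x_t)_{t ∈ Γ_{ξ,n}.D}` is contained in the closed unit ball. -/
def InUnitBall {D : Type u} (ξ : Ordinal.{w}) (n : ℕ) (x : List (Ordinal.{w} × D) → X) : Prop :=
  ∀ t ∈ dot D (Gamma ξ n), ‖x t‖ ≤ 1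

/-- `z_i^t = ∑_{Λ_{ξ,n,i}.D ∋ s ≤ t} ℙ_{ξ,n}(s) x_s`. -/
def zvec {D : Type u} (ξ : Ordinal.{w}) (n i : ℕ) (x : List (Ordinal.{w} × D) → X)
    (t : List (Ordinal.{w} × D)) : X :=
  open Classical in
  ∑ k ∈ Finset.range t.length,
    if t.take (k + 1) ∈ dot D (Lambda ξ n i) then
      ((weight ξ n ((t.take (k + 1)).map Prod.fst) : ℝ) : 𝕜) • x (t.take (k + 1))
    else 0

variable {𝕜}

/-- `r_K(x) = max_{x* ∈ K} Re x*(x)`, with value `0` if `K` is empty. -/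
def rK (K : Set (StrongDual 𝕜 X)) (x : X) : ℝ := sSup ((fun f : StrongDual 𝕜 X => RCLike.re (f x)) '' K)

/-- `α_{ξ,γ,n}(K)`. The level `i` of the tree is `Λ_{ξ,n,i+1}`, for `i : Fin n`. -/
def alphaN (ξ : Ordinal.{w}) (γ : ℝ≥0∞) (n : ℕ) (K : Set (StrongDual 𝕜 X)) : ℝ≥0∞ :=
  sInf {c : ℝ≥0∞ | ∃ α : ℝ, 0 < α ∧ c = ENNReal.ofReal α ∧
    ∀ (D : Type u) [Preorder D] [IsDirectedOrder D] [Nonempty D] (a : Fin n → 𝕜)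
      (x : List (Ordinal.{w} × D) → X), IsWeaklyNull 𝕜 ξ n x → InUnitBall ξ n x →
      (⨅ t : maxDot D ξ n, rK K (∑ i : Fin n, a i • zvec 𝕜 ξ n (i + 1) x t)) ≤
        α * ‖(WithLp.toLp γ a : PiLp γ fun _ : Fin n => 𝕜)‖}

/-- `α_{ξ,γ}(K) = sup_n α_{ξ,γ,n}(K)`. -/
def alpha (ξ : Ordinal.{w}) (γ : ℝ≥0∞) (K : Set (StrongDual 𝕜 X)) : ℝ≥0∞ :=
  ⨆ (n : ℕ) (_ : 1 ≤ n), alphaN ξ γ n K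

/-- `θ_{ξ,n}(K)`. -/
def theta (ξ : Ordinal.{w}) (n : ℕ) (K : Set (StrongDual 𝕜 X)) : ℝ≥0∞ :=
  sInf {c : ℝ≥0∞ | ∃ θ : ℝ, 0 < θ ∧ c = ENNReal.ofReal θ ∧
    ∀ (D : Type u) [Preorder D] [IsDirectedOrder D] [Nonempty D]
      (x : List (Ordinal.{w} × D) → X), IsWeaklyNull 𝕜 ξ n x → InUnitBall ξ n x →
      (⨅ t : maxDot D ξ n, rK K (∑ i : Fin n, (n : 𝕜)⁻¹ • zvec 𝕜 ξ n (i + 1) x t)) ≤ θ}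

/-- `A^* B_{Y^*}`. The quantities `α` and `θ` of an operator `A` are those of this set. -/
def dualBall {Y : Type*} [NormedAddCommGroup Y] [NormedSpace 𝕜 Y] (A : X →L[𝕜] Y) :
    Set (StrongDual 𝕜 X) :=
  {f | ∃ g : StrongDual 𝕜 Y, ‖g‖ ≤ 1 ∧ f = g.comp A}

end Quantities

/-! ### Diagonal operators between direct sums -/

section Diagonal

variable {𝕜 : Type v} [RCLike 𝕜] {ι : Type u} {X Y : ι → Type u}
  [∀ l, NormedAddCommGroup (X l)] [∀ l, NormedSpace 𝕜 (X l)]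
  [∀ l, NormedAddCommGroup (Y l)] [∀ l, NormedSpace 𝕜 (Y l)]

/-- For finite `Υ ⊆ ι`, the operator `D_Υ^{p,r}` from the `ℓ_p` sum of the `X l` to the `ℓ_r` sum of
the `Y l`, which maps `(x_l)_l` to `(1_Υ(l) A_l x_l)_l`; see `diagOp_apply`. -/
def diagOp (p r : ℝ≥0∞) [Fact (1 ≤ p)] [Fact (1 ≤ r)] (A : ∀ l, X l →L[𝕜] Y l) (Υ : Finset ι) :
    lp X p →L[𝕜] lp Y r :=
  open Classical in
  ∑ l ∈ Υ, (lp.singleContinuousLinearMap 𝕜 Y r l).comp ((A l).comp (lp.evalCLM 𝕜 X p l))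

open Classical in
theorem diagOp_apply (p r : ℝ≥0∞) [Fact (1 ≤ p)] [Fact (1 ≤ r)] (A : ∀ l, X l →L[𝕜] Y l)
    (Υ : Finset ι) (x : lp X p) (l : ι) :
    (diagOp p r A Υ x : ∀ l, Y l) l = if l ∈ Υ then A l (x l) else 0 := by
  simp only [diagOp, _root_.sum_apply, ContinuousLinearMap.comp_apply,
    lp.singleContinuousLinearMap_apply, lp.coeFn_sum, Finset.sum_apply, lp.single_apply]
  rw [Finset.sum_pi_single]
  rfl

end Diagonal

end SzTree

end

open SzTree

/-! ### Block structure of the trees of ordinals -/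

noncomputable section

namespace SzTree

/-! The proof trades statements about branches of weakly null trees for ordinal ranks. Fix the
filter of weak neighbourhoods of 0 and a set T of finite sequences of labelled points, closed under
subsequences. The derivation `Der` of order α keeps the sequences of T that can be extended, for
every β < α, by frequently many points within the derivation of order β. If the empty sequence
survives, a recursive choice of points yields a weakly null tree each of whose branches consists of
points of a sequence of T (`exists_tree_of_mem_IterDer`). Conversely, if cofinally many branches of
a given tree have, on prescribed levels, subsequences of mass at least δ that together belong to T,
then the empty sequence survives one derivation of order ω^ξ per prescribed level (`derivesAt`,
`nil_mem_IterDer_of`). The latter is an induction on ξ. At a successor, a branch of Γ_{η,n} that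
carries mass δ has at least nδ/2 levels that carry δ/2, and the pattern of these levels can be fixed
because cofinal sets are stable under finite partitions.

Hence a cofinal failure of a norm estimate stabilises (`exists_stable`). Norm the combination by
functionals, round their values on the averages, and keep the heavy part of each level. The outcome
is a new tree on which one functional per branch is at least c_i on level i, with the sum of the c_i
almost as large as the original norms, and on which a prescribed finite colouring is constant on
each level. Derivations may be omitted, so any selection of levels also carries such a tree. If
θ_{ζ,m} ≤ ε, at most m levels can have c_i > ε b_i; there c_i ≤ R b_i, and Hölder's inequality gives
the bound of (i) and (ii) for a single operator (`eventualBound_of_theta_le`). A bound on α becomes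
an eventual bound in the same way (`eventualBound_of_alphaN_le`).

For a diagonal operator the colour of a vector records its rounded coordinate norms
(`eventualBound_diagOp`). On the stable tree the l-th coordinate has size at most d_{l,i} on level
i, where the column of i has ℓ_p norm at most 1 + τ. Rescaled coordinate estimates hold eventually,
hence on a common branch, and mixed Minkowski and Hölder inequalities combine them. The lower bound
in (iii) for γ ≤ r comes from embedding a summand. For γ > r, stable sets for A_l and for the
remaining coordinates are placed on successive levels (`exists_tree_append`), and the coefficients
of equality in Hölder's inequality give superadditivity of the s-th powers, summed by induction on
Υ. -/

theorem Lambda_first {ξ : Ordinal.{w}} {n : ℕ} {t : List Ordinal.{w}} :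
    t ∈ Lambda ξ (n + 1) 1 ↔ ∃ u ∈ Gamma1 ξ, t = shift (Ordinal.omega0 ^ ξ * n) u := Iff.rfl

theorem Lambda_next {ξ : Ordinal.{w}} {n i : ℕ} {t : List Ordinal.{w}} :
    t ∈ Lambda ξ (n + 1) (i + 2) ↔ ∃ u ∈ maxNodes (Gamma1 ξ), ∃ s ∈ Lambda ξ n (i + 1),
      t = shift (Ordinal.omega0 ^ ξ * n) u ++ s := Iff.rfl

theorem mem_Gamma_iff {ξ : Ordinal.{w}} {n : ℕ} {t : List Ordinal.{w}} :
    t ∈ Gamma ξ n ↔ ∃ i, 1 ≤ i ∧ i ≤ n ∧ t ∈ Lambda ξ n i := Iff.rfl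

theorem Gamma_nat_zero {ξ : Ordinal.{w}} {t : List Ordinal.{w}} : t ∉ Gamma ξ 0 := by
  rintro ⟨i, h1, h2, -⟩
  omega

/-- Trades the union over levels for a recursion on n: removing the first block lowers the level by
one. The inductions over n use this form. -/
theorem mem_Gamma_succ {ξ : Ordinal.{w}} {n : ℕ} {t : List Ordinal.{w}} :
    t ∈ Gamma ξ (n + 1) ↔ (∃ u ∈ Gamma1 ξ, t = shift (Ordinal.omega0 ^ ξ * n) u) ∨
      ∃ u ∈ maxNodes (Gamma1 ξ), ∃ s ∈ Gamma ξ n, t = shift (Ordinal.omega0 ^ ξ * n) u ++ s := by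
  rw [mem_Gamma_iff]
  constructor
  · rintro ⟨i, h1, h2, ht⟩
    match i, h1, ht with
    | 1, _, ht => exact Or.inl (Lambda_first.1 ht)
    | i + 2, _, ht =>
      obtain ⟨u, hu, s, hs, rfl⟩ := Lambda_next.1 ht
      exact Or.inr ⟨u, hu, s, ⟨i + 1, by omega, by omega, hs⟩, rfl⟩
  · rintro (h | ⟨u, hu, s, ⟨i, h1, h2, hs⟩, rfl⟩)
    · exact ⟨1, le_rfl, by omega, Lambda_first.2 h⟩
    · obtain ⟨i, rfl⟩ : ∃ j, i = j + 1 := ⟨i - 1, by omega⟩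
      exact ⟨i + 2, by omega, by omega, Lambda_next.2 ⟨u, hu, s, hs, rfl⟩⟩

theorem shift_injective (a : Ordinal.{w}) : Function.Injective (shift a) :=
  Function.LeftInverse.injective (unshift_shift a)

theorem le_of_mem_shift {a b : Ordinal.{w}} {t : List Ordinal.{w}} (h : b ∈ shift a t) : a ≤ b := by
  obtain ⟨c, -, rfl⟩ := List.mem_map.1 h
  exact le_self_add

theorem Gamma_lt {ξ : Ordinal.{w}} {n : ℕ} {t : List Ordinal.{w}} (ht : t ∈ Gamma ξ n) :
    ∀ a ∈ t, a < Ordinal.omega0 ^ ξ * n := (Gamma_bounds ξ n t ht).2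

theorem Gamma_ne_nil {ξ : Ordinal.{w}} {n : ℕ} {t : List Ordinal.{w}} (ht : t ∈ Gamma ξ n) :
    t ≠ [] := by
  obtain ⟨⟨a, ha, -⟩, -⟩ := Gamma_bounds ξ n t ht
  exact List.ne_nil_of_mem ha

/-- The entries of a sequence in the first level, and in the other levels, are separated. -/
theorem prefix_of_shift_append_prefix {a : Ordinal.{w}} {u u' s s' : List Ordinal.{w}}
    (hs : ∀ b ∈ s, b < a) (hs' : ∀ b ∈ s', b < a) (h : shift a u ++ s <+: shift a u' ++ s') :
    u <+: u' ∧ (u = u' → s <+: s') := by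
  -- Keeping the entries that are at least a recovers the first block, because the tails lie below
  -- a.
  have hf : ∀ (v r : List Ordinal.{w}), (∀ b ∈ r, b < a) →
      (shift a v ++ r).filter (a ≤ ·) = shift a v := by
    intro v r hr
    rw [List.filter_append, List.filter_eq_self.2, List.filter_eq_nil_iff.2]
    · simp
    · simpa using hr
    · simpa using fun b hb => le_of_mem_shift hb
  constructor
  · have := h.filter (a ≤ ·)
    rw [hf u s hs, hf u' s' hs'] at this
    have h2 := this.map (· - a)
    change unshift a _ <+: unshift a _ at h2
    rwa [unshift_shift, unshift_shift] at h2
  · rintro rfl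
    exact (List.prefix_append_right_inj _).1 h

theorem shift_append_inj {a : Ordinal.{w}} {u u' s s' : List Ordinal.{w}}
    (hs : ∀ b ∈ s, b < a) (hs' : ∀ b ∈ s', b < a) (h : shift a u ++ s = shift a u' ++ s') :
    u = u' ∧ s = s' := by
  have h1 := (prefix_of_shift_append_prefix hs hs' ⟨[], (List.append_nil _).trans h⟩).1
  have h2 := prefix_of_shift_append_prefix hs' hs ⟨[], (List.append_nil _).trans h.symm⟩
  have h3 : u = u' := h1.eq_of_length_le h2.1.length_le
  exact ⟨h3, by subst h3; exact List.append_cancel_left h⟩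

/-- Conditional on the case n = 1 because Γ_{ξ+1,1} is made of the sets Γ_{ξ,n}: the transfinite
induction on ξ calls it at successors. The other lemmas ending in `_of` are conditional for the same
reason. -/
theorem Gamma_pairwise_of (ξ : Ordinal.{w})
    (h1 : ∀ t ∈ Gamma1 ξ, t.Pairwise (· > ·)) (n : ℕ) :
    ∀ t ∈ Gamma ξ n, t.Pairwise (· > ·) := by
  induction n with
  | zero => exact fun t ht => absurd ht Gamma_nat_zero
  | succ n ih =>
    intro t ht
    have hsh : ∀ u ∈ Gamma1 ξ, (shift (Ordinal.omega0 ^ ξ * n) u).Pairwise (· > ·) := by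
      intro u hu
      rw [shift, List.pairwise_map]
      exact (h1 u hu).imp fun h => by simpa using h
    rcases mem_Gamma_succ.1 ht with ⟨u, hu, rfl⟩ | ⟨u, hu, s, hs, rfl⟩
    · exact hsh u hu
    · rw [List.pairwise_append]
      exact ⟨hsh u hu.1, ih s hs, fun a ha b hb => (Gamma_lt hs b hb).trans_le (le_of_mem_shift ha)⟩

theorem Gamma1_pairwise (ξ : Ordinal.{w}) : ∀ t ∈ Gamma1 ξ, t.Pairwise (· > ·) := by
  induction ξ using Ordinal.limitRecOn with
  | zero => simp [Gamma1_zero]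
  | add_one η ih =>
    intro t ht
    rw [Gamma1_add_one] at ht
    obtain ⟨n, hn, ht⟩ := ht
    exact Gamma_pairwise_of η ih n t ht
  | limit ξ hξ ih =>
    intro t ht
    rw [Gamma1_limit ξ hξ] at ht
    obtain ⟨ζ, hζ, s, hs, rfl⟩ := ht
    rw [shift, List.pairwise_map]
    exact (ih _ (hξ.succ_lt hζ) s hs).imp fun h => by simpa using h

theorem Gamma_pairwise {ξ : Ordinal.{w}} {n : ℕ} {t : List Ordinal.{w}} (ht : t ∈ Gamma ξ n) :
    t.Pairwise (· > ·) := Gamma_pairwise_of ξ (Gamma1_pairwise ξ) n t ht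

theorem prefix_append_cases {α : Type*} {s t r : List α} (h : r <+: s ++ t) :
    r <+: s ∨ ∃ t', t' ≠ [] ∧ t' <+: t ∧ r = s ++ t' := by
  rcases List.prefix_or_prefix_of_prefix h (List.prefix_append s t) with h' | ⟨t', rfl⟩
  · exact Or.inl h'
  · rcases eq_or_ne t' [] with rfl | h0
    · exact Or.inl (by simp)
    · exact Or.inr ⟨t', h0, (List.prefix_append_right_inj _).1 h, rfl⟩

theorem Gamma_prefix_of (ξ : Ordinal.{w})
    (h1 : ∀ t ∈ Gamma1 ξ, ∀ s, s <+: t → s ≠ [] → s ∈ Gamma1 ξ) (n : ℕ) :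
    ∀ t ∈ Gamma ξ n, ∀ s, s <+: t → s ≠ [] → s ∈ Gamma ξ n := by
  have hsh : ∀ (a : Ordinal.{w}), ∀ u ∈ Gamma1 ξ, ∀ r, r <+: shift a u → r ≠ [] →
      ∃ u' ∈ Gamma1 ξ, r = shift a u' := by
    intro a u hu r hr hr0
    obtain ⟨u', hu', rfl⟩ := List.prefix_map_iff.1 hr
    exact ⟨u', h1 u hu u' hu' (by rintro rfl; exact hr0 rfl), rfl⟩
  induction n with
  | zero => exact fun t ht => absurd ht Gamma_nat_zero
  | succ n ih =>
    intro t ht r hr hr0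
    rw [mem_Gamma_succ]
    rcases mem_Gamma_succ.1 ht with ⟨u, hu, rfl⟩ | ⟨u, hu, s, hs, rfl⟩
    · exact Or.inl (hsh _ u hu r hr hr0)
    · rcases prefix_append_cases hr with h | ⟨s', hs'0, hs', rfl⟩
      · exact Or.inl (hsh _ u hu.1 r h hr0)
      · exact Or.inr ⟨u, hu, s', ih s hs s' hs' hs'0, rfl⟩

theorem Gamma1_prefix (ξ : Ordinal.{w}) :
    ∀ t ∈ Gamma1 ξ, ∀ s, s <+: t → s ≠ [] → s ∈ Gamma1 ξ := by
  induction ξ using Ordinal.limitRecOn with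
  | zero =>
    intro t ht s hs hs0
    rw [Gamma1_zero, mem_singleton_iff] at *
    subst ht
    exact hs.eq_of_length_le (by simpa [Nat.succ_le_iff] using List.length_pos_iff.2 hs0)
  | add_one η ih =>
    intro t ht s hs hs0
    rw [Gamma1_add_one] at *
    obtain ⟨n, hn, ht⟩ := ht
    exact ⟨n, hn, Gamma_prefix_of η ih n t ht s hs hs0⟩
  | limit ξ hξ ih =>
    intro t ht r hr hr0
    rw [Gamma1_limit ξ hξ] at *
    obtain ⟨ζ, hζ, s, hs, rfl⟩ := ht
    obtain ⟨s', hs', rfl⟩ := List.prefix_map_iff.1 hr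
    exact ⟨ζ, hζ, s', ih _ (hξ.succ_lt hζ) s hs s' hs' (by rintro rfl; exact hr0 rfl), rfl⟩

theorem Gamma_prefix {ξ : Ordinal.{w}} {n : ℕ} {t s : List Ordinal.{w}} (ht : t ∈ Gamma ξ n)
    (hs : s <+: t) (hs0 : s ≠ []) : s ∈ Gamma ξ n :=
  Gamma_prefix_of ξ (Gamma1_prefix ξ) n t ht s hs hs0

/-- The last entry alone reveals the level, since each block occupies its own interval of length
ω^ξ, counted from the top. Labels and scaling factors can therefore be functions of the last
ordinal. -/
theorem Lambda_last {ξ : Ordinal.{w}} {n i : ℕ} {s : List Ordinal.{w}} {ζ : Ordinal.{w}}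
    (h : s ++ [ζ] ∈ Lambda ξ n (i + 1)) :
    i < n ∧ ∃ ρ < Ordinal.omega0 ^ ξ, ζ = Ordinal.omega0 ^ ξ * (n - 1 - i : ℕ) + ρ := by
  induction n generalizing i s with
  | zero => simp [Lambda, levelOf] at h
  | succ n ih =>
    match i, h with
    | 0, h =>
      obtain ⟨u, hu, hs⟩ := Lambda_first.1 h
      have hζ : ζ ∈ shift (Ordinal.omega0 ^ ξ * n) u := by rw [← hs]; simp
      obtain ⟨ρ, hρ, rfl⟩ := List.mem_map.1 hζ
      exact ⟨by omega, ρ, (Gamma1_bounds ξ u hu).2 ρ hρ, by simp⟩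
    | i + 1, h =>
      obtain ⟨u, hu, r, hr, hs⟩ := Lambda_next.1 h
      have hin : i < n := by
        by_contra hin
        -- Levels past the n-th are empty, which the recursive definition shows only after n
        -- unfoldings.
        have : ∀ (n i : ℕ), n ≤ i → ∀ r, r ∉ Lambda ξ n (i + 1) := by
          intro n
          induction n with
          | zero => intro i _ r hr; simp [Lambda, levelOf] at hr
          | succ n ih =>
            intro i hi r hr
            obtain ⟨i, rfl⟩ : ∃ j, i = j + 1 := ⟨i - 1, by omega⟩
            obtain ⟨u, -, r', hr', -⟩ := Lambda_next.1 hr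
            exact ih i (by omega) r' hr'
        exact this n i (by omega) r hr
      have hr0 : r ≠ [] := Gamma_ne_nil (mem_Gamma_iff.2 ⟨i + 1, by omega, by omega, hr⟩)
      obtain ⟨r', b, rfl⟩ : ∃ r' b, r = r' ++ [b] := by
        rcases List.eq_nil_or_concat r with h | ⟨r', b, h⟩
        · exact absurd h hr0
        · exact ⟨r', b, by simpa using h⟩
      rw [← List.append_assoc] at hs
      obtain ⟨-, rfl⟩ : _ ∧ ζ = b := by simpa using List.append_inj' hs rfl
      obtain ⟨-, ρ, hρ, h⟩ := ih hr
      exact ⟨by omega, ρ, hρ, by rw [h]; congr 3; omega⟩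

/-! ### Maximal members -/

theorem maxNodes_shift_append {ξ : Ordinal.{w}} {n : ℕ} {u s : List Ordinal.{w}}
    (hu : u ∈ maxNodes (Gamma1 ξ)) (hs : s ∈ maxNodes (Gamma ξ n)) :
    shift (Ordinal.omega0 ^ ξ * n) u ++ s ∈ maxNodes (Gamma ξ (n + 1)) := by
  refine ⟨mem_Gamma_succ.2 (Or.inr ⟨u, hu, s, hs.1, rfl⟩), ?_⟩
  intro t ht hst
  rcases mem_Gamma_succ.1 ht with ⟨u', hu', rfl⟩ | ⟨u', hu', s', hs', rfl⟩
  · exfalso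
    obtain ⟨b, hb⟩ := List.exists_mem_of_ne_nil s (Gamma_ne_nil hs.1)
    exact absurd (Gamma_lt hs.1 b hb) (not_lt.2 (le_of_mem_shift
      (hst.subset (List.mem_append_right _ hb))))
  · obtain ⟨h1, h2⟩ := prefix_of_shift_append_prefix (Gamma_lt hs.1) (Gamma_lt hs') hst
    obtain rfl := hu.2 u' hu'.1 h1
    rw [hs.2 s' hs' (h2 rfl)]

theorem Gamma_nonempty_of (ξ : Ordinal.{w}) (h : (maxNodes (Gamma1 ξ)).Nonempty) (n : ℕ) :
    (maxNodes (Gamma ξ (n + 1))).Nonempty := by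
  induction n with
  | zero => rwa [zero_add, Gamma_one]
  | succ n ih =>
    obtain ⟨u, hu⟩ := h
    obtain ⟨s, hs⟩ := ih
    exact ⟨_, maxNodes_shift_append hu hs⟩

/-- Extensions cannot leave Γ_{η,n}: by closure under initial segments t would also lie in the other
set Γ_{η,m}, and these sets are disjoint. -/
theorem maxNodes_Gamma_succ_subset (η : Ordinal.{w}) {n : ℕ} {t : List Ordinal.{w}} (hn : 1 ≤ n)
    (ht : t ∈ maxNodes (Gamma η n)) : t ∈ maxNodes (Gamma1 (η + 1)) := by
  rw [Gamma1_add_one]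
  refine ⟨⟨n, hn, ht.1⟩, ?_⟩
  rintro s ⟨m, hm, hs⟩ hts
  have : t ∈ Gamma η m := Gamma_prefix hs hts (Gamma_ne_nil ht.1)
  obtain rfl := Gamma_unique η hm hn this ht.1
  exact ht.2 s hs hts

theorem maxNodes_of_mem_Gamma {η : Ordinal.{w}} {n : ℕ} {t : List Ordinal.{w}} (hn : 1 ≤ n)
    (ht : t ∈ maxNodes (Gamma1 (η + 1))) (h : t ∈ Gamma η n) : t ∈ maxNodes (Gamma η n) :=
  ⟨h, fun s hs hts => ht.2 s (by rw [Gamma1_add_one]; exact ⟨n, hn, hs⟩) hts⟩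

/-- The first entry lies in [ω^ζ, ω^(ζ+1)), and these intervals are disjoint for distinct ζ. -/
theorem eq_of_shift_mem {ζ ζ' : Ordinal.{w}} {s s' : List Ordinal.{w}} (hs : s ∈ Gamma1 (ζ + 1))
    (hs' : s' ∈ Gamma1 (ζ' + 1)) {r : List Ordinal.{w}}
    (h : shift (Ordinal.omega0 ^ ζ) s <+: r) (h' : shift (Ordinal.omega0 ^ ζ') s' <+: r) :
    ζ = ζ' := by
  have key : ∀ {ζ ζ' : Ordinal.{w}} {b c : Ordinal.{w}}, c < Ordinal.omega0 ^ (ζ' + 1) →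
      Ordinal.omega0 ^ ζ + b = Ordinal.omega0 ^ ζ' + c → ζ ≤ ζ' := by
    intro ζ ζ' b c hc hbc
    have h1 : Ordinal.omega0 ^ ζ' + c < Ordinal.omega0 ^ (ζ' + 1) :=
      Ordinal.isPrincipal_add_omega0_opow (ζ' + 1)
        ((Ordinal.opow_lt_opow_iff_right Ordinal.one_lt_omega0).2 (lt_add_one ζ')) hc
    rw [← hbc] at h1
    have h2 : Ordinal.omega0 ^ ζ < Ordinal.omega0 ^ (ζ' + 1) := lt_of_le_of_lt (by simp) h1
    rw [Ordinal.opow_lt_opow_iff_right Ordinal.one_lt_omega0] at h2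
    exact Order.lt_add_one_iff.1 h2
  obtain ⟨b, s, rfl⟩ := List.exists_cons_of_ne_nil (Gamma1_bounds _ s hs).1
  obtain ⟨c, s', rfl⟩ := List.exists_cons_of_ne_nil (Gamma1_bounds _ s' hs').1
  have hb := (Gamma1_bounds _ _ hs).2 b List.mem_cons_self
  have hc := (Gamma1_bounds _ _ hs').2 c List.mem_cons_self
  obtain ⟨r1, rfl⟩ := h
  simp only [shift, List.map_cons, List.cons_append, List.cons_prefix_cons] at h'
  exact le_antisymm (key hc h'.1.symm) (key hb h'.1)

theorem maxNodes_shift_limit {ξ ζ : Ordinal.{w}} (hξ : Order.IsSuccLimit ξ) (hζ : ζ < ξ)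
    {s : List Ordinal.{w}} : shift (Ordinal.omega0 ^ ζ) s ∈ maxNodes (Gamma1 ξ) ∧
      s ∈ Gamma1 (ζ + 1) ↔ s ∈ maxNodes (Gamma1 (ζ + 1)) := by
  have hmem : ∀ r ∈ Gamma1 (ζ + 1), shift (Ordinal.omega0 ^ ζ) r ∈ Gamma1 ξ := by
    intro r hr
    rw [Gamma1_limit ξ hξ]
    exact ⟨ζ, hζ, r, hr, rfl⟩
  constructor
  · rintro ⟨h1, h2⟩
    refine ⟨h2, fun r hr hsr => ?_⟩
    exact shift_injective _ (h1.2 _ (hmem r hr) (hsr.map _))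
  · intro hs
    refine ⟨⟨hmem s hs.1, fun t ht hst => ?_⟩, hs.1⟩
    rw [Gamma1_limit ξ hξ] at ht
    obtain ⟨ζ', hζ', s', hs', rfl⟩ := ht
    obtain rfl := eq_of_shift_mem hs.1 hs' hst List.prefix_rfl
    have := hst.map (· - Ordinal.omega0 ^ ζ)
    change unshift _ _ <+: unshift _ _ at this
    rw [unshift_shift, unshift_shift] at this
    rw [hs.2 s' hs' this]

theorem maxNodes_Gamma1_nonempty (ξ : Ordinal.{w}) : (maxNodes (Gamma1 ξ)).Nonempty := by
  induction ξ using Ordinal.limitRecOn with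
  | zero => exact ⟨[0], by simp [Gamma1_zero], by simp [Gamma1_zero]⟩
  | add_one η ih =>
    obtain ⟨t, ht⟩ := Gamma_nonempty_of η ih 0
    exact ⟨t, maxNodes_Gamma_succ_subset η le_rfl ht⟩
  | limit ξ hξ ih =>
    have h0 : 0 < ξ := hξ.bot_lt
    obtain ⟨t, ht⟩ := ih (0 + 1) (hξ.succ_lt h0)
    exact ⟨_, ((maxNodes_shift_limit hξ h0).2 ht).1⟩

theorem maxNodes_Gamma_nonempty (ξ : Ordinal.{w}) {n : ℕ} (hn : 1 ≤ n) :
    (maxNodes (Gamma ξ n)).Nonempty := by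
  obtain ⟨n, rfl⟩ : ∃ m, n = m + 1 := ⟨n - 1, by omega⟩
  exact Gamma_nonempty_of ξ (maxNodes_Gamma1_nonempty ξ) n

/-- A lone first block is never maximal when n ≥ 1: even if it comes from a maximal member of
Γ_{ξ,1}, a member of Γ_{ξ,n} can be appended. -/
theorem exists_of_mem_maxNodes {ξ : Ordinal.{w}} {n : ℕ} (hn : 1 ≤ n) {t : List Ordinal.{w}}
    (ht : t ∈ maxNodes (Gamma ξ (n + 1))) : ∃ u ∈ maxNodes (Gamma1 ξ),
      ∃ s ∈ maxNodes (Gamma ξ n), t = shift (Ordinal.omega0 ^ ξ * n) u ++ s := by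
  rcases mem_Gamma_succ.1 ht.1 with ⟨u, hu, rfl⟩ | ⟨u, hu, s, hs, rfl⟩
  · exfalso
    have humax : u ∈ maxNodes (Gamma1 ξ) := by
      refine ⟨hu, fun u' hu' huu' => ?_⟩
      exact shift_injective _ (ht.2 _ (mem_Gamma_succ.2 (Or.inl ⟨u', hu', rfl⟩)) (huu'.map _))
    obtain ⟨s, hs⟩ := maxNodes_Gamma_nonempty ξ hn
    have := ht.2 _ (mem_Gamma_succ.2 (Or.inr ⟨u, humax, s, hs.1, rfl⟩)) (List.prefix_append _ _)
    exact Gamma_ne_nil hs.1 (List.append_right_eq_self.1 this)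
  · refine ⟨u, hu, s, ⟨hs, fun s' hs' hss' => ?_⟩, rfl⟩
    exact List.append_cancel_left (ht.2 _ (mem_Gamma_succ.2 (Or.inr ⟨u, hu, s', hs', rfl⟩))
      ((List.prefix_append_right_inj _).2 hss'))

/-! ### Weights -/

theorem weightOf_nonneg {ξ : Ordinal.{w}} {W : List Ordinal.{w} → ℝ} (hW : ∀ t, 0 ≤ W t) (n : ℕ) :
    ∀ t, 0 ≤ weightOf ξ W n t := by
  induction n with
  | zero => intro t; simp [weightOf]
  | succ n ih =>
    intro t
    rw [weightOf]
    split_ifs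
    · exact hW _
    · exact ih _

theorem weight1_nonneg (ξ : Ordinal.{w}) : ∀ t, 0 ≤ weight1 ξ t := by
  induction ξ using Ordinal.limitRecOn with
  | zero => intro t; simp [weight1]
  | add_one η ih =>
    intro t
    rw [weight1, Ordinal.limitRecOn_add_one]
    exact div_nonneg (weightOf_nonneg ih _ _) (Nat.cast_nonneg _)
  | limit ξ hξ ih =>
    intro t
    rw [weight1, Ordinal.limitRecOn_limit _ _ _ _ hξ]
    dsimp only
    split_ifs with h
    · exact ih _ (hξ.succ_lt h) _
    · exact le_rfl

theorem weight_nonneg (ξ : Ordinal.{w}) (n : ℕ) (t : List Ordinal.{w}) : 0 ≤ weight ξ n t :=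
  weightOf_nonneg (weight1_nonneg ξ) n t

end SzTree

end

noncomputable section

namespace SzTree

variable {D : Type u} {X : Type*}

/-! ### Sequences of pairs -/

theorem map_fst_shiftD (a : Ordinal.{w}) (t : List (Ordinal.{w} × D)) :
    (shiftD a t).map Prod.fst = shift a (t.map Prod.fst) := by
  simp [shiftD, shift]

theorem exists_shiftD {a : Ordinal.{w}} {t : List (Ordinal.{w} × D)} {u : List Ordinal.{w}}
    (h : t.map Prod.fst = shift a u) : ∃ v : List (Ordinal.{w} × D), t = shiftD a v ∧
      v.map Prod.fst = u := by
  have h2 : unshift a (t.map Prod.fst) = u := by rw [h, unshift_shift]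
  refine ⟨t.map fun q => (q.1 - a, q.2), ?_, by rw [← h2]; simp [unshift]⟩
  simp only [shiftD, List.map_map]
  refine (List.map_id t).symm.trans (List.map_congr_left fun q hq => ?_)
  have : a ≤ q.1 := le_of_mem_shift (h ▸ List.mem_map_of_mem hq)
  simp [Ordinal.add_sub_cancel_of_le this]

theorem mem_dot {T : Set (List Ordinal.{w})} {t : List (Ordinal.{w} × D)} :
    t ∈ dot D T ↔ t.map Prod.fst ∈ T := Iff.rfl

/-- An extension of the ordinals lifts to an extension of the pairs by attaching one arbitrary
element of D. -/
theorem maxNodes_dot [Nonempty D] (T : Set (List Ordinal.{w})) :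
    maxNodes (dot D T) = dot D (maxNodes T) := by
  ext t
  constructor
  · rintro ⟨h1, h2⟩
    refine ⟨h1, ?_⟩
    rintro s hs ⟨r, rfl⟩
    obtain ⟨d⟩ := ‹Nonempty D›
    have := h2 (t ++ r.map fun a => (a, d)) (by simpa [mem_dot, Function.comp_def] using hs)
      (List.prefix_append _ _)
    simpa using this
  · rintro ⟨h1, h2⟩
    refine ⟨h1, fun s hs hts => (hts.eq_of_length ?_).symm⟩
    have := h2 _ hs (hts.map _)
    simpa using (congrArg List.length this).symm

theorem maxDot_eq [Nonempty D] (ξ : Ordinal.{w}) (n : ℕ) :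
    maxDot D ξ n = dot D (maxNodes (Gamma ξ n)) := maxNodes_dot _

theorem mem_maxDot [Nonempty D] {ξ : Ordinal.{w}} {n : ℕ} {t : List (Ordinal.{w} × D)} :
    t ∈ maxDot D ξ n ↔ t.map Prod.fst ∈ maxNodes (Gamma ξ n) := by
  rw [maxDot_eq, mem_dot]

theorem mem_maxDot_one [Nonempty D] {ξ : Ordinal.{w}} {t : List (Ordinal.{w} × D)} :
    t ∈ maxDot D ξ 1 ↔ t.map Prod.fst ∈ maxNodes (Gamma1 ξ) := by
  rw [mem_maxDot, Gamma_one]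

theorem shiftD_append_mem_maxDot [Nonempty D] {ξ : Ordinal.{w}} {n : ℕ}
    {u s : List (Ordinal.{w} × D)} (hu : u ∈ maxDot D ξ 1) (hs : s ∈ maxDot D ξ n) :
    shiftD (Ordinal.omega0 ^ ξ * n) u ++ s ∈ maxDot D ξ (n + 1) := by
  rw [mem_maxDot, List.map_append, map_fst_shiftD]
  exact maxNodes_shift_append (mem_maxDot_one.1 hu) (mem_maxDot.1 hs)

theorem exists_of_mem_maxDot [Nonempty D] {ξ : Ordinal.{w}} {n : ℕ} (hn : 1 ≤ n)
    {t : List (Ordinal.{w} × D)} (ht : t ∈ maxDot D ξ (n + 1)) : ∃ u ∈ maxDot D ξ 1,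
      ∃ s ∈ maxDot D ξ n, t = shiftD (Ordinal.omega0 ^ ξ * n) u ++ s := by
  obtain ⟨u, hu, s, hs, h⟩ := exists_of_mem_maxNodes hn (mem_maxDot.1 ht)
  obtain ⟨t1, t2, rfl, h1, h2⟩ := List.map_eq_append_iff.1 h
  obtain ⟨v, rfl, rfl⟩ := exists_shiftD h1
  exact ⟨v, mem_maxDot_one.2 hu, t2, mem_maxDot.2 (h2 ▸ hs), rfl⟩

theorem maxDot_nonempty [Nonempty D] (ξ : Ordinal.{w}) {n : ℕ} (hn : 1 ≤ n) :
    (maxDot D ξ n).Nonempty := by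
  obtain ⟨t, ht⟩ := maxNodes_Gamma_nonempty ξ hn
  obtain ⟨d⟩ := ‹Nonempty D›
  exact ⟨t.map fun a => (a, d), by simpa [mem_maxDot, Function.comp_def] using ht⟩

/-! ### Non-empty initial segments -/

/-- The non-empty initial segments of a list. -/
def prefixes {α : Type*} (t : List α) : List (List α) :=
  (List.range t.length).map fun k => t.take (k + 1)

theorem mem_prefixes {α : Type*} {t r : List α} : r ∈ prefixes t ↔ r <+: t ∧ r ≠ [] := by
  simp only [prefixes, List.mem_map, List.mem_range]
  constructor
  · rintro ⟨k, hk, rfl⟩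
    refine ⟨List.take_prefix _ _, ?_⟩
    rw [ne_eq, List.take_eq_nil_iff]
    rintro (h | rfl)
    · omega
    · simp at hk
  · rintro ⟨h, h0⟩
    have h1 := List.length_pos_iff.2 h0
    have h2 := h.length_le
    refine ⟨r.length - 1, by omega, ?_⟩
    rw [Nat.sub_add_cancel h1, ← List.prefix_iff_eq_take.1 h]

theorem prefixes_append {α : Type*} (s t : List α) :
    prefixes (s ++ t) = prefixes s ++ (prefixes t).map (s ++ ·) := by
  simp only [prefixes, List.length_append, List.range_add, List.map_append, List.map_map]
  congr 1
  · refine List.map_congr_left fun k hk => ?_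
    rw [List.mem_range] at hk
    rw [List.take_append_of_le_length (by omega)]
  · refine List.map_congr_left fun k _ => ?_
    simp [List.take_append, add_assoc]

theorem prefixes_map {α β : Type*} (f : α → β) (t : List α) :
    prefixes (t.map f) = (prefixes t).map (List.map f) := by
  simp [prefixes, List.map_take, Function.comp_def]

/-- The list of the pairs `(ℙ_{ξ,n}(s), x_s)`, for the non-empty initial segments `s` of `t`. -/
def nodes (ξ : Ordinal.{w}) (n : ℕ) (x : List (Ordinal.{w} × D) → X)
    (t : List (Ordinal.{w} × D)) : List (ℝ × X) :=
  (prefixes t).map fun s => (weight ξ n (s.map Prod.fst), x s)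

open Classical in
/-- The part of `nodes ξ n x t` that belongs to the level `i` of the tree. -/
def lev (ξ : Ordinal.{w}) (n i : ℕ) (x : List (Ordinal.{w} × D) → X)
    (t : List (Ordinal.{w} × D)) : List (ℝ × X) :=
  ((prefixes t).filter fun s => s.map Prod.fst ∈ Lambda ξ n i).map
    fun s => (weight ξ n (s.map Prod.fst), x s)

/-- The levels of `nodes ξ n x t`. -/
def levs (ξ : Ordinal.{w}) (n : ℕ) (x : List (Ordinal.{w} × D) → X)
    (t : List (Ordinal.{w} × D)) : List (List (ℝ × X)) :=
  (List.range n).map fun i => lev ξ n (i + 1) x t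

/-- The sum of the weights of a list of pairs. -/
def mass (l : List (ℝ × X)) : ℝ := (l.map Prod.fst).sum

theorem mass_append (l l' : List (ℝ × X)) : mass (l ++ l') = mass l + mass l' := by
  simp [mass]

theorem Lambda_lt {ξ : Ordinal.{w}} {n i : ℕ} {s : List Ordinal.{w}}
    (hs : s ∈ Lambda ξ n (i + 1)) : s ∈ Gamma ξ n := by
  have h0 : s ≠ [] := by
    obtain ⟨⟨a, ha, -⟩, -⟩ := levelOf_bounds ξ _ (Gamma1_bounds ξ) n (i + 1) s hs
    exact List.ne_nil_of_mem ha
  obtain ⟨r, b, rfl⟩ : ∃ r b, s = r ++ [b] := by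
    rcases List.eq_nil_or_concat s with h | ⟨r', b, h⟩
    · exact absurd h h0
    · exact ⟨r', b, by simpa using h⟩
  exact mem_Gamma_iff.2 ⟨i + 1, by omega, (Lambda_last hs).1, hs⟩

theorem weight_shiftD_prefix {ξ : Ordinal.{w}} {n : ℕ} (x : List (Ordinal.{w} × D) → X)
    (u : List (Ordinal.{w} × D)) :
    nodes ξ (n + 1) x (shiftD (Ordinal.omega0 ^ ξ * n) u) =
      nodes ξ 1 (fun s => x (shiftD (Ordinal.omega0 ^ ξ * n) s)) u := by
  simp only [nodes]
  rw [shiftD, prefixes_map, List.map_map]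
  refine List.map_congr_left fun s _ => ?_
  change (weight _ _ ((shiftD _ s).map _), x (shiftD _ s)) = _
  rw [map_fst_shiftD, weight_first]

theorem nodes_shiftD_append {ξ : Ordinal.{w}} {n : ℕ} (x : List (Ordinal.{w} × D) → X)
    (u : List (Ordinal.{w} × D)) {s : List (Ordinal.{w} × D)} (hs : s ∈ dot D (Gamma ξ n)) :
    nodes ξ (n + 1) x (shiftD (Ordinal.omega0 ^ ξ * n) u ++ s) =
      nodes ξ 1 (fun s => x (shiftD (Ordinal.omega0 ^ ξ * n) s)) u ++
      nodes ξ n (fun s => x (shiftD (Ordinal.omega0 ^ ξ * n) u ++ s)) s := by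
  rw [← weight_shiftD_prefix]
  simp only [nodes]
  rw [prefixes_append, List.map_append, List.map_map]
  congr 1
  refine List.map_congr_left fun r hr => ?_
  rw [mem_prefixes] at hr
  simp only [Function.comp_apply, List.map_append, map_fst_shiftD]
  rw [weight_next]
  exact Gamma_prefix hs (hr.1.map _) (by simpa using hr.2)

theorem lev_first {ξ : Ordinal.{w}} {n : ℕ} (x : List (Ordinal.{w} × D) → X)
    {u s : List (Ordinal.{w} × D)} (hu : u ∈ dot D (Gamma1 ξ)) (hs : ∀ q ∈ s, q.1 < Ordinal.omega0 ^ ξ * n) :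
    lev ξ (n + 1) 1 x (shiftD (Ordinal.omega0 ^ ξ * n) u ++ s) =
      nodes ξ 1 (fun s => x (shiftD (Ordinal.omega0 ^ ξ * n) s)) u := by
  rw [← weight_shiftD_prefix]
  simp only [nodes, lev]
  rw [prefixes_append, List.filter_append, List.filter_eq_self.2, List.filter_eq_nil_iff.2,
    List.append_nil]
  · intro r hr
    simp only [List.mem_map, mem_prefixes] at hr
    obtain ⟨r, ⟨hr, hr0⟩, rfl⟩ := hr
    simp only [List.map_append, decide_eq_true_eq]
    intro h
    obtain ⟨u', hu', h⟩ := Lambda_first.1 h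
    obtain ⟨q, hq⟩ := List.exists_mem_of_ne_nil r hr0
    have : q.1 ∈ shift (Ordinal.omega0 ^ ξ * n) u' := by
      rw [← h]; exact List.mem_append_right _ (List.mem_map_of_mem hq)
    exact absurd (hs q (hr.subset hq)) (not_lt.2 (le_of_mem_shift this))
  · intro r hr
    simp only [decide_eq_true_eq]
    rw [shiftD, prefixes_map, List.mem_map] at hr
    obtain ⟨r, hr, rfl⟩ := hr
    rw [mem_prefixes] at hr
    change (shiftD _ r).map _ ∈ _
    rw [map_fst_shiftD]
    exact Lambda_first.2 ⟨_, Gamma1_prefix ξ _ hu _ (hr.1.map _) (by simpa using hr.2), rfl⟩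

open Classical in
theorem lev_next {ξ : Ordinal.{w}} {n i : ℕ} (x : List (Ordinal.{w} × D) → X)
    {u s : List (Ordinal.{w} × D)} (hu : u ∈ dot D (maxNodes (Gamma1 ξ))) (hs : s ∈ dot D (Gamma ξ n)) :
    lev ξ (n + 1) (i + 2) x (shiftD (Ordinal.omega0 ^ ξ * n) u ++ s) =
      lev ξ n (i + 1) (fun s => x (shiftD (Ordinal.omega0 ^ ξ * n) u ++ s)) s := by
  have hlt : ∀ r ∈ prefixes s, r.map Prod.fst ∈ Gamma ξ n := by
    intro r hr
    rw [mem_prefixes] at hr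
    exact Gamma_prefix hs (hr.1.map _) (by simpa using hr.2)
  simp only [lev]
  rw [prefixes_append, List.filter_append, List.filter_eq_nil_iff.2, List.nil_append,
    List.filter_map, List.map_map]
  · have : (prefixes s).filter ((fun s => decide (s.map Prod.fst ∈ Lambda ξ (n + 1) (i + 2))) ∘
        fun r => shiftD (Ordinal.omega0 ^ ξ * n) u ++ r) =
        (prefixes s).filter fun s => decide (s.map Prod.fst ∈ Lambda ξ n (i + 1)) := by
      refine List.filter_congr fun r hr => ?_
      simp only [Function.comp_apply, List.map_append, map_fst_shiftD, decide_eq_decide]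
      constructor
      · intro h
        obtain ⟨u', hu', r', hr', h⟩ := Lambda_next.1 h
        obtain ⟨-, h2⟩ := shift_append_inj (Gamma_lt (hlt r hr)) (Gamma_lt (Lambda_lt hr')) h
        rwa [h2]
      · intro h
        exact Lambda_next.2 ⟨_, hu, _, h, rfl⟩
    rw [this]
    refine List.map_congr_left fun r hr => ?_
    simp only [Function.comp_apply, List.map_append, map_fst_shiftD]
    rw [weight_next _ _ _ _ (hlt r (List.mem_of_mem_filter hr))]
  · intro r hr
    simp only [decide_eq_true_eq]
    rw [shiftD, prefixes_map, List.mem_map] at hr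
    obtain ⟨r, hr, rfl⟩ := hr
    change (shiftD _ r).map _ ∉ _
    rw [map_fst_shiftD]
    intro h
    obtain ⟨u', hu', r', hr', h⟩ := Lambda_next.1 h
    obtain ⟨b, hb⟩ := List.exists_mem_of_ne_nil r' (Gamma_ne_nil (Lambda_lt hr'))
    have : b ∈ shift (Ordinal.omega0 ^ ξ * n) (r.map Prod.fst) := by
      rw [h]; exact List.mem_append_right _ hb
    exact absurd (Gamma_lt (Lambda_lt hr') b hb) (not_lt.2 (le_of_mem_shift this))

/-- The branch splits as the definition of Ω_{ξ,n+1} splits its quantifiers: a maximal block u, then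
a branch s of the remaining tree. -/
theorem levs_succ [Nonempty D] {ξ : Ordinal.{w}} {n : ℕ} (x : List (Ordinal.{w} × D) → X)
    {u s : List (Ordinal.{w} × D)} (hu : u ∈ maxDot D ξ 1) (hs : s ∈ maxDot D ξ n) :
    levs ξ (n + 1) x (shiftD (Ordinal.omega0 ^ ξ * n) u ++ s) =
      nodes ξ 1 (fun s => x (shiftD (Ordinal.omega0 ^ ξ * n) s)) u ::
      levs ξ n (fun s => x (shiftD (Ordinal.omega0 ^ ξ * n) u ++ s)) s := by
  have hu' := mem_maxDot_one.1 hu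
  rw [levs, List.range_succ_eq_map, List.map_cons, List.map_map, zero_add, lev_first x hu'.1]
  · congr 1
    refine List.map_congr_left fun i _ => ?_
    exact lev_next x hu' hs.1
  · exact fun q hq => Gamma_lt hs.1 _ (List.mem_map_of_mem hq)

theorem levs_one [Nonempty D] {ξ : Ordinal.{w}} (x : List (Ordinal.{w} × D) → X)
    {u : List (Ordinal.{w} × D)} (hu : u ∈ maxDot D ξ 1) : levs ξ 1 x u = [nodes ξ 1 x u] := by
  have h0 : ∀ t : List (Ordinal.{w} × D), shiftD (Ordinal.omega0 ^ ξ * (0 : ℕ)) t = t := by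
    intro t; simp [shiftD]
  have := lev_first (n := 0) (s := []) x (mem_maxDot_one.1 hu).1 (by simp)
  simp only [h0, List.append_nil, zero_add] at this
  simp [levs, this]

theorem flatten_levs [Nonempty D] {ξ : Ordinal.{w}} {n : ℕ} (hn : 1 ≤ n)
    (x : List (Ordinal.{w} × D) → X) {t : List (Ordinal.{w} × D)} (ht : t ∈ maxDot D ξ n) :
    (levs ξ n x t).flatten = nodes ξ n x t := by
  induction n, hn using Nat.le_induction generalizing x t with
  | base => simp [levs_one x ht]
  | succ n hn ih =>
    obtain ⟨u, hu, s, hs, rfl⟩ := exists_of_mem_maxDot hn ht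
    rw [levs_succ x hu hs, List.flatten_cons, ih _ hs, nodes_shiftD_append _ _ hs.1]

theorem nodes_add_one {η : Ordinal.{w}} {n : ℕ} (hn : 1 ≤ n) (x : List (Ordinal.{w} × D) → X)
    {t : List (Ordinal.{w} × D)} (ht : t ∈ dot D (Gamma η n)) :
    nodes (η + 1) 1 x t = (nodes η n x t).map fun q => ((n : ℝ)⁻¹ * q.1, q.2) := by
  simp only [nodes, List.map_map]
  refine List.map_congr_left fun s hs => ?_
  rw [mem_prefixes] at hs
  simp only [Function.comp_apply]
  rw [weight_add_one η n hn _ (Gamma_prefix ht (hs.1.map _) (by simpa using hs.2))]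

theorem nodes_limit {ξ ζ : Ordinal.{w}} (hξ : Order.IsSuccLimit ξ) (hζ : ζ < ξ)
    (x : List (Ordinal.{w} × D) → X) {t : List (Ordinal.{w} × D)} (ht : t ∈ dot D (Gamma1 (ζ + 1))) :
    nodes ξ 1 x (shiftD (Ordinal.omega0 ^ ζ) t) =
      nodes (ζ + 1) 1 (fun s => x (shiftD (Ordinal.omega0 ^ ζ) s)) t := by
  simp only [nodes]
  rw [shiftD, prefixes_map, List.map_map]
  refine List.map_congr_left fun s hs => ?_
  rw [mem_prefixes] at hs
  change (weight _ _ ((shiftD _ s).map _), x (shiftD _ s)) = _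
  rw [map_fst_shiftD, weight_limit ξ hξ ζ hζ]
  rw [Gamma_one]
  exact Gamma1_prefix _ _ ht _ (hs.1.map _) (by simpa using hs.2)

theorem mass_map_mul (c : ℝ) (l : List (ℝ × X)) :
    mass (l.map fun q => (c * q.1, q.2)) = c * mass l := by
  simp [mass, Function.comp_def, List.sum_map_mul_left]

theorem mass_flatten (ls : List (List (ℝ × X))) : mass ls.flatten = (ls.map mass).sum := by
  induction ls with
  | nil => simp [mass]
  | cons l ls ih => simp [mass_append, ih]

theorem mass_levs_of [Nonempty D] (ξ : Ordinal.{w})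
    (h : ∀ (x : List (Ordinal.{w} × D) → X), ∀ t ∈ maxDot D ξ 1, mass (nodes ξ 1 x t) = 1) {n : ℕ}
    (hn : 1 ≤ n) (x : List (Ordinal.{w} × D) → X) {t : List (Ordinal.{w} × D)}
    (ht : t ∈ maxDot D ξ n) : ∀ l ∈ levs ξ n x t, mass l = 1 := by
  induction n, hn using Nat.le_induction generalizing x t with
  | base => simpa [levs_one x ht] using h x t ht
  | succ n hn ih =>
    obtain ⟨u, hu, s, hs, rfl⟩ := exists_of_mem_maxDot hn ht
    rw [levs_succ x hu hs]
    simp only [List.mem_cons, forall_eq_or_imp]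
    exact ⟨h _ u hu, ih _ hs⟩

/-- The averages are convex combinations: at a successor, n levels of mass one are averaged with
weight 1/n, and at a limit the weights are copied. -/
theorem mass_nodes [Nonempty D] (ξ : Ordinal.{w}) :
    ∀ (x : List (Ordinal.{w} × D) → X), ∀ t ∈ maxDot D ξ 1, mass (nodes ξ 1 x t) = 1 := by
  induction ξ using Ordinal.limitRecOn with
  | zero =>
    intro x t ht
    have := (mem_maxDot_one.1 ht).1
    rw [Gamma1_zero, mem_singleton_iff] at this
    obtain ⟨q, rfl, hq⟩ := List.map_eq_singleton_iff.1 this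
    simp [mass, nodes, prefixes, hq, weight_zero]
  | add_one η ih =>
    intro x t ht
    rw [mem_maxDot_one] at ht
    have h := ht.1
    rw [Gamma1_add_one] at h
    obtain ⟨n, hn, h⟩ := h
    have ht' : t ∈ maxDot D η n := mem_maxDot.2 (maxNodes_of_mem_Gamma hn ht h)
    rw [nodes_add_one hn x h, mass_map_mul, ← flatten_levs hn x ht', mass_flatten]
    rw [List.eq_replicate_iff.2 ⟨List.length_map .., by
      simpa using mass_levs_of η ih hn x ht'⟩]
    have : (n : ℝ) ≠ 0 := by positivity
    simp [levs, this]
  | limit ξ hξ ih =>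
    intro x t ht
    rw [mem_maxDot_one] at ht
    have h := ht.1
    rw [Gamma1_limit ξ hξ] at h
    obtain ⟨ζ, hζ, s, hs, h⟩ := h
    obtain ⟨v, rfl, rfl⟩ := exists_shiftD h
    rw [map_fst_shiftD] at ht
    rw [nodes_limit hξ hζ x hs]
    exact ih _ (hξ.succ_lt hζ) _ _ (mem_maxDot_one.2 ((maxNodes_shift_limit hξ hζ).1 ⟨ht, hs⟩))

theorem mass_lev [Nonempty D] {ξ : Ordinal.{w}} {n i : ℕ} (hi : i < n)
    (x : List (Ordinal.{w} × D) → X) {t : List (Ordinal.{w} × D)}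
    (ht : t ∈ maxDot D ξ n) : mass (lev ξ n (i + 1) x t) = 1 :=
  mass_levs_of ξ (mass_nodes ξ) (by omega) x ht _
    (List.mem_map.2 ⟨i, List.mem_range.2 hi, rfl⟩)

theorem lev_fst_nonneg {ξ : Ordinal.{w}} {n i : ℕ} (x : List (Ordinal.{w} × D) → X)
    (t : List (Ordinal.{w} × D)) : ∀ q ∈ lev ξ n i x t, 0 ≤ q.1 := by
  intro q hq
  obtain ⟨s, -, rfl⟩ := List.mem_map.1 hq
  exact weight_nonneg _ _ _

end SzTree

end

noncomputable section

namespace SzTree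

/-! ### Cofinal sets -/

/-- A family of sets that is closed under supersets, does not contain the empty set, and contains
one of two sets if it contains their union. -/
structure IsGrill {α : Type*} (C : Set α → Prop) : Prop where
  mono : ∀ {E F : Set α}, E ⊆ F → C E → C F
  empty : ¬ C ∅
  union : ∀ {E F : Set α}, C (E ∪ F) → C E ∨ C F

theorem IsGrill.nonempty {α : Type*} {C : Set α → Prop} (hC : IsGrill C) {E : Set α} (hE : C E) :
    E.Nonempty := by
  rw [nonempty_iff_ne_empty]
  rintro rfl
  exact hC.empty hE

/-- Pigeonhole principle for grills. It turns a choice among finitely many options that depends on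
the branch into one choice that is valid on a cofinal set. -/
theorem IsGrill.exists_of_finite {α β : Type*} {C : Set α → Prop} (hC : IsGrill C) {S : Set β}
    (hS : S.Finite) {P : β → α → Prop} {E : Set α} (hE : C E) (h : ∀ t ∈ E, ∃ k ∈ S, P k t) :
    ∃ k ∈ S, C {t | t ∈ E ∧ P k t} := by
  induction S, hS using Set.Finite.induction_on generalizing E with
  | empty =>
    obtain ⟨t, ht⟩ := hC.nonempty hE
    obtain ⟨k, hk, -⟩ := h t ht
    exact absurd hk (notMem_empty k)
  | @insert a S _ _ ih =>
    have : C ({t | t ∈ E ∧ P a t} ∪ {t | t ∈ E ∧ ¬ P a t}) :=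
      hC.mono (fun t ht => by by_cases hp : P a t <;> simp [ht, hp]) hE
    rcases hC.union this with h1 | h1
    · exact ⟨a, mem_insert _ _, h1⟩
    · obtain ⟨k, hk, h2⟩ := ih h1 fun t ht => by
        obtain ⟨k, hk, hP⟩ := h t ht.1
        rcases hk with rfl | hk
        · exact absurd hP ht.2
        · exact ⟨k, hk, hP⟩
      exact ⟨k, mem_insert_of_mem _ hk, hC.mono (fun t ht => ⟨ht.1.1, ht.2⟩) h2⟩

/-- Directedness gives the union axiom: bounds beyond which the two sets have no member have a
common upper bound. -/
theorem isGrill_frequently {α β : Type*} [Preorder β] [IsDirectedOrder β] [Nonempty β]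
    (f : β → α) : IsGrill fun E : Set α => IsCofinal {u | f u ∈ E} := by
  refine ⟨fun h hE => hE.mono fun u hu => h hu, fun h => ?_, fun {E F} h => ?_⟩
  · obtain ⟨b⟩ := ‹Nonempty β›
    obtain ⟨u, hu, -⟩ := h b
    exact hu
  · by_contra! hc
    obtain ⟨h1, h2⟩ := hc
    simp only [IsCofinal, not_forall, not_exists, not_and] at h1 h2
    obtain ⟨b, hb⟩ := h1
    obtain ⟨c, hc⟩ := h2
    obtain ⟨d, hbd, hcd⟩ := exists_ge_ge b c
    obtain ⟨u, hu, hdu⟩ := h d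
    rcases hu with hu | hu
    · exact hb u hu (hbd.trans hdu)
    · exact hc u hu (hcd.trans hdu)

variable {D : Type u}

/-- The quantifier is iterated, cofinally many u and then cofinally many s. The axioms are applied
to the inner grill for each u and then to the outer one. -/
theorem isGrill_cofinalOf {ξ : Ordinal.{w}} {C : Set (List (Ordinal.{w} × D)) → Prop}
    (hC : IsGrill C) {n : ℕ} (hn : 1 ≤ n) : IsGrill (cofinalOf ξ C n) := by
  induction n, hn using Nat.le_induction with
  | base => exact hC
  | succ n hn ih =>
    obtain ⟨n, rfl⟩ : ∃ m, n = m + 1 := ⟨n - 1, by omega⟩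
    refine ⟨fun h hE => ?_, fun h => ?_, fun {E F} h => ?_⟩
    · exact hC.mono (fun u hu => ⟨hu.1, ih.mono (fun s hs => ⟨hs.1, h hs.2⟩) hu.2⟩) hE
    · obtain ⟨u, hu⟩ := hC.nonempty h
      obtain ⟨s, hs⟩ := ih.nonempty hu.2
      exact hs.2
    · refine hC.union (hC.mono ?_ h)
      rintro u ⟨hu, hs⟩
      have := ih.union (ih.mono (F := {s | s ∈ maxDot D ξ (n + 1) ∧
        shiftD (Ordinal.omega0 ^ ξ * (n + 1 : ℕ)) u ++ s ∈ E} ∪ {s | s ∈ maxDot D ξ (n + 1) ∧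
        shiftD (Ordinal.omega0 ^ ξ * (n + 1 : ℕ)) u ++ s ∈ F}) ?_ hs)
      · rcases this with h | h
        · exact Or.inl ⟨hu, h⟩
        · exact Or.inr ⟨hu, h⟩
      · rintro s ⟨hs, h | h⟩
        · exact Or.inl ⟨hs, h⟩
        · exact Or.inr ⟨hs, h⟩

variable [Preorder D]

theorem cofinal1_zero (E : Set (List (Ordinal.{w} × D))) :
    cofinal1 D 0 E ↔ IsCofinal {u : D | [((0 : Ordinal.{w}), u)] ∈ E} := by
  simp [cofinal1]

theorem cofinal1_add_one (η : Ordinal.{w}) (E : Set (List (Ordinal.{w} × D))) :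
    cofinal1 D (η + 1) E ↔ ∃ M : Set ℕ, IsCofinal M ∧
      ∀ n ∈ M, 1 ≤ n → cofinalOf η (cofinal1 D η) n (E ∩ dot D (Gamma η n)) := by
  simp only [cofinal1, Ordinal.limitRecOn_add_one]

theorem cofinal1_limit {ξ : Ordinal.{w}} (hξ : Order.IsSuccLimit ξ)
    (E : Set (List (Ordinal.{w} × D))) :
    cofinal1 D ξ E ↔ ∃ M : Set Ordinal.{w}, (∀ η < ξ, ∃ ζ ∈ M, η ≤ ζ ∧ ζ < ξ) ∧
      ∀ ζ ∈ M, ζ < ξ → cofinal1 D (ζ + 1)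
        {s | s ∈ maxDot D (ζ + 1) 1 ∧ shiftD (Ordinal.omega0 ^ ζ) s ∈ E} := by
  conv_lhs => rw [cofinal1, Ordinal.limitRecOn_limit _ _ _ _ hξ]
  rfl

theorem isGrill_cofinal1 [IsDirectedOrder D] [Nonempty D] (ξ : Ordinal.{w}) :
    IsGrill (cofinal1 D ξ) := by
  induction ξ using Ordinal.limitRecOn with
  | zero =>
    have := isGrill_frequently fun u : D => [((0 : Ordinal.{w}), u)]
    refine ⟨fun h => ?_, ?_, fun h => ?_⟩ <;> simp only [cofinal1_zero] at *
    · exact this.mono h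
    · exact this.empty
    · exact this.union h
  | add_one η ih =>
    have hg : ∀ {n : ℕ}, 1 ≤ n → IsGrill (cofinalOf η (cofinal1 D η) n) :=
      fun hn => isGrill_cofinalOf ih hn
    refine ⟨fun h => ?_, ?_, fun {E F} h => ?_⟩ <;> simp only [cofinal1_add_one] at *
    · rintro ⟨M, hM, h'⟩
      exact ⟨M, hM, fun n hn hn1 => (hg hn1).mono (inter_subset_inter_left _ h) (h' n hn hn1)⟩
    · rintro ⟨M, hM, h'⟩
      obtain ⟨n, hn, hn1⟩ := hM 1
      obtain ⟨t, ht⟩ := (hg hn1).nonempty (h' n hn hn1)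
      exact ht.1
    · obtain ⟨M, hM, h'⟩ := h
      have key : IsCofinal {n : ℕ | n ∈ {n | n ∈ M ∧ 1 ≤ n ∧
          cofinalOf η (cofinal1 D η) n (E ∩ dot D (Gamma η n))} ∪ {n | n ∈ M ∧ 1 ≤ n ∧
          cofinalOf η (cofinal1 D η) n (F ∩ dot D (Gamma η n))}} := by
        intro k
        -- The maximum with 1 avoids n = 0, for which membership in M says nothing about E ∪ F.
        obtain ⟨n, hn, hkn⟩ := hM (max k 1)
        have hn1 : 1 ≤ n := le_trans (le_max_right _ _) hkn
        refine ⟨n, ?_, (le_max_left _ _).trans hkn⟩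
        have := h' n hn hn1
        rw [union_inter_distrib_right] at this
        rcases (hg hn1).union this with h | h
        · exact Or.inl ⟨hn, hn1, h⟩
        · exact Or.inr ⟨hn, hn1, h⟩
      rcases (isGrill_frequently (fun n : ℕ => n)).union key with h | h
      · exact Or.inl ⟨_, h, fun n hn _ => hn.2.2⟩
      · exact Or.inr ⟨_, h, fun n hn _ => hn.2.2⟩
  | limit ξ hξ ih =>
    refine ⟨fun h => ?_, ?_, fun {E F} h => ?_⟩ <;> simp only [cofinal1_limit hξ] at *
    · rintro ⟨M, hM, h'⟩
      exact ⟨M, hM, fun ζ hζ hζ' => (ih _ (hξ.succ_lt hζ')).mono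
        (fun s hs => ⟨hs.1, h hs.2⟩) (h' ζ hζ hζ')⟩
    · rintro ⟨M, hM, h'⟩
      obtain ⟨ζ, hζ, -, hζ'⟩ := hM 0 hξ.bot_lt
      obtain ⟨t, ht⟩ := (ih _ (hξ.succ_lt hζ')).nonempty (h' ζ hζ hζ')
      exact ht.2
    · obtain ⟨M, hM, h'⟩ := h
      have h'' : ∀ ζ ∈ M, ζ < ξ →
          cofinal1 D (ζ + 1) {s | s ∈ maxDot D (ζ + 1) 1 ∧ shiftD (Ordinal.omega0 ^ ζ) s ∈ E} ∨
          cofinal1 D (ζ + 1) {s | s ∈ maxDot D (ζ + 1) 1 ∧ shiftD (Ordinal.omega0 ^ ζ) s ∈ F} := by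
        intro ζ hζ hζ'
        refine (ih _ (hξ.succ_lt hζ')).union ((ih _ (hξ.succ_lt hζ')).mono ?_ (h' ζ hζ hζ'))
        rintro s ⟨hs, h | h⟩
        · exact Or.inl ⟨hs, h⟩
        · exact Or.inr ⟨hs, h⟩
      -- Either the ordinals that serve E are cofinal in ξ, or beyond some η every ordinal of M
      -- below ξ serves F.
      by_cases hE : ∀ η < ξ, ∃ ζ ∈ {ζ | ζ ∈ M ∧ cofinal1 D (ζ + 1)
          {s | s ∈ maxDot D (ζ + 1) 1 ∧ shiftD (Ordinal.omega0 ^ ζ) s ∈ E}}, η ≤ ζ ∧ ζ < ξ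
      · exact Or.inl ⟨_, hE, fun ζ hζ _ => hζ.2⟩
      · push Not at hE
        obtain ⟨η, hη, hE⟩ := hE
        refine Or.inr ⟨{ζ | η ≤ ζ ∧ ζ ∈ M}, ?_, ?_⟩
        · intro η' hη'
          obtain ⟨ζ, hζ, h1, h2⟩ := hM (max η η') (max_lt hη hη')
          exact ⟨ζ, ⟨(le_max_left _ _).trans h1, hζ⟩, (le_max_right _ _).trans h1, h2⟩
        · rintro ζ ⟨h1, h2⟩ h3
          refine (h'' ζ h2 h3).resolve_left fun h => ?_
          exact absurd h3 (not_lt.2 (hE ζ ⟨h2, h⟩ h1))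

theorem isGrill_cofinal [IsDirectedOrder D] [Nonempty D] (ξ : Ordinal.{w}) {n : ℕ} (hn : 1 ≤ n) :
    IsGrill (cofinalOf ξ (cofinal1 D ξ) n) := isGrill_cofinalOf (isGrill_cofinal1 ξ) hn

theorem cofinalOf_maxDot_of [IsDirectedOrder D] [Nonempty D] (ξ : Ordinal.{w})
    (h : cofinal1 D ξ (maxDot D ξ 1)) {n : ℕ} (hn : 1 ≤ n) :
    cofinalOf ξ (cofinal1 D ξ) n (maxDot D ξ n) := by
  induction n, hn using Nat.le_induction with
  | base => exact h
  | succ n hn ih =>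
    obtain ⟨n, rfl⟩ : ∃ m, n = m + 1 := ⟨n - 1, by omega⟩
    refine (isGrill_cofinal1 ξ).mono (fun u hu => ⟨hu, ?_⟩) h
    exact (isGrill_cofinal ξ hn).mono (fun s hs => ⟨hs, shiftD_append_mem_maxDot hu hs⟩) ih

/-- Together with the grill property, this makes finitely many eventual sets intersect. -/
theorem cofinal1_maxDot [IsDirectedOrder D] [Nonempty D] (ξ : Ordinal.{w}) :
    cofinal1 D ξ (maxDot D ξ 1) := by
  induction ξ using Ordinal.limitRecOn with
  | zero =>
    rw [cofinal1_zero]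
    exact fun u => ⟨u, mem_maxDot_one.2 ⟨by simp [Gamma1_zero], by simp [Gamma1_zero]⟩, le_rfl⟩
  | add_one η ih =>
    rw [cofinal1_add_one]
    refine ⟨univ, fun n => ⟨n, mem_univ _, le_rfl⟩, fun n _ hn => ?_⟩
    refine (isGrill_cofinal η hn).mono (fun t ht => ⟨?_, ht.1⟩) (cofinalOf_maxDot_of η ih hn)
    exact mem_maxDot_one.2 (maxNodes_Gamma_succ_subset η hn (mem_maxDot.1 ht))
  | limit ξ hξ ih =>
    rw [cofinal1_limit hξ]
    refine ⟨Iio ξ, fun η hη => ⟨η, hη, le_rfl, hη⟩, fun ζ _ hζ => ?_⟩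
    refine (isGrill_cofinal1 _).mono (fun t ht => ⟨ht, ?_⟩) (ih _ (hξ.succ_lt hζ))
    rw [mem_maxDot_one, map_fst_shiftD]
    exact ((maxNodes_shift_limit hξ hζ).2 (mem_maxDot_one.1 ht)).1

theorem cofinalOf_maxDot [IsDirectedOrder D] [Nonempty D] (ξ : Ordinal.{w}) {n : ℕ} (hn : 1 ≤ n) :
    cofinalOf ξ (cofinal1 D ξ) n (maxDot D ξ n) :=
  cofinalOf_maxDot_of ξ (cofinal1_maxDot ξ) hn

theorem isEventualIn_setOf {ξ : Ordinal.{w}} {n : ℕ} {P : List (Ordinal.{w} × D) → Prop} :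
    IsEventualIn D ξ n {t | t ∈ maxDot D ξ n ∧ P t} ↔
      ¬ cofinalOf ξ (cofinal1 D ξ) n {t | t ∈ maxDot D ξ n ∧ ¬ P t} := by
  have : maxDot D ξ n \ {t | t ∈ maxDot D ξ n ∧ P t} = {t | t ∈ maxDot D ξ n ∧ ¬ P t} := by
    ext t
    simp only [Set.mem_sdiff, mem_ofPred_eq, not_and]
    exact ⟨fun h => ⟨h.1, h.2 h.1⟩, fun h => ⟨h.1, fun _ => h.2⟩⟩
  rw [IsEventualIn, IsCofinalIn, this]
  constructor
  · exact fun h h' => h.2 ⟨fun t ht => ht.1, h'⟩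
  · exact fun h => ⟨fun t ht => ht.1, fun h' => h h'.2⟩

/-- Finitely many eventual sets have a common element. -/
theorem exists_forall_of_isEventualIn [IsDirectedOrder D] [Nonempty D] {ξ : Ordinal.{w}} {n : ℕ}
    (hn : 1 ≤ n) {β : Type*} (S : Finset β) {P : β → List (Ordinal.{w} × D) → Prop}
    (h : ∀ k ∈ S, IsEventualIn D ξ n {t | t ∈ maxDot D ξ n ∧ P k t}) :
    ∃ t ∈ maxDot D ξ n, ∀ k ∈ S, P k t := by
  by_contra! hc
  obtain ⟨k, hk, h'⟩ := (isGrill_cofinal ξ hn).exists_of_finite S.finite_toSet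
    (cofinalOf_maxDot ξ hn) (P := fun k t => ¬ P k t) fun t ht => hc t ht
  exact isEventualIn_setOf.1 (h k hk) h'

end SzTree

end

noncomputable section

namespace SzTree

variable {X : Type u} {κ : Type*}

/-! ### Derivations of sets of labelled sequences -/

/-- The derivation of order `α` of a set `T` of sequences of labelled points, with respect to a
filter `W`: a sequence `s` of `T` survives if for all `β < α` there are frequently points `x` such
that `s ⌢ (lab β, x)` survives the derivation of order `β`. -/
def Der (W : Filter X) (lab : Ordinal.{w} → κ) (T : Set (List (κ × X))) (α : Ordinal.{w}) :
    Set (List (κ × X)) :=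
  {s | s ∈ T ∧ ∀ β, ∀ _h : β < α, ∃ᶠ x in W, s ++ [(lab β, x)] ∈ Der W lab T β}
termination_by α

/-- `T` is closed under subsequences. -/
def Hereditary (T : Set (List (κ × X))) : Prop := ∀ t ∈ T, ∀ s, s.Sublist t → s ∈ T

variable {W : Filter X} {lab : Ordinal.{w} → κ} {T : Set (List (κ × X))}

theorem mem_Der {α : Ordinal.{w}} {s : List (κ × X)} : s ∈ Der W lab T α ↔
    s ∈ T ∧ ∀ β < α, ∃ᶠ x in W, s ++ [(lab β, x)] ∈ Der W lab T β := by
  rw [Der]; rfl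

theorem Der_subset (α : Ordinal.{w}) : Der W lab T α ⊆ T := fun _ hs => (mem_Der.1 hs).1

theorem Der_zero : Der W lab T 0 = T := by
  ext s
  rw [mem_Der]
  simp

theorem Der_anti {α β : Ordinal.{w}} (h : α ≤ β) : Der W lab T β ⊆ Der W lab T α :=
  fun _ hs => mem_Der.2 ⟨(mem_Der.1 hs).1, fun γ hγ => (mem_Der.1 hs).2 γ (hγ.trans_le h)⟩

theorem mem_Der_of_isSuccLimit {α : Ordinal.{w}} (hα : Order.IsSuccLimit α) {s : List (κ × X)}
    (h : ∀ β < α, s ∈ Der W lab T β) : s ∈ Der W lab T α :=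
  mem_Der.2 ⟨Der_subset 0 (h 0 hα.bot_lt), fun β hβ =>
    (mem_Der.1 (h _ (hα.succ_lt hβ))).2 β (Order.lt_succ β)⟩

/-- An ordinal below α + β is either below α, where membership in the inner derivation applies, or α
+ γ with γ < β, where the outer derivation and induction apply. -/
theorem Der_add (α β : Ordinal.{w}) :
    Der W (fun γ => lab (α + γ)) (Der W lab T α) β ⊆ Der W lab T (α + β) := by
  induction β using WellFoundedLT.induction with
  | ind β ih =>
    intro s hs
    obtain ⟨h1, h2⟩ := mem_Der.1 hs
    refine mem_Der.2 ⟨Der_subset _ h1, fun γ hγ => ?_⟩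
    rcases lt_or_ge γ α with h | h
    · exact (mem_Der.1 h1).2 γ h
    · obtain ⟨γ, rfl⟩ := exists_add_of_le h
      have hγ' : γ < β := by simpa using hγ
      exact (h2 γ hγ').mono fun x hx => ih γ hγ' hx

theorem Der_congr {lab' : Ordinal.{w} → κ} {α : Ordinal.{w}} (h : ∀ β < α, lab β = lab' β) :
    Der W lab T α ⊆ Der W lab' T α := by
  induction α using WellFoundedLT.induction with
  | ind α ih =>
    intro s hs
    refine mem_Der.2 ⟨Der_subset _ hs, fun β hβ => ?_⟩
    rw [← h β hβ]
    exact ((mem_Der.1 hs).2 β hβ).mono fun x hx => ih β hβ (fun γ hγ => h γ (hγ.trans hβ)) hx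

/-- Used in three ways: with identities and p empty it is monotonicity in T, with p a fixed sequence
it is concatenation, and with j an embedding it moves a derivation from a summand into the whole
space. -/
theorem Der_map {X' : Type*} {κ' : Type*} {W' : Filter X'} {T' : Set (List (κ' × X'))}
    (f : κ → κ') (j : X → X') (hj : Tendsto j W W') (p : List (κ' × X'))
    (h : ∀ l ∈ T, p ++ l.map (Prod.map f j) ∈ T') {α : Ordinal.{w}} :
    ∀ l ∈ Der W lab T α, p ++ l.map (Prod.map f j) ∈ Der W' (f ∘ lab) T' α := by
  induction α using WellFoundedLT.induction with
  | ind α ih =>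
    intro l hl
    refine mem_Der.2 ⟨h l (Der_subset _ hl), fun β hβ => ?_⟩
    refine hj.frequently (((mem_Der.1 hl).2 β hβ).mono fun x hx => ?_)
    have := ih β hβ _ hx
    simpa using this

theorem Hereditary.Der (hT : Hereditary T) (α : Ordinal.{w}) : Hereditary (Der W lab T α) := by
  induction α using WellFoundedLT.induction with
  | ind α ih =>
    intro t ht s hs
    refine mem_Der.2 ⟨hT t (Der_subset _ ht) s hs, fun β hβ => ?_⟩
    exact ((mem_Der.1 ht).2 β hβ).mono fun x hx =>
      ih β hβ _ hx _ (hs.append (List.Sublist.refl _))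

/-- The successive derivations of order `ω ^ ξ`, with the labels in the list `L`. -/
def IterDer (W : Filter X) (ξ : Ordinal.{w}) : List κ → Set (List (κ × X)) → Set (List (κ × X))
  | [], T => T
  | c :: L, T => Der W (fun _ : Ordinal.{w} => c) (IterDer W ξ L T) (Ordinal.omega0 ^ ξ)

theorem IterDer_append (ξ : Ordinal.{w}) (L L' : List κ) :
    IterDer W ξ (L ++ L') T = IterDer W ξ L (IterDer W ξ L' T) := by
  induction L with
  | nil => rfl
  | cons c L ih => simp [IterDer, ih]

theorem Hereditary.iterDer (hT : Hereditary T) (ξ : Ordinal.{w}) (L : List κ) :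
    Hereditary (IterDer W ξ L T) := by
  induction L with
  | nil => exact hT
  | cons c L ih => exact ih.Der _

theorem IterDer_map {X' : Type*} {κ' : Type*} {W' : Filter X'} {T' : Set (List (κ' × X'))}
    (f : κ → κ') (j : X → X') (hj : Tendsto j W W') (p : List (κ' × X'))
    (h : ∀ l ∈ T, p ++ l.map (Prod.map f j) ∈ T') (ξ : Ordinal.{w}) (L : List κ) :
    ∀ l ∈ IterDer W ξ L T, p ++ l.map (Prod.map f j) ∈ IterDer W' ξ (L.map f) T' := by
  induction L with
  | nil => exact h
  | cons c L ih => exact Der_map f j hj p ih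

/-- Every derivation shrinks its set, so levels can be omitted. This extracts the exceptional levels
that are compared with θ_{ζ,m}. -/
theorem IterDer_sublist {ξ : Ordinal.{w}} {L L' : List κ} (h : L'.Sublist L) :
    IterDer W ξ L T ⊆ IterDer W ξ L' T := by
  induction h with
  | slnil => exact Subset.rfl
  | cons c _ ih => exact (Der_subset _).trans ih
  | @cons_cons L1 L2 c _ ih =>
    intro l hl
    have := Der_map (W' := W) id id tendsto_id [] (T' := IterDer W ξ L1 T)
      (fun l hl => by simpa using ih hl) l hl
    simpa [IterDer] using this

theorem IterDer_replicate (ξ : Ordinal.{w}) (c : κ) (k : ℕ) :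
    IterDer W ξ (List.replicate k c) T ⊆
      Der W (fun _ : Ordinal.{w} => c) T (Ordinal.omega0 ^ ξ * k) := by
  induction k with
  | zero => simp [IterDer, Der_zero]
  | succ k ih =>
    intro l hl
    have := Der_map (W' := W) id id tendsto_id [] (fun l hl => by simpa using ih hl) l hl
    push_cast
    rw [mul_add_one]
    exact Der_add _ _ (by simpa using this)

/-- The label, in `L`, of an ordinal less than `ω ^ ξ * L.length`. -/
def labelOf [Inhabited κ] (ξ : Ordinal.{w}) : List κ → Ordinal.{w} → κ
  | [], _ => default
  | c :: L, β => open Classical in if β < Ordinal.omega0 ^ ξ * L.length then labelOf ξ L β else c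

theorem labelOf_eq [Inhabited κ] {ξ : Ordinal.{w}} {L : List κ} {i : ℕ} (hi : i < L.length)
    {ρ : Ordinal.{w}} (hρ : ρ < Ordinal.omega0 ^ ξ) :
    labelOf ξ L (Ordinal.omega0 ^ ξ * (L.length - 1 - i : ℕ) + ρ) = L[i] := by
  induction L generalizing i with
  | nil => simp at hi
  | cons c L ih =>
    match i with
    | 0 => simp [labelOf]
    | i + 1 =>
      have hi' : i < L.length := by simpa using hi
      have h1 : (c :: L).length - 1 - (i + 1) = L.length - 1 - i := by simp; omega
      rw [labelOf, h1, if_pos, ih hi']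
      · rfl
      · calc Ordinal.omega0 ^ ξ * (L.length - 1 - i : ℕ) + ρ
          < Ordinal.omega0 ^ ξ * (L.length - 1 - i : ℕ) + Ordinal.omega0 ^ ξ := by gcongr
        _ = Ordinal.omega0 ^ ξ * (L.length - 1 - i + 1 : ℕ) := by push_cast; rw [mul_add_one]
        _ ≤ _ := by gcongr; omega

/-- Fuses the derivations into a single one. The head of L labels the topmost interval of ordinals,
which a branch, being decreasing, visits first. -/
theorem IterDer_subset_Der [Inhabited κ] (ξ : Ordinal.{w}) (L : List κ) :
    IterDer W ξ L T ⊆ Der W (labelOf ξ L) T (Ordinal.omega0 ^ ξ * L.length) := by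
  induction L with
  | nil => simp [IterDer, Der_zero]
  | cons c L ih =>
    intro l hl
    have h1 := Der_map (W' := W) id id tendsto_id [] (T' := Der W (labelOf ξ (c :: L)) T
      (Ordinal.omega0 ^ ξ * L.length)) (fun l hl => ?_) l hl
    · simp only [List.length_cons]
      push_cast
      rw [mul_add_one]
      refine Der_add _ _ ?_
      refine Der_congr (lab := fun _ => c) (fun β hβ => ?_) (by simpa [Function.comp_def] using h1)
      simp [labelOf]
    · simp only [List.nil_append, Prod.map_id, List.map_id]
      refine Der_congr (fun β hβ => ?_) (ih hl)
      simp [labelOf, hβ]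

/-! ### Weakly null trees from derivations -/

/-- The family of the points of a filter, directed by reverse inclusion. -/
def FilterIndex (W : Filter X) : Type u := {U : Set X // U ∈ W}ᵒᵈ

instance : PartialOrder (FilterIndex W) := inferInstanceAs (PartialOrder {U : Set X // U ∈ W}ᵒᵈ)

instance : Nonempty (FilterIndex W) := ⟨OrderDual.toDual ⟨univ, univ_mem⟩⟩

instance : IsDirectedOrder (FilterIndex W) :=
  ⟨fun U V => ⟨OrderDual.toDual ⟨(OrderDual.ofDual U).1 ∩ (OrderDual.ofDual V).1,
    inter_mem (OrderDual.ofDual U).2 (OrderDual.ofDual V).2⟩,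
    (inter_subset_left : (OrderDual.ofDual U).1 ∩ _ ⊆ _),
    (inter_subset_right : _ ∩ (OrderDual.ofDual V).1 ⊆ _)⟩⟩

/-- A point of `U` that extends the sequence `s` to a sequence in the derivation of order `β`. -/
def nextPoint (W : Filter X) (lab : Ordinal.{w} → κ) (T : Set (List (κ × X))) (x₀ : X)
    (s : List (κ × X)) (q : Ordinal.{w} × FilterIndex W) : X :=
  open Classical in
  if h : ∃ x ∈ (OrderDual.ofDual q.2).1, s ++ [(lab q.1, x)] ∈ Der W lab T q.1 then h.choose else x₀

/-- The sequences along the branches of the tree that is obtained from a derivation. -/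
def branchSeq (W : Filter X) (lab : Ordinal.{w} → κ) (T : Set (List (κ × X))) (x₀ : X)
    (t : List (Ordinal.{w} × FilterIndex W)) : List (κ × X) :=
  t.foldl (fun s q => s ++ [(lab q.1, nextPoint W lab T x₀ s q)]) []

theorem branchSeq_concat (x₀ : X) (t : List (Ordinal.{w} × FilterIndex W))
    (q : Ordinal.{w} × FilterIndex W) : branchSeq W lab T x₀ (t ++ [q]) =
      branchSeq W lab T x₀ t ++ [(lab q.1, nextPoint W lab T x₀ (branchSeq W lab T x₀ t) q)] := by
  simp [branchSeq]

theorem branchSeq_prefix (x₀ : X) {s t : List (Ordinal.{w} × FilterIndex W)} (h : s <+: t) :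
    branchSeq W lab T x₀ s <+: branchSeq W lab T x₀ t := by
  obtain ⟨r, rfl⟩ := h
  induction r using List.reverseRecOn with
  | nil => simp
  | append_singleton r q ih =>
    rw [← List.append_assoc, branchSeq_concat]
    exact ih.trans (List.prefix_append _ _)

/-- A decreasing sequence of ordinals less than `α`. -/
def IsDecreasing (α : Ordinal.{w}) (t : List Ordinal.{w}) : Prop :=
  t.Pairwise (· > ·) ∧ ∀ a ∈ t, a < α

theorem IsDecreasing.prefix {α : Ordinal.{w}} {s t : List Ordinal.{w}} (h : IsDecreasing α t)
    (hs : s <+: t) : IsDecreasing α s :=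
  ⟨h.1.sublist hs.sublist, fun a ha => h.2 a (hs.subset ha)⟩

/-- Invariant along a branch: the sequence built so far survives the derivation of order its last
ordinal, or α at the start. A smaller next ordinal then offers a suitable point in every U. -/
theorem branchSeq_mem {x₀ : X} {α : Ordinal.{w}} (h0 : [] ∈ Der W lab T α) :
    ∀ t : List (Ordinal.{w} × FilterIndex W), IsDecreasing α (t.map Prod.fst) →
      branchSeq W lab T x₀ t ∈ T ∧
      ∀ β, IsDecreasing α (t.map Prod.fst ++ [β]) → ∀ U : FilterIndex W,
        nextPoint W lab T x₀ (branchSeq W lab T x₀ t) (β, U) ∈ (OrderDual.ofDual U).1 ∧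
        branchSeq W lab T x₀ (t ++ [(β, U)]) ∈ Der W lab T β := by
  intro t
  have step : ∀ (s : List (κ × X)) (α' β : Ordinal.{w}), s ∈ Der W lab T α' → β < α' →
      ∀ U : FilterIndex W, nextPoint W lab T x₀ s (β, U) ∈ (OrderDual.ofDual U).1 ∧
        s ++ [(lab β, nextPoint W lab T x₀ s (β, U))] ∈ Der W lab T β := by
    intro s α' β hs hβ U
    have h : ∃ x ∈ (OrderDual.ofDual U).1, s ++ [(lab β, x)] ∈ Der W lab T β := by
      obtain ⟨x, hx, hU⟩ := (((mem_Der.1 hs).2 β hβ).and_eventually (OrderDual.ofDual U).2).exists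
      exact ⟨x, hU, hx⟩
    rw [nextPoint, dif_pos h]
    exact h.choose_spec
  induction t using List.reverseRecOn with
  | nil =>
    intro _
    refine ⟨Der_subset _ h0, fun β hβ U => ?_⟩
    rw [branchSeq_concat]
    exact step [] α β h0 (hβ.2 β (by simp)) U
  | append_singleton t q ih =>
    intro ht
    have h1 := (ih (ht.prefix (by simp))).2 q.1 (by simpa using ht) q.2
    refine ⟨Der_subset _ h1.2, fun β hβ U => ?_⟩
    rw [branchSeq_concat _ (t ++ [q])]
    refine step _ q.1 β h1.2 ?_ U
    have := hβ.1
    simp only [List.map_append, List.map_cons, List.map_nil, List.append_assoc,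
      List.pairwise_append] at this
    exact by simpa using this.2.1

/-- The index set consists of the members of the filter and the new point is chosen in U, so the
nets of successors converge along W. -/
theorem exists_tree_of_mem_Der {α : Ordinal.{w}} [Nonempty X] (h0 : [] ∈ Der W lab T α) :
    ∃ x : List (Ordinal.{w} × FilterIndex W) → X,
      (∀ (s : List (Ordinal.{w} × FilterIndex W)) (ζ : Ordinal.{w}),
        IsDecreasing α (s.map Prod.fst ++ [ζ]) → Tendsto (fun U => x (s ++ [(ζ, U)])) atTop W) ∧
      ∀ t : List (Ordinal.{w} × FilterIndex W), IsDecreasing α (t.map Prod.fst) →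
        ∃ l ∈ T, ∀ s q, s ++ [q] <+: t → (lab q.1, x (s ++ [q])) ∈ l := by
  obtain ⟨x₀⟩ := ‹Nonempty X›
  -- The point at a node is the one that its last pair adds to the sequence of its predecessor; x₀
  -- is only the value at the empty sequence, which is not a node.
  let x : List (Ordinal.{w} × FilterIndex W) → X := fun t =>
    match t.getLast? with
    | none => x₀
    | some q => nextPoint W lab T x₀ (branchSeq W lab T x₀ t.dropLast) q
  have hx : ∀ s q, x (s ++ [q]) = nextPoint W lab T x₀ (branchSeq W lab T x₀ s) q := by
    intro s q
    simp [x]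
  refine ⟨x, fun s ζ hs => ?_, fun t ht => ⟨branchSeq W lab T x₀ t, (branchSeq_mem h0 t ht).1, ?_⟩⟩
  · intro V hV
    rw [mem_map, mem_atTop_sets]
    refine ⟨OrderDual.toDual ⟨V, hV⟩, fun U hU => ?_⟩
    have hUV : (OrderDual.ofDual U).1 ⊆ V := hU
    rw [mem_preimage, hx]
    exact hUV ((branchSeq_mem h0 s (hs.prefix (List.prefix_append _ _))).2 ζ hs U).1
  · intro s q hsq
    refine (branchSeq_prefix x₀ hsq).subset ?_
    rw [branchSeq_concat, hx]
    simp

theorem Gamma_isDecreasing {ξ : Ordinal.{w}} {n : ℕ} {t : List Ordinal.{w}} (ht : t ∈ Gamma ξ n) :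
    IsDecreasing (Ordinal.omega0 ^ ξ * n) t := ⟨Gamma_pairwise ht, Gamma_lt ht⟩

/-- A node of level i + 1 ends in the interval of ordinals labelled L[i], by `Lambda_last` and
`labelOf_eq`. -/
theorem exists_tree_of_mem_IterDer [Nonempty X] {ξ : Ordinal.{w}} {L : List κ} (hL : L ≠ [])
    (h0 : [] ∈ IterDer W ξ L T) :
    ∃ x : List (Ordinal.{w} × FilterIndex W) → X,
      (∀ (s : List (Ordinal.{w} × FilterIndex W)) (ζ : Ordinal.{w}),
        s.map Prod.fst ++ [ζ] ∈ Gamma ξ L.length →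
        Tendsto (fun U => x (s ++ [(ζ, U)])) atTop W) ∧
      ∀ t ∈ dot (FilterIndex W) (Gamma ξ L.length), ∃ l ∈ T, ∀ i, ∀ hi : i < L.length, ∀ s,
        s <+: t → s ∈ dot (FilterIndex W) (Lambda ξ L.length (i + 1)) → (L[i], x s) ∈ l := by
  have : Inhabited κ := ⟨L.head hL⟩
  obtain ⟨x, h1, h2⟩ := exists_tree_of_mem_Der (IterDer_subset_Der ξ L h0)
  refine ⟨x, fun s ζ hs => h1 s ζ (Gamma_isDecreasing hs), fun t ht => ?_⟩
  obtain ⟨l, hl, h⟩ := h2 t (Gamma_isDecreasing ht)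
  refine ⟨l, hl, fun i hi s hs hsi => ?_⟩
  have h0 : s ≠ [] := by
    rintro rfl
    exact Gamma_ne_nil (Lambda_lt hsi) rfl
  obtain ⟨r, q, rfl⟩ : ∃ r q, s = r ++ [q] := by
    rcases List.eq_nil_or_concat s with h | ⟨r, b, h⟩
    · exact absurd h h0
    · exact ⟨r, b, by simpa using h⟩
  have h3 := h r q hs
  rw [mem_dot, List.map_append] at hsi
  obtain ⟨-, ρ, hρ, hq⟩ := Lambda_last hsi
  rwa [hq, labelOf_eq hi hρ] at h3

end SzTree

end

noncomputable section

namespace SzTree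

variable {D : Type u} {X : Type*} {κ : Type*}

/-! ### Cofinal sets of branches with heavy subsequences -/

/-- The nets of successors of the tree `(x_t)_{t ∈ Γ_{ξ,n}.D}` converge along the filter `W`. -/
def TreeTendsto [Preorder D] (W : Filter X) (ξ : Ordinal.{w}) (n : ℕ)
    (x : List (Ordinal.{w} × D) → X) : Prop :=
  ∀ (s : List (Ordinal.{w} × D)) (ζ : Ordinal.{w}), s.map Prod.fst ++ [ζ] ∈ Gamma ξ n →
    Tendsto (fun u : D => x (s ++ [(ζ, u)])) atTop W

/-- The points of a list of pairs, with the label `c`. -/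
def relabel (c : κ) (l : List (ℝ × X)) : List (κ × X) := l.map fun q => (c, q.2)

/-- Each list of `ls` with a label in `L` has a sublist of mass at least `δ`, such that the
concatenation of these sublists, with the labels in `L`, belongs to `T`. -/
def HeavyLevels (δ : ℝ) : List (Option κ) → List (List (ℝ × X)) → Set (List (κ × X)) → Prop
  | none :: L, _ :: ls, T => HeavyLevels δ L ls T
  | some c :: L, l :: ls, T => ∃ l', l'.Sublist l ∧ δ ≤ mass l' ∧
      HeavyLevels δ L ls {m | relabel c l' ++ m ∈ T}
  | [], _, T => [] ∈ T
  | _ :: _, [], T => [] ∈ T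

theorem HeavyLevels.mono {δ : ℝ} {L : List (Option κ)} {ls : List (List (ℝ × X))}
    {T T' : Set (List (κ × X))} (h : T ⊆ T') (hT : HeavyLevels δ L ls T) :
    HeavyLevels δ L ls T' := by
  induction L generalizing ls T T' with
  | nil => cases ls <;> exact h hT
  | cons o L ih =>
    cases ls with
    | nil => cases o <;> exact h hT
    | cons l ls =>
      cases o with
      | none => exact ih h hT
      | some c =>
        obtain ⟨l', h1, h2, h3⟩ := hT
        exact ⟨l', h1, h2, ih (fun m hm => h hm) h3⟩

theorem Hereditary.append_left {T : Set (List (κ × X))} (hT : Hereditary T) (p : List (κ × X)) :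
    Hereditary {m | p ++ m ∈ T} :=
  fun _ ht _ hs => hT _ ht _ ((List.Sublist.refl _).append hs)

/-- Averaging: a level marked true contributes at most 1 to the mass, and a level marked false less
than δ. The pieces in unmarked levels are discarded, which heredity permits. -/
theorem exists_heavyLevels {δ : ℝ} (h0 : 0 ≤ δ) (c : κ) (ls : List (List (ℝ × X)))
    (hls : ∀ l ∈ ls, ∀ l', l'.Sublist l → mass l' ≤ 1) (T : Set (List (κ × X)))
    (hT : Hereditary T) (l' : List (ℝ × X)) (h : l'.Sublist ls.flatten) (hl' : relabel c l' ∈ T) :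
    ∃ B : List Bool, B.length = ls.length ∧
      HeavyLevels δ (B.map fun b => if b then some c else none) ls T ∧
      mass l' ≤ B.count true + δ * ls.length := by
  induction ls generalizing T l' with
  | nil =>
    have : l' = [] := by simpa using h
    subst this
    exact ⟨[], rfl, hl', by simp [mass]⟩
  | cons l ls ih =>
    rw [List.flatten_cons, List.sublist_append_iff] at h
    obtain ⟨l1, l2, rfl, h1, h2⟩ := h
    have hm := mass_append l1 l2
    have hr : relabel c (l1 ++ l2) = relabel c l1 ++ relabel c l2 := by simp [relabel]
    have hls' : ∀ l ∈ ls, ∀ l', l'.Sublist l → mass l' ≤ 1 :=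
      fun l hl => hls l (List.mem_cons_of_mem _ hl)
    by_cases hδ : δ ≤ mass l1
    · obtain ⟨B, hB, hH, hc⟩ := ih hls' {m | relabel c l1 ++ m ∈ T}
        (hT.append_left _) l2 h2 (by rwa [hr] at hl')
      refine ⟨true :: B, by simp [hB], ⟨l1, h1, hδ, hH⟩, ?_⟩
      have := hls l List.mem_cons_self l1 h1
      simp only [List.count_cons_self, List.length_cons]
      push_cast
      linarith
    · obtain ⟨B, hB, hH, hc⟩ := ih hls' T hT l2 h2
        (hT _ hl' _ (by rw [hr]; exact List.sublist_append_right _ _))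
      refine ⟨false :: B, by simp [hB], hH, ?_⟩
      simp only [List.length_cons]
      push_cast
      rw [List.count_cons_of_ne (by simp)]
      linarith

theorem reduceOption_map_ite (c : κ) (B : List Bool) :
    (B.map fun b => if b then some c else none).reduceOption = List.replicate (B.count true) c := by
  induction B with
  | nil => rfl
  | cons b B ih =>
    cases b <;> simp [List.reduceOption_cons_of_none, List.reduceOption_cons_of_some, ih,
      List.replicate_succ]

theorem TreeTendsto.first [Preorder D] {W : Filter X} {ξ : Ordinal.{w}} {n : ℕ}
    {x : List (Ordinal.{w} × D) → X} (hx : TreeTendsto W ξ (n + 1) x) :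
    TreeTendsto W ξ 1 fun s => x (shiftD (Ordinal.omega0 ^ ξ * n) s) := by
  intro s ζ hs
  rw [Gamma_one] at hs
  have := hx (shiftD (Ordinal.omega0 ^ ξ * n) s) (Ordinal.omega0 ^ ξ * n + ζ)
    (mem_Gamma_succ.2 (Or.inl ⟨_, hs, by rw [map_fst_shiftD]; simp [shift]⟩))
  simpa [shiftD] using this

theorem TreeTendsto.next [Preorder D] [Nonempty D] {W : Filter X} {ξ : Ordinal.{w}} {n : ℕ}
    {x : List (Ordinal.{w} × D) → X} (hx : TreeTendsto W ξ (n + 1) x)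
    {u : List (Ordinal.{w} × D)} (hu : u ∈ maxDot D ξ 1) :
    TreeTendsto W ξ n fun s => x (shiftD (Ordinal.omega0 ^ ξ * n) u ++ s) := by
  intro s ζ hs
  have := hx (shiftD (Ordinal.omega0 ^ ξ * n) u ++ s) ζ
    (mem_Gamma_succ.2 (Or.inr ⟨_, mem_maxDot_one.1 hu, _, hs, by
      rw [List.map_append, map_fst_shiftD, List.append_assoc]⟩))
  simpa using this

theorem mass_sublist_le [Nonempty D] {ξ : Ordinal.{w}} {n : ℕ} (hn : 1 ≤ n) (x : List (Ordinal.{w} × D) → X)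
    {t : List (Ordinal.{w} × D)} (ht : t ∈ maxDot D ξ n) :
    ∀ l ∈ levs ξ n x t, ∀ l', l'.Sublist l → mass l' ≤ 1 := by
  intro l hl l' hl'
  rw [← mass_levs_of ξ (mass_nodes ξ) hn x ht l hl]
  obtain ⟨i, -, rfl⟩ := List.mem_map.1 hl
  refine (hl'.map _).sum_le_sum fun a ha => ?_
  obtain ⟨q, hq, rfl⟩ := List.mem_map.1 ha
  exact lev_fst_nonneg x t q hq

variable [Preorder D] [IsDirectedOrder D] [Nonempty D]

variable (D) (κ) in
/-- The derivation of order `ω ^ ξ` is reached if the set of branches of a tree on `Γ_{ξ,1}.D` that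
have a subsequence of mass at least `δ` in `T` is cofinal. -/
def DerivesAt (W : Filter X) (ξ : Ordinal.{w}) : Prop :=
  ∀ (T : Set (List (κ × X))), Hereditary T → ∀ (x : List (Ordinal.{w} × D) → X),
    TreeTendsto W ξ 1 x → ∀ (c : κ) (δ : ℝ), 0 < δ →
    cofinal1 D ξ {t | t ∈ maxDot D ξ 1 ∧ ∃ l', l'.Sublist (nodes ξ 1 x t) ∧ δ ≤ mass l' ∧
      relabel c l' ∈ T} → [] ∈ Der W (fun _ : Ordinal.{w} => c) T (Ordinal.omega0 ^ ξ)

/-- Induction on the levels. For each first block u a heavy sublist l' is fixed, the induction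
hypothesis shows that l' survives the later derivations, and `DerivesAt` is applied to the tree of
first blocks. -/
theorem nil_mem_IterDer_of {W : Filter X} {ξ : Ordinal.{w}} (hξ : DerivesAt D κ W ξ) {δ : ℝ}
    (hδ : 0 < δ) {n : ℕ} (hn : 1 ≤ n) (L : List (Option κ)) (hL : L.length = n)
    (T : Set (List (κ × X))) (hT : Hereditary T) (x : List (Ordinal.{w} × D) → X)
    (hx : TreeTendsto W ξ n x)
    (h : cofinalOf ξ (cofinal1 D ξ) n
      {t | t ∈ maxDot D ξ n ∧ HeavyLevels δ L (levs ξ n x t) T}) :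
    [] ∈ IterDer W ξ L.reduceOption T := by
  induction n, hn using Nat.le_induction generalizing L T x with
  | base =>
    obtain ⟨o, rfl⟩ := List.length_eq_one_iff.1 hL
    cases o with
    | none =>
      obtain ⟨t, ht, h⟩ := (isGrill_cofinal ξ le_rfl).nonempty h
      rw [levs_one x ht] at h
      exact h
    | some c =>
      refine hξ T hT x hx c δ hδ ((isGrill_cofinal1 ξ).mono ?_ h)
      rintro t ⟨ht, h⟩
      rw [levs_one x ht] at h
      obtain ⟨l', h1, h2, h3⟩ := h
      exact ⟨ht, l', h1, h2, by simpa [HeavyLevels] using h3⟩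
  | succ n hn ih =>
    obtain ⟨n, rfl⟩ : ∃ m, n = m + 1 := ⟨n - 1, by omega⟩
    obtain ⟨o, L, rfl⟩ := List.exists_of_length_succ L hL
    have hL' : L.length = n + 1 := by simpa using hL
    cases o with
    | none =>
      -- An unmarked level imposes no condition, so a single u with cofinally many continuations
      -- suffices.
      obtain ⟨u, hu, h⟩ := (isGrill_cofinal1 ξ).nonempty h
      refine ih L hL' T hT _ (hx.next hu) ((isGrill_cofinal ξ hn).mono ?_ h)
      rintro s ⟨hs, -, h⟩
      rw [levs_succ x hu hs] at h
      exact ⟨hs, h⟩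
    | some c =>
      rw [List.reduceOption_cons_of_some]
      refine hξ _ (hT.iterDer ξ _) _ hx.first c δ hδ ((isGrill_cofinal1 ξ).mono ?_ h)
      rintro u ⟨hu, h⟩
      refine ⟨hu, ?_⟩
      -- The sublist chosen in the first block depends on the continuation s, but the block has
      -- finitely many sublists, so one of them works for cofinally many s.
      have hfin : Set.Finite {l' | l' ∈ (nodes ξ 1
          (fun s => x (shiftD (Ordinal.omega0 ^ ξ * (n + 1 : ℕ)) s)) u).sublists} :=
        List.finite_toSet _
      obtain ⟨l', hl', h'⟩ := (isGrill_cofinal ξ hn).exists_of_finite hfin h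
        (P := fun l' s => s ∈ maxDot D ξ (n + 1) ∧ δ ≤ mass l' ∧ HeavyLevels δ L (levs ξ (n + 1)
          (fun s => x (shiftD (Ordinal.omega0 ^ ξ * (n + 1 : ℕ)) u ++ s)) s)
          {m | relabel c l' ++ m ∈ T}) (by
        rintro s ⟨hs, -, h⟩
        rw [levs_succ x hu hs] at h
        obtain ⟨l', h1, h2, h3⟩ := h
        exact ⟨l', List.mem_sublists.2 h1, hs, h2, h3⟩)
      obtain ⟨s, -, -, h2, -⟩ := (isGrill_cofinal ξ hn).nonempty h'
      refine ⟨l', List.mem_sublists.1 hl', h2, ?_⟩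
      have := ih L hL' _ (hT.append_left (relabel c l')) _ (hx.next hu)
        ((isGrill_cofinal ξ hn).mono (fun s hs => ⟨hs.2.1, hs.2.2.2⟩) h')
      -- With l' as a prefix, survival of the empty sequence for the set of continuations becomes
      -- survival of l' for T.
      have h3 := IterDer_map (W' := W) id id tendsto_id (relabel c l') (T' := T)
        (fun l hl => by simpa using hl) ξ L.reduceOption [] this
      simpa using h3

theorem derivesAt_zero (W : Filter X) : DerivesAt D κ W (0 : Ordinal.{w}) := by
  intro T hT x hx c δ hδ h
  rw [cofinal1_zero] at h
  rw [Ordinal.opow_zero]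
  have h1 : ∃ᶠ u : D in atTop, [(c, x [(0, u)])] ∈ T := by
    rw [Filter.frequently_atTop]
    intro u
    obtain ⟨v, ⟨hv, l', hl, hl2, hl3⟩, huv⟩ := h u
    refine ⟨v, huv, ?_⟩
    -- Positive mass excludes the empty sublist, so the single node of the branch is used.
    have : l' ≠ [] := by
      rintro rfl
      simp only [mass, List.map_nil, List.sum_nil] at hl2
      linarith
    simp only [nodes, prefixes, List.length_cons, List.length_nil, List.range_succ,
      List.range_zero, List.nil_append, List.map_cons, List.map_nil, zero_add,
      List.take_succ_cons, List.take_nil] at hl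
    rcases List.sublist_singleton.1 hl with h | h
    · exact absurd h this
    · simpa [h, relabel] using hl3
  have h2 := (hx [] 0 (by rw [Gamma_one, Gamma1_zero]; rfl)).frequently
    (p := fun y => [(c, y)] ∈ T) (by simpa using h1)
  refine mem_Der.2 ⟨?_, fun β hβ => ?_⟩
  · obtain ⟨y, hy⟩ := h2.exists
    exact hT _ hy _ (List.nil_sublist _)
  · rw [Order.lt_one_iff] at hβ
    subst hβ
    simpa [Der_zero] using h2

/-- An order below ω^ξ is below ω^η for some η < ξ, and an index ζ ≥ η of the cofinal set M provides
order ω^(ζ+1). -/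
theorem derivesAt_limit {W : Filter X} {ξ : Ordinal.{w}} (hξ : Order.IsSuccLimit ξ)
    (ih : ∀ ζ < ξ, DerivesAt D κ W ζ) : DerivesAt D κ W ξ := by
  intro T hT x hx c δ hδ h
  rw [cofinal1_limit hξ] at h
  obtain ⟨M, hM, h⟩ := h
  have hω : Order.IsSuccLimit (Ordinal.omega0 ^ ξ) :=
    Ordinal.isSuccLimit_opow Ordinal.one_lt_omega0 hξ
  refine mem_Der_of_isSuccLimit hω fun β hβ => ?_
  obtain ⟨η, hη, hβη⟩ := (Ordinal.lt_opow_of_isSuccLimit Ordinal.omega0_ne_zero hξ).1 hβ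
  obtain ⟨ζ, hζM, hηζ, hζ⟩ := hM η hη
  have hle : β ≤ Ordinal.omega0 ^ (ζ + 1) := hβη.le.trans
    (Ordinal.opow_le_opow_right Ordinal.omega0_pos (hηζ.trans (le_self_add)))
  refine Der_anti hle (ih (ζ + 1) (hξ.succ_lt hζ) T hT
    (fun s => x (shiftD (Ordinal.omega0 ^ ζ) s)) ?_ c δ hδ
    ((isGrill_cofinal1 _).mono ?_ (h ζ hζM hζ)))
  · intro s η hs
    rw [Gamma_one] at hs
    have := hx (shiftD (Ordinal.omega0 ^ ζ) s) (Ordinal.omega0 ^ ζ + η) (by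
      rw [Gamma_one, Gamma1_limit ξ hξ]
      exact ⟨ζ, hζ, _, hs, by rw [map_fst_shiftD]; simp [shift]⟩)
    simpa [shiftD] using this
  · rintro s ⟨hs, -, h⟩
    rw [nodes_limit hξ hζ x (mem_maxDot_one.1 hs).1] at h
    exact ⟨hs, h⟩

/-- Orders below ω^(η+1) lie below some ω^η k. For large n in M, a branch of Γ_{η,n} carrying mass δ
has at least k levels carrying δ/2, and k derivations of order ω^η amount to one of order ω^η k. -/
theorem derivesAt_add_one {W : Filter X} {η : Ordinal.{w}} (ih : DerivesAt D κ W η) :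
    DerivesAt D κ W (η + 1) := by
  intro T hT x hx c δ hδ h
  rw [cofinal1_add_one] at h
  obtain ⟨M, hM, h⟩ := h
  have hω : Order.IsSuccLimit (Ordinal.omega0 ^ (η + 1)) :=
    Ordinal.isSuccLimit_opow_left Ordinal.isSuccLimit_omega0 (by simp)
  refine mem_Der_of_isSuccLimit hω fun β hβ => ?_
  rw [Ordinal.opow_add, Ordinal.opow_one] at hβ
  obtain ⟨γ, hγ, hβγ⟩ := (Ordinal.lt_mul_iff_of_isSuccLimit Ordinal.isSuccLimit_omega0).1 hβ
  obtain ⟨k, rfl⟩ := Ordinal.lt_omega0.1 hγ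
  -- Before division by n the mass is at least nδ, and light levels account for at most nδ/2 of it;
  -- for n ≥ N the rest exceeds k.
  obtain ⟨N, hN⟩ := exists_nat_gt (2 * k / δ)
  obtain ⟨n, hnM, hn'⟩ := hM (max N 1)
  have hn : 1 ≤ n := (le_max_right _ _).trans hn'
  have hkn : (k : ℝ) < n * (δ / 2) := by
    have : (N : ℝ) ≤ n := by exact_mod_cast (le_max_left _ _).trans hn'
    have := hN.trans_le this
    rw [div_lt_iff₀ hδ] at this
    linarith
  -- The heavy levels form one of finitely many Boolean patterns of length n, so one pattern occurs
  -- on a cofinal set.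
  obtain ⟨B, hB, h'⟩ := (isGrill_cofinal η hn).exists_of_finite
    (S := {B : List Bool | B.length = n}) (List.finite_length_eq Bool n) (h n hnM hn)
    (P := fun B t => t ∈ maxDot D η n ∧ HeavyLevels (δ / 2)
      (B.map fun b => if b then some c else none) (levs η n x t) T ∧ k ≤ B.count true) (by
    rintro t ⟨⟨ht, l', hl', hm, hT'⟩, htn⟩
    have ht' : t ∈ maxDot D η n :=
      mem_maxDot.2 (maxNodes_of_mem_Gamma hn (mem_maxDot_one.1 ht) htn)
    rw [nodes_add_one hn x htn, ← flatten_levs hn x ht'] at hl'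
    obtain ⟨l, hl, rfl⟩ := List.sublist_map_iff.1 hl'
    rw [mass_map_mul] at hm
    obtain ⟨B, hB, hH, hc⟩ := exists_heavyLevels (half_pos hδ).le c _ (mass_sublist_le hn x ht') T hT l
      hl (by simpa [relabel, Function.comp_def] using hT')
    have hlen : (levs η n x t).length = n := by simp [levs]
    rw [hlen] at hB hc
    refine ⟨B, hB, ht', hH, ?_⟩
    have hn0 : (0 : ℝ) < n := by exact_mod_cast hn
    rw [inv_mul_eq_div, le_div_iff₀ hn0] at hm
    have : (k : ℝ) ≤ B.count true := by linarith
    exact_mod_cast this)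
  obtain ⟨t, -, -, -, hk⟩ := (isGrill_cofinal η hn).nonempty h'
  have hxη : TreeTendsto W η n x := by
    intro s ζ hs
    refine hx s ζ ?_
    rw [Gamma_one, Gamma1_add_one]
    exact ⟨n, hn, hs⟩
  have := nil_mem_IterDer_of ih (half_pos hδ) hn _ (by simpa using hB) T hT x hxη
    ((isGrill_cofinal η hn).mono (fun t ht => ⟨ht.2.1, ht.2.2.1⟩) h')
  rw [reduceOption_map_ite] at this
  refine Der_anti (hβγ.le.trans ?_) (IterDer_replicate η c _ this)
  gcongr

theorem derivesAt (W : Filter X) (ξ : Ordinal.{w}) : DerivesAt D κ W ξ := by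
  induction ξ using Ordinal.limitRecOn with
  | zero => exact derivesAt_zero W
  | add_one η ih => exact derivesAt_add_one ih
  | limit ξ hξ ih => exact derivesAt_limit hξ ih

end SzTree

end

noncomputable section

namespace SzTree

/-! ### Masses and averages -/

section Lists

variable {X : Type*}

/-- Values below the threshold c are bounded by c, the others by R. An average that exceeds c thus
forces mass above the threshold. -/
theorem weighted_sum_le {φ : X → ℝ} {c R : ℝ} (l : List (ℝ × X))
    (h0 : ∀ q ∈ l, 0 ≤ q.1) (hR : ∀ q ∈ l, φ q.2 ≤ R) :
    (l.map fun q => q.1 * φ q.2).sum ≤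
      c * mass l + (R - c) * mass (l.filter fun q => c ≤ φ q.2) := by
  induction l with
  | nil => simp [mass]
  | cons q l ih =>
    have ih := ih (fun q hq => h0 q (List.mem_cons_of_mem _ hq))
      (fun q hq => hR q (List.mem_cons_of_mem _ hq))
    have hq0 := h0 q List.mem_cons_self
    have hqR := hR q List.mem_cons_self
    have hm : ∀ l' : List (ℝ × X), mass (q :: l') = q.1 + mass l' := fun l' => by simp [mass]
    rw [List.map_cons, List.sum_cons, hm]
    by_cases h : c ≤ φ q.2
    · rw [List.filter_cons_of_pos (by simpa using h), hm]
      nlinarith [mul_le_mul_of_nonneg_left hqR hq0]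
    · rw [List.filter_cons_of_neg (by simpa using h)]
      nlinarith [mul_le_mul_of_nonneg_left (not_le.1 h).le hq0]

theorem le_weighted_sum {φ : X → ℝ} {c : ℝ} (l : List (ℝ × X))
    (h0 : ∀ q ∈ l, 0 ≤ q.1) (hc : ∀ q ∈ l, c ≤ φ q.2) :
    c * mass l ≤ (l.map fun q => q.1 * φ q.2).sum := by
  induction l with
  | nil => simp [mass]
  | cons q l ih =>
    have ih := ih (fun q hq => h0 q (List.mem_cons_of_mem _ hq))
      (fun q hq => hc q (List.mem_cons_of_mem _ hq))
    have hm : mass (q :: l) = q.1 + mass l := by simp [mass]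
    rw [List.map_cons, List.sum_cons, hm]
    nlinarith [mul_le_mul_of_nonneg_left (hc q List.mem_cons_self) (h0 q List.mem_cons_self)]

open Classical in
theorem exists_mass_filter {κ : Type*} [Fintype κ] [Nonempty κ] (χ : X → κ) (l : List (ℝ × X)) :
    ∃ k, mass l ≤ Fintype.card κ * mass (l.filter fun q => χ q.2 = k) := by
  have hsum : ∑ k, mass (l.filter fun q => χ q.2 = k) = mass l := by
    induction l with
    | nil => simp [mass]
    | cons q l ih =>
      have : ∀ k, mass ((q :: l).filter fun q => χ q.2 = k) =
          (if χ q.2 = k then q.1 else 0) + mass (l.filter fun q => χ q.2 = k) := by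
        intro k
        by_cases h : χ q.2 = k
        · rw [List.filter_cons_of_pos (by simpa using h), if_pos h]; simp [mass]
        · rw [List.filter_cons_of_neg (by simpa using h), if_neg h, zero_add]
      simp_rw [this, Finset.sum_add_distrib, ih]
      simp [mass]
  obtain ⟨k, -, hk⟩ := Finset.exists_max_image Finset.univ
    (fun k => mass (l.filter fun q => χ q.2 = k)) Finset.univ_nonempty
  refine ⟨k, ?_⟩
  rw [← hsum]
  refine (Finset.sum_le_card_nsmul _ _ _ hk).trans ?_
  simp [nsmul_eq_mul]

open Classical in
theorem heavyLevels_of_forall₂ {κ : Type*} {P : κ → X → Prop} {μ : ℝ} {L : List κ}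
    {ls : List (List (ℝ × X))}
    (h : List.Forall₂ (fun c l => μ ≤ mass (l.filter fun q => P c q.2)) L ls) :
    HeavyLevels μ (L.map some) ls {m | ∀ q ∈ m, P q.1 q.2} := by
  induction h with
  | nil => simp [HeavyLevels]
  | @cons c l L ls h1 _ ih =>
    refine ⟨_, List.filter_sublist, h1, ih.mono fun m hm q hq => ?_⟩
    rcases List.mem_append.1 hq with hq | hq
    · obtain ⟨q', hq', rfl⟩ := List.mem_map.1 hq
      simpa using List.of_mem_filter hq'
    · exact hm q hq

theorem reduceOption_map_some {κ : Type*} (L : List κ) : (L.map some).reduceOption = L := by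
  induction L with
  | nil => rfl
  | cons c L ih => simp [List.reduceOption_cons_of_some, ih]

end Lists

theorem mem_lev {X : Type*} {D : Type u} {ξ : Ordinal.{w}} {n i : ℕ} {x : List (Ordinal.{w} × D) → X}
    {t : List (Ordinal.{w} × D)} {q : ℝ × X} (hq : q ∈ lev ξ n i x t) :
    ∃ s, s <+: t ∧ s ∈ dot D (Lambda ξ n i) ∧ q.2 = x s := by
  obtain ⟨s, hs, rfl⟩ := List.mem_map.1 hq
  rw [List.mem_filter, mem_prefixes] at hs
  exact ⟨s, hs.1.1, mem_dot.2 (by simpa using hs.2), rfl⟩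

variable {𝕜 : Type v} [RCLike 𝕜] {X : Type u} [NormedAddCommGroup X] [NormedSpace 𝕜 X]
  {D : Type u}

/-! ### Weakly null trees -/

variable (𝕜 X) in
/-- The filter of the weak neighbourhoods of `0`. -/
def weakZero : Filter X := ⨅ f : StrongDual 𝕜 X, comap f (𝓝 0)

theorem tendsto_weakZero {β : Type*} {l : Filter β} {g : β → X} :
    Tendsto g l (weakZero 𝕜 X) ↔ ∀ f : StrongDual 𝕜 X, Tendsto (fun b => f (g b)) l (𝓝 0) := by
  simp [weakZero, tendsto_iInf, tendsto_comap_iff, Function.comp_def]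

theorem tendsto_clm_weakZero {Z : Type*} [NormedAddCommGroup Z] [NormedSpace 𝕜 Z] (Q : X →L[𝕜] Z) :
    Tendsto Q (weakZero 𝕜 X) (weakZero 𝕜 Z) :=
  tendsto_weakZero.2 fun f => tendsto_weakZero.1 tendsto_id (f.comp Q)

theorem isWeaklyNull_iff [Preorder D] {ξ : Ordinal.{w}} {n : ℕ} {x : List (Ordinal.{w} × D) → X} :
    IsWeaklyNull 𝕜 ξ n x ↔ TreeTendsto (weakZero 𝕜 X) ξ n x := by
  simp only [IsWeaklyNull, TreeTendsto, tendsto_weakZero]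

theorem zvec_eq (ξ : Ordinal.{w}) (n i : ℕ) (x : List (Ordinal.{w} × D) → X)
    (t : List (Ordinal.{w} × D)) :
    zvec 𝕜 ξ n i x t = ((lev ξ n i x t).map fun q => ((q.1 : ℝ) : 𝕜) • q.2).sum := by
  classical
  have h1 : ∀ (l : List (List (Ordinal.{w} × D))) (p : List (Ordinal.{w} × D) → Prop)
      (f : List (Ordinal.{w} × D) → X), ((l.filter fun s => p s).map f).sum =
        (l.map fun s => if p s then f s else 0).sum := by
    intro l p f
    induction l with
    | nil => simp
    | cons s l ih => by_cases h : p s <;> simp [h, ih]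
  have h2 : ∀ (m : ℕ) (f : ℕ → X), ∑ k ∈ Finset.range m, f k = ((List.range m).map f).sum := by
    intro m f
    induction m with
    | zero => simp
    | succ m ih => simp [Finset.sum_range_succ, List.range_succ, ih]
  rw [zvec, lev, List.map_map, h2]
  have h3 := h1 (prefixes t) (fun s => s.map Prod.fst ∈ Lambda ξ n i)
    (fun s => ((weight ξ n (s.map Prod.fst) : ℝ) : 𝕜) • x s)
  simp only [prefixes, List.map_map] at h3
  simp only [mem_dot]
  convert! h3.symm using 2

theorem re_apply_zvec (y : StrongDual 𝕜 X) (ξ : Ordinal.{w}) (n i : ℕ)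
    (x : List (Ordinal.{w} × D) → X) (t : List (Ordinal.{w} × D)) :
    RCLike.re (y (zvec 𝕜 ξ n i x t)) =
      ((lev ξ n i x t).map fun q => q.1 * RCLike.re (y q.2)).sum := by
  rw [zvec_eq]
  induction lev ξ n i x t with
  | nil => simp
  | cons q l ih => simp [ih]

/-- A bound for a functional on the nodes of a level is a bound for the average. -/
theorem le_re_apply_zvec [Nonempty D] {y : StrongDual 𝕜 X} {ξ : Ordinal.{w}} {n i : ℕ} (hi : i < n)
    {x : List (Ordinal.{w} × D) → X} {t : List (Ordinal.{w} × D)} (ht : t ∈ maxDot D ξ n) {c : ℝ}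
    (h : ∀ s, s <+: t → s ∈ dot D (Lambda ξ n (i + 1)) → c ≤ RCLike.re (y (x s))) :
    c ≤ RCLike.re (y (zvec 𝕜 ξ n (i + 1) x t)) := by
  rw [re_apply_zvec]
  have := le_weighted_sum (φ := fun v => RCLike.re (y v)) (lev ξ n (i + 1) x t)
    (lev_fst_nonneg x t) (c := c) (fun q hq => by
      obtain ⟨s, h1, h2, h3⟩ := mem_lev hq
      rw [h3]
      exact h s h1 h2)
  rwa [mass_lev hi x ht, mul_one] at this

theorem exists_mem_level [Nonempty D] {ξ : Ordinal.{w}} {n i : ℕ} (hi : i < n) :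
    ∃ s, s ∈ dot D (Lambda ξ n (i + 1)) := by
  obtain ⟨t, ht⟩ := maxDot_nonempty (D := D) ξ (show 1 ≤ n by omega)
  have h := mass_lev hi (fun _ => (0 : ℝ)) ht
  have : lev ξ n (i + 1) (fun _ => (0 : ℝ)) t ≠ [] := by
    intro h0
    simp [h0, mass] at h
  obtain ⟨q, hq⟩ := List.exists_mem_of_ne_nil _ this
  obtain ⟨s, hs, -⟩ := List.mem_map.1 hq
  exact ⟨s, mem_dot.2 (by simpa using List.of_mem_filter hs)⟩

/-! ### Stable sets: one functional per branch -/

variable {Y : Type*} [NormedAddCommGroup Y] [NormedSpace 𝕜 Y]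

/-- The labelled sequences in the unit ball, with the properties `G`, on which a functional in the
unit ball of `Y^*` is bounded below by the constants `c`. -/
def StableSet {κ : Type*} (A : X →L[𝕜] Y) (a : κ → 𝕜) (c : κ → ℝ) (G : κ → X → Prop) :
    Set (List (κ × X)) :=
  {l | ∃ y : StrongDual 𝕜 Y, ‖y‖ ≤ 1 ∧ ∀ q ∈ l, G q.1 q.2 ∧ ‖q.2‖ ≤ 1 ∧
    c q.1 ≤ RCLike.re (y (A (a q.1 • q.2)))}

theorem hereditary_stableSet {κ : Type*} (A : X →L[𝕜] Y) (a : κ → 𝕜) (c : κ → ℝ)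
    (G : κ → X → Prop) : Hereditary (StableSet A a c G) := by
  rintro t ⟨y, hy, h⟩ s hs
  exact ⟨y, hy, fun q hq => h q (hs.subset hq)⟩

/-- The same functional serves a whole branch, so its lower bounds at the nodes pass to the averages
over that branch. -/
theorem exists_tree_of_mem_stableSet {κ : Type*} {A : X →L[𝕜] Y} {a : κ → 𝕜} {c : κ → ℝ}
    {G : κ → X → Prop} {ξ : Ordinal.{w}} {L : List κ} (hL : L ≠ [])
    (h : [] ∈ IterDer (weakZero 𝕜 X) ξ L (StableSet A a c G)) :
    ∃ (D : Type u) (_ : Preorder D) (_ : IsDirectedOrder D) (_ : Nonempty D)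
      (x : List (Ordinal.{w} × D) → X), IsWeaklyNull 𝕜 ξ L.length x ∧ InUnitBall ξ L.length x ∧
      (∀ i (hi : i < L.length), ∀ s ∈ dot D (Lambda ξ L.length (i + 1)), G L[i] (x s)) ∧
      ∀ t ∈ maxDot D ξ L.length, ∃ y : StrongDual 𝕜 Y, ‖y‖ ≤ 1 ∧ ∀ i (hi : i < L.length),
        c L[i] ≤ RCLike.re (y (A (a L[i] • zvec 𝕜 ξ L.length (i + 1) x t))) := by
  obtain ⟨x, hx, ht⟩ := exists_tree_of_mem_IterDer hL h
  have hnode : ∀ i (hi : i < L.length), ∀ s ∈ dot _ (Lambda ξ L.length (i + 1)),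
      G L[i] (x s) ∧ ‖x s‖ ≤ 1 := by
    intro i hi s hs
    obtain ⟨l, ⟨y, hy, hl⟩, h⟩ := ht s (Lambda_lt hs)
    have := hl _ (h i hi s List.prefix_rfl hs)
    exact ⟨this.1, this.2.1⟩
  refine ⟨_, inferInstance, inferInstance, inferInstance, x, isWeaklyNull_iff.2 hx, ?_,
    fun i hi s hs => (hnode i hi s hs).1, fun t ht' => ?_⟩
  · intro s hs
    obtain ⟨i, h1, h2, hi⟩ := mem_Gamma_iff.1 hs
    obtain ⟨i, rfl⟩ : ∃ j, i = j + 1 := ⟨i - 1, by omega⟩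
    exact (hnode i (by omega) s hi).2
  · obtain ⟨l, ⟨y, hy, hl⟩, h⟩ := ht t ht'.1
    refine ⟨y, hy, fun i hi => ?_⟩
    exact le_re_apply_zvec (y := y.comp (a L[i] • A)) hi ht'
      (fun s hs hs' => by simpa using (hl _ (h i hi s hs hs')).2.2) |>.trans_eq (by simp)

theorem re_le_of_norm_le_one {Z : Type*} [NormedAddCommGroup Z] [NormedSpace 𝕜 Z]
    {y : StrongDual 𝕜 Z} (hy : ‖y‖ ≤ 1) (z : Z) : RCLike.re (y z) ≤ ‖z‖ :=
  (RCLike.re_le_norm _).trans ((y.le_opNorm z).trans (mul_le_of_le_one_left (norm_nonneg _) hy))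

theorem exists_re_eq_norm {Z : Type*} [NormedAddCommGroup Z] [NormedSpace 𝕜 Z] (z : Z) :
    ∃ y : StrongDual 𝕜 Z, ‖y‖ ≤ 1 ∧ RCLike.re (y z) = ‖z‖ := by
  obtain ⟨y, h1, h2⟩ := exists_dual_vector'' 𝕜 z
  exact ⟨y, h1, by rw [h2]; simp⟩

variable [Preorder D] [IsDirectedOrder D] [Nonempty D]

/-- If the norms of the images of the combinations `∑ a_i z_i^t` are greater than `ε'` for a cofinal
set of `t`, then, up to `δ`, this can be achieved with functionals that are bounded below by a
constant on each level, and with a constant colour on each level. -/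
theorem exists_stable {ξ : Ordinal.{w}} {A : X →L[𝕜] Y} {n : ℕ} (hn : 1 ≤ n) (a : Fin n → 𝕜)
    {x : List (Ordinal.{w} × D) → X} (hx : IsWeaklyNull 𝕜 ξ n x) (hb : InUnitBall ξ n x)
    {G : Fin n → X → Prop} (hG : ∀ i : Fin n, ∀ t ∈ dot D (Lambda ξ n (i + 1)), G i (x t))
    {κ : Type*} [Finite κ] (χ : X → κ) {ε' : ℝ}
    (hcof : cofinalOf ξ (cofinal1 D ξ) n {t | t ∈ maxDot D ξ n ∧
      ε' < ‖A (∑ i : Fin n, a i • zvec 𝕜 ξ n (i + 1) x t)‖}) {δ : ℝ} (hδ : 0 < δ) :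
    ∃ (k : Fin n → κ) (c : Fin n → ℝ), ε' - δ < ∑ i, c i ∧
      [] ∈ IterDer (weakZero 𝕜 X) ξ (List.finRange n)
        (StableSet A a c fun i v => G i v ∧ χ v = k i) := by
  classical
  have := Fintype.ofFinite κ
  have : Nonempty κ := ⟨χ 0⟩
  -- Rounding costs 2δ' on each of the n levels, hence δ in total.
  set δ' : ℝ := δ / (2 * n) with hδ'
  have hn0 : (0 : ℝ) < n := by exact_mod_cast hn
  have hδ'0 : 0 < δ' := by positivity
  set R : ℝ := ‖A‖ * ∑ i, ‖a i‖ with hR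
  have hR0 : 0 ≤ R := by positivity
  -- N bounds the grid indices of all numbers in [-R, R].
  obtain ⟨N, hN⟩ := exists_nat_gt (R / δ' + 1)
  have hNR : R + δ' < N * δ' := by
    have := (lt_div_iff₀ hδ'0).1 (show R / δ' + 1 < (N * δ') / δ' by rwa [mul_div_cancel_right₀ _ hδ'0.ne'])
    rwa [add_mul, div_mul_cancel₀ _ hδ'0.ne', one_mul] at this
  set M : ℝ := R + (N + 1) * δ' with hM
  have hM0 : 0 < M := by positivity
  -- An average that exceeds a threshold by δ', with no value exceeding it by more than M, forces
  -- mass δ'/M above the threshold; some colour receives at least an equal share of it.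
  set μ : ℝ := δ' / (M * Fintype.card κ) with hμ
  have hcard : (0 : ℝ) < Fintype.card κ := by exact_mod_cast Fintype.card_pos
  have hμ0 : 0 < μ := by positivity
  let P : (Fin n → ℤ) × (Fin n → κ) → StrongDual 𝕜 Y → Fin n → X → Prop := fun s y i v =>
    ((s.1 i - 1 : ℝ) * δ' ≤ RCLike.re (y (A (a i • v)))) ∧ χ v = s.2 i
  -- The finitely many patterns: for each level, the grid index of its average and a colour.
  let S : Set ((Fin n → ℤ) × (Fin n → κ)) :=
    {s | (∀ i, s.1 i ∈ Icc (-N : ℤ) N) ∧ ε' < ∑ i, (s.1 i + 1 : ℝ) * δ'}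
  have hS : S.Finite := by
    refine ((Set.Finite.pi' fun _ => finite_Icc (-N : ℤ) N).prod (finite_univ (α := Fin n → κ))).subset ?_
    rintro ⟨q, k⟩ ⟨h, -⟩
    exact ⟨h, mem_univ _⟩
  obtain ⟨s, hsS, hs⟩ := (isGrill_cofinal ξ hn).exists_of_finite hS hcof
    (P := fun s t => ∃ y : StrongDual 𝕜 Y, ‖y‖ ≤ 1 ∧ ∀ i : Fin n,
      μ ≤ mass ((lev ξ n (i + 1) x t).filter fun q => P s y i q.2)) (by
    rintro t ⟨ht, hnorm⟩
    obtain ⟨y, hy, hyt⟩ := exists_re_eq_norm (𝕜 := 𝕜) (A (∑ i : Fin n, a i • zvec 𝕜 ξ n (i + 1) x t))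
    let Φ : Fin n → StrongDual 𝕜 X := fun i => y.comp (a i • A)
    have hΦ : ∀ i v, RCLike.re (Φ i v) = RCLike.re (y (A (a i • v))) := fun i v => by simp [Φ]
    have hbd : ∀ i v, ‖v‖ ≤ 1 → |RCLike.re (Φ i v)| ≤ R := by
      intro i v hv
      refine (RCLike.abs_re_le_norm _).trans ?_
      calc ‖Φ i v‖ = ‖y (A (a i • v))‖ := by simp [Φ]
        _ ≤ ‖A (a i • v)‖ := (y.le_opNorm _).trans (mul_le_of_le_one_left (norm_nonneg _) hy)
        _ ≤ ‖A‖ * (‖a i‖ * ‖v‖) := by rw [← norm_smul]; exact A.le_opNorm _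
        _ ≤ ‖A‖ * (∑ i, ‖a i‖) := by
          gcongr
          refine (mul_le_of_le_one_right (norm_nonneg _) hv).trans ?_
          exact Finset.single_le_sum (f := fun i => ‖a i‖) (fun i _ => norm_nonneg _)
            (Finset.mem_univ i)
    have hball : ∀ i : Fin n, ∀ s ∈ dot D (Lambda ξ n (i + 1)), ‖x s‖ ≤ 1 :=
      fun i s hs => hb s (Lambda_lt hs)
    set g : Fin n → ℝ := fun i => RCLike.re (Φ i (zvec 𝕜 ξ n (i + 1) x t)) with hg
    have hglow : ∀ i, -R ≤ g i := fun i => le_re_apply_zvec i.2 ht fun s _ hs =>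
      (abs_le.1 (hbd i _ (hball i s hs))).1
    have hghigh : ∀ i, g i ≤ R := fun i => by
      have := le_re_apply_zvec (y := -Φ i) (c := -R) i.2 ht fun s _ hs => by
        have := (abs_le.1 (hbd i _ (hball i s hs))).2
        simpa using this
      simpa using this
    let q : Fin n → ℤ := fun i => ⌊g i / δ'⌋
    have hq1 : ∀ i, (q i : ℝ) * δ' ≤ g i := fun i =>
      (le_div_iff₀ hδ'0).1 (Int.floor_le _)
    have hq2 : ∀ i, g i < (q i + 1 : ℝ) * δ' := fun i =>
      (div_lt_iff₀ hδ'0).1 (Int.lt_floor_add_one _)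
    have hqN : ∀ i, q i ∈ Icc (-N : ℤ) N := by
      intro i
      constructor
      · have h : (-N : ℝ) * δ' < (q i + 1 : ℝ) * δ' := by
          have := hq2 i; have := hglow i; linarith
        have := lt_of_mul_lt_mul_right h hδ'0.le
        have : (-N : ℤ) < q i + 1 := by exact_mod_cast this
        omega
      · have h : (q i : ℝ) * δ' < (N : ℝ) * δ' := by
          have := hq1 i; have := hghigh i; linarith
        have := lt_of_mul_lt_mul_right h hδ'0.le
        have : q i < (N : ℤ) := by exact_mod_cast this
        omega
    have hmass : ∀ i : Fin n, ∃ k : κ, μ ≤ mass (((lev ξ n (i + 1) x t).filter fun p =>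
        ((q i - 1 : ℝ) * δ' ≤ RCLike.re (Φ i p.2))).filter fun p => χ p.2 = k) := by
      intro i
      obtain ⟨k, hk⟩ := exists_mass_filter χ ((lev ξ n (i + 1) x t).filter fun p =>
        ((q i - 1 : ℝ) * δ' ≤ RCLike.re (Φ i p.2)))
      refine ⟨k, ?_⟩
      -- The threshold is one grid step below the rounded average, so that the average exceeds it by
      -- at least δ'.
      have h1 := weighted_sum_le (φ := fun v => RCLike.re (Φ i v)) (c := (q i - 1 : ℝ) * δ') (lev ξ n (i + 1) x t)
        (lev_fst_nonneg x t) (fun p hp => by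
          obtain ⟨s, -, h2, h3⟩ := mem_lev hp
          rw [h3]
          exact (abs_le.1 (hbd i _ (hball i s h2))).2)
      rw [← re_apply_zvec, mass_lev i.2 x ht, mul_one] at h1
      have h2 : δ' ≤ (R - (q i - 1 : ℝ) * δ') * mass ((lev ξ n (i + 1) x t).filter fun p =>
          ((q i - 1 : ℝ) * δ' ≤ RCLike.re (Φ i p.2))) := by
        have := hq1 i
        simp only [hg] at this
        linarith
      have h3 : (R - (q i - 1 : ℝ) * δ') ≤ M := by
        have h : (-N : ℝ) ≤ q i := by exact_mod_cast (hqN i).1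
        rw [hM]
        nlinarith [mul_le_mul_of_nonneg_right h hδ'0.le]
      have h4 : 0 ≤ mass ((lev ξ n (i + 1) x t).filter fun p =>
          ((q i - 1 : ℝ) * δ' ≤ RCLike.re (Φ i p.2))) := by
        refine List.sum_nonneg fun r hr => ?_
        obtain ⟨p, hp, rfl⟩ := List.mem_map.1 hr
        exact lev_fst_nonneg x t p (List.mem_of_mem_filter hp)
      rw [hμ, div_le_iff₀ (by positivity)]
      calc δ' ≤ _ := h2
        _ ≤ M * mass ((lev ξ n (i + 1) x t).filter fun p =>
          ((q i - 1 : ℝ) * δ' ≤ RCLike.re (Φ i p.2))) := by gcongr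
        _ ≤ M * (Fintype.card κ * _) := by gcongr
        _ = _ := by ring
    choose k hk using hmass
    refine ⟨(q, k), ⟨hqN, ?_⟩, y, hy, fun i => ?_⟩
    · calc ε' < _ := hnorm
        _ = ∑ i, g i := by
          rw [← hyt, map_sum, map_sum, map_sum]
          simp [g, Φ]
        _ ≤ _ := Finset.sum_le_sum fun i _ => (hq2 i).le
    · have := hk i
      rw [List.filter_filter] at this
      refine this.trans_eq ?_
      congr 2
      ext p
      simp only [P, hΦ, Bool.decide_and, Bool.and_comm])
  refine ⟨s.2, fun i => (s.1 i - 1 : ℝ) * δ', ?_, ?_⟩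
  · have h : ∑ i : Fin n, (s.1 i - 1 : ℝ) * δ' = ∑ i, (s.1 i + 1 : ℝ) * δ' - n * (2 * δ') := by
      have : ∀ i : Fin n, (s.1 i - 1 : ℝ) * δ' = (s.1 i + 1 : ℝ) * δ' - 2 * δ' := fun i => by ring
      simp_rw [this, Finset.sum_sub_distrib]
      simp
    have h2 : n * (2 * δ') = δ := by rw [hδ']; field_simp
    rw [h, h2]
    linarith [hsS.2]
  · have h1 := nil_mem_IterDer_of (derivesAt (D := D) (κ := Fin n) (weakZero 𝕜 X) ξ) hμ0 hn
      ((List.finRange n).map some) (by simp) _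
      (hereditary_stableSet A a (fun i => (s.1 i - 1 : ℝ) * δ') fun i v => G i v ∧ χ v = s.2 i) x
      (isWeaklyNull_iff.1 hx) ((isGrill_cofinal ξ hn).mono ?_ hs)
    · rwa [reduceOption_map_some] at h1
    · rintro t ⟨⟨ht, -⟩, y, hy, h⟩
      refine ⟨ht, HeavyLevels.mono (T := {m | ∀ q ∈ m, (G q.1 q.2 ∧ ‖q.2‖ ≤ 1) ∧ P s y q.1 q.2}) ?_
        (heavyLevels_of_forall₂ (P := fun i v => (G i v ∧ ‖v‖ ≤ 1) ∧ P s y i v) ?_)⟩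
      · intro m hm
        exact ⟨y, hy, fun q hq => ⟨⟨(hm q hq).1.1, (hm q hq).2.2⟩, (hm q hq).1.2, (hm q hq).2.1⟩⟩
      · rw [List.forall₂_iff_get]
        refine ⟨by simp [levs], fun i h1 h2 => ?_⟩
        have hin : i < n := by simpa using h1
        have := h ⟨i, hin⟩
        simp only [levs, List.get_eq_getElem, List.getElem_map, List.getElem_range,
          List.getElem_finRange]
        refine this.trans_eq ?_
        congr 1
        refine List.filter_congr fun p hp => ?_
        obtain ⟨r, -, hr, h3⟩ := mem_lev hp
        have h4 : G ⟨i, hin⟩ p.2 := h3 ▸ hG ⟨i, hin⟩ r hr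
        have h5 : ‖p.2‖ ≤ 1 := h3 ▸ hb r (Lambda_lt hr)
        simp [h4, h5]

end SzTree

end

noncomputable section

namespace SzTree

variable {𝕜 : Type v} [RCLike 𝕜] {X : Type u} [NormedAddCommGroup X] [NormedSpace 𝕜 X]
  {Y : Type*} [NormedAddCommGroup Y] [NormedSpace 𝕜 Y]

/-! ### The quantities of an operator -/

theorem rK_dualBall (A : X →L[𝕜] Y) (x : X) : rK (dualBall A) x = ‖A x‖ := by
  obtain ⟨y, hy, hyx⟩ := exists_re_eq_norm (𝕜 := 𝕜) (A x)
  have h : IsGreatest ((fun f : StrongDual 𝕜 X => RCLike.re (f x)) '' dualBall A) ‖A x‖ := by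
    refine ⟨⟨y.comp A, ⟨y, hy, rfl⟩, hyx⟩, ?_⟩
    rintro _ ⟨_, ⟨g, hg, rfl⟩, rfl⟩
    exact re_le_of_norm_le_one hg _
  exact h.csSup_eq

theorem iInf_le_of_theta_le {A : X →L[𝕜] Y} {ζ : Ordinal.{w}} {m : ℕ} {ε : ℝ}
    (h : theta ζ m (dualBall A) ≤ ENNReal.ofReal ε) (hε : 0 ≤ ε) {η : ℝ} (hη : 0 < η)
    {D : Type u} [Preorder D] [IsDirectedOrder D] [Nonempty D] {x : List (Ordinal.{w} × D) → X}
    (hx : IsWeaklyNull 𝕜 ζ m x) (hb : InUnitBall ζ m x) :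
    (⨅ t : maxDot D ζ m, ‖A (∑ i : Fin m, (m : 𝕜)⁻¹ • zvec 𝕜 ζ m (i + 1) x t)‖) ≤ ε + η := by
  have hlt : theta ζ m (dualBall A) < ENNReal.ofReal (ε + η) :=
    h.trans_lt ((ENNReal.ofReal_lt_ofReal_iff (by linarith)).2 (by linarith))
  obtain ⟨c, ⟨θ, hθ, rfl, h'⟩, hc⟩ := sInf_lt_iff.1 hlt
  rw [ENNReal.ofReal_lt_ofReal_iff (by linarith)] at hc
  have := h' D x hx hb
  simp only [rK_dualBall] at this
  exact this.trans hc.le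

theorem iInf_le_of_alphaN_le {A : X →L[𝕜] Y} {ξ : Ordinal.{w}} {γ : ℝ≥0∞} {n : ℕ} {α : ℝ}
    (h : alphaN ξ γ n (dualBall A) ≤ ENNReal.ofReal α) (hα : 0 ≤ α) {η : ℝ} (hη : 0 < η)
    {D : Type u} [Preorder D] [IsDirectedOrder D] [Nonempty D] (a : Fin n → 𝕜)
    {x : List (Ordinal.{w} × D) → X} (hx : IsWeaklyNull 𝕜 ξ n x) (hb : InUnitBall ξ n x)
    (h0 : 0 ≤ ‖(WithLp.toLp γ a : PiLp γ fun _ : Fin n => 𝕜)‖) :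
    (⨅ t : maxDot D ξ n, ‖A (∑ i : Fin n, a i • zvec 𝕜 ξ n (i + 1) x t)‖) ≤
      (α + η) * ‖(WithLp.toLp γ a : PiLp γ fun _ : Fin n => 𝕜)‖ := by
  have hlt : alphaN ξ γ n (dualBall A) < ENNReal.ofReal (α + η) :=
    h.trans_lt ((ENNReal.ofReal_lt_ofReal_iff (by linarith)).2 (by linarith))
  obtain ⟨c, ⟨θ, hθ, rfl, h'⟩, hc⟩ := sInf_lt_iff.1 hlt
  rw [ENNReal.ofReal_lt_ofReal_iff (by linarith)] at hc
  have := h' D a x hx hb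
  simp only [rK_dualBall] at this
  exact this.trans (mul_le_mul_of_nonneg_right hc.le h0)

/-- `N` is an upper bound for the norms of the images of the combinations `∑ a_i z_i^t` of weakly
null trees in the unit ball, in the sense that for `ε' > N` the set of the `t` such that the norm is
greater than `ε'` is not cofinal. -/
def EventualBound (A : X →L[𝕜] Y) (ξ : Ordinal.{w}) {n : ℕ} (a : Fin n → 𝕜) (N : ℝ) : Prop :=
  ∀ (D : Type u) [Preorder D] [IsDirectedOrder D] [Nonempty D] (x : List (Ordinal.{w} × D) → X),
    IsWeaklyNull 𝕜 ξ n x → InUnitBall ξ n x → ∀ ε', N < ε' →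
      ¬ cofinalOf ξ (cofinal1 D ξ) n {t | t ∈ maxDot D ξ n ∧
        ε' < ‖A (∑ i : Fin n, a i • zvec 𝕜 ξ n (i + 1) x t)‖}

theorem norm_zvec_le {D : Type u} [Nonempty D] {ξ : Ordinal.{w}} {n i : ℕ} (hi : i < n)
    {x : List (Ordinal.{w} × D) → X} (hb : InUnitBall ξ n x)
    {t : List (Ordinal.{w} × D)} (ht : t ∈ maxDot D ξ n) : ‖zvec 𝕜 ξ n (i + 1) x t‖ ≤ 1 := by
  obtain ⟨y, hy, h⟩ := exists_re_eq_norm (𝕜 := 𝕜) (zvec 𝕜 ξ n (i + 1) x t)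
  have := le_re_apply_zvec (y := -y) (c := -1) hi ht fun s _ hs => by
    have := (re_le_of_norm_le_one hy (x s)).trans (hb s (Lambda_lt hs))
    simpa using this
  rw [← h]
  simpa using this

/-- After division by b_i > 0 the functional of a branch is at least ε + η on each average, hence on
their mean, against θ ≤ ε. -/
theorem false_of_theta_le {A : X →L[𝕜] Y} {κ : Type*} {b c : κ → ℝ} {G : κ → X → Prop}
    {ξ : Ordinal.{w}} {L : List κ} (hL : L ≠ [])
    (h : [] ∈ IterDer (weakZero 𝕜 X) ξ L (StableSet A (fun i => (b i : 𝕜)) c G)) {ε η : ℝ}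
    (hε : 0 ≤ ε) (hη : 0 < η) (hθ : theta ξ L.length (dualBall A) ≤ ENNReal.ofReal ε)
    (hb : ∀ i ∈ L, 0 < b i ∧ (ε + η) * b i ≤ c i) : False := by
  obtain ⟨D, _, _, _, x, hx, hball, -, ht⟩ := exists_tree_of_mem_stableSet hL h
  have hlen : 1 ≤ L.length := List.length_pos_iff.2 hL
  have hlen0 : (0 : ℝ) < L.length := by exact_mod_cast hlen
  have h1 := iInf_le_of_theta_le hθ hε (half_pos hη) hx hball
  have := (maxDot_nonempty (D := D) ξ hlen).to_subtype
  have h2 : ε + η ≤ ⨅ t : maxDot D ξ L.length,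
      ‖A (∑ i : Fin L.length, (L.length : 𝕜)⁻¹ • zvec 𝕜 ξ L.length (i + 1) x t)‖ := by
    refine le_ciInf fun t => ?_
    obtain ⟨y, hy, hyt⟩ := ht t t.2
    refine le_trans ?_ (re_le_of_norm_le_one hy _)
    have h3 : ∀ i : Fin L.length, ε + η ≤ RCLike.re (y (A (zvec 𝕜 ξ L.length (i + 1) x t))) := by
      intro i
      obtain ⟨hb0, hbc⟩ := hb L[i] (List.getElem_mem i.2)
      have h4 := hbc.trans (hyt i i.2)
      rw [map_smul, map_smul, smul_eq_mul, RCLike.re_ofReal_mul, mul_comm] at h4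
      exact le_of_mul_le_mul_left h4 hb0
    have h5 : RCLike.re (y (A (∑ i : Fin L.length, (L.length : 𝕜)⁻¹ •
        zvec 𝕜 ξ L.length (i + 1) x t))) =
        ∑ i : Fin L.length, (L.length : ℝ)⁻¹ *
          RCLike.re (y (A (zvec 𝕜 ξ L.length (i + 1) x t))) := by
      simp only [map_sum, map_smul, smul_eq_mul]
      refine Finset.sum_congr rfl fun i _ => ?_
      rw [← RCLike.re_ofReal_mul]
      simp
    rw [h5, ← Finset.mul_sum]
    have h6 := Finset.card_nsmul_le_sum Finset.univ _ _ fun i _ => h3 i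
    rw [Finset.card_univ, Fintype.card_fin, nsmul_eq_mul] at h6
    rw [le_inv_mul_iff₀ hlen0]
    exact h6
  linarith

/-- The `ℓ_p` norm of a finite family of numbers. -/
def pnorm {ι : Type*} [Fintype ι] (p : ℝ≥0∞) (f : ι → ℝ) : ℝ :=
  ‖(WithLp.toLp p f : PiLp p fun _ : ι => ℝ)‖

/-! ### Finite ℓ_p norms -/

section pnorm

variable {ι : Type*} [Fintype ι]

theorem pnorm_top (f : ι → ℝ) : pnorm ∞ f = ⨆ i, |f i| := by
  simp [pnorm, PiLp.norm_eq_ciSup]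

theorem pnorm_eq {p : ℝ≥0∞} (h0 : p ≠ 0) (hp : p ≠ ∞) (f : ι → ℝ) :
    pnorm p f = (∑ i, |f i| ^ p.toReal) ^ (1 / p.toReal) := by
  simp [pnorm, PiLp.norm_eq_sum (ENNReal.toReal_pos h0 hp)]

theorem pnorm_norm {E : ι → Type*} [∀ i, NormedAddCommGroup (E i)] {p : ℝ≥0∞} (h1 : 1 ≤ p)
    (f : ∀ i, E i) : ‖(WithLp.toLp p f : PiLp p E)‖ = pnorm p fun i => ‖f i‖ := by
  rcases eq_or_ne p ∞ with rfl | hp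
  · simp [pnorm_top, PiLp.norm_eq_ciSup]
  · have h0 : p ≠ 0 := (zero_lt_one.trans_le h1).ne'
    rw [pnorm_eq h0 hp, PiLp.norm_eq_sum (ENNReal.toReal_pos h0 hp)]
    simp

theorem pnorm_nonneg {p : ℝ≥0∞} (h1 : 1 ≤ p) (f : ι → ℝ) : 0 ≤ pnorm p f := by
  have := Fact.mk h1
  exact norm_nonneg _

theorem abs_le_pnorm {p : ℝ≥0∞} (h1 : 1 ≤ p) (f : ι → ℝ) (i : ι) : |f i| ≤ pnorm p f := by
  have := Fact.mk h1
  exact PiLp.norm_apply_le (WithLp.toLp p f : PiLp p fun _ : ι => ℝ) i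

theorem pnorm_mono {p : ℝ≥0∞} (h1 : 1 ≤ p) {f g : ι → ℝ} (h : ∀ i, |f i| ≤ |g i|) :
    pnorm p f ≤ pnorm p g := by
  rcases eq_or_ne p ∞ with rfl | hp
  · rw [pnorm_top, pnorm_top]
    exact ciSup_mono (Set.finite_range _).bddAbove h
  · have h0 : p ≠ 0 := (zero_lt_one.trans_le h1).ne'
    rw [pnorm_eq h0 hp, pnorm_eq h0 hp]
    exact Real.rpow_le_rpow (Finset.sum_nonneg fun i _ => by positivity)
      (Finset.sum_le_sum fun i _ => Real.rpow_le_rpow (abs_nonneg _) (h i) ENNReal.toReal_nonneg)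
      (by positivity)

/-- Hölder's inequality on I. For finite r it follows from the power mean inequality. -/
theorem sum_le_card_rpow_mul_pnorm {r s : ℝ≥0∞} (hr : 1 ≤ r) (hrs : r⁻¹ + s⁻¹ = 1) {b : ι → ℝ}
    (hb : ∀ i, 0 ≤ b i) (I : Finset ι) {m : ℕ} (hm : I.card ≤ m) :
    ∑ i ∈ I, b i ≤ (m : ℝ) ^ (s⁻¹).toReal * pnorm r b := by
  have hr0 : r ≠ 0 := (zero_lt_one.trans_le hr).ne'
  refine le_trans ?_ (mul_le_mul_of_nonneg_right (Real.rpow_le_rpow (Nat.cast_nonneg _)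
    (Nat.cast_le.2 hm) ENNReal.toReal_nonneg) (pnorm_nonneg hr b))
  rcases eq_or_ne r ∞ with rfl | hr'
  · have : s⁻¹ = 1 := by simpa using hrs
    rw [this, ENNReal.toReal_one, Real.rpow_one]
    refine (Finset.sum_le_card_nsmul _ _ (pnorm ∞ b) fun i _ => ?_).trans_eq (nsmul_eq_mul _ _)
    exact (le_abs_self _).trans (abs_le_pnorm hr b i)
  · set ρ := r.toReal with hρ
    have hρ1 : 1 ≤ ρ := by
      rw [hρ, ← ENNReal.toReal_one]; exact ENNReal.toReal_mono hr' hr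
    have hρ0 : 0 < ρ := by linarith
    have hs : (s⁻¹).toReal = 1 - ρ⁻¹ := by
      have h2 : s⁻¹ ≠ ∞ := fun h => by simp [h] at hrs
      have h3 := congrArg ENNReal.toReal hrs
      rw [ENNReal.toReal_add (ENNReal.inv_ne_top.2 hr0) h2, ENNReal.toReal_inv,
        ENNReal.toReal_one] at h3
      linarith
    have hJ := Real.rpow_sum_le_const_mul_sum_rpow_of_nonneg I hρ1 (f := b) fun i _ => hb i
    rw [hs, pnorm_eq hr0 hr', ← hρ, one_div]
    have h1 : ∑ i ∈ I, b i = ((∑ i ∈ I, b i) ^ ρ) ^ ρ⁻¹ := by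
      rw [← Real.rpow_mul (Finset.sum_nonneg fun i _ => hb i), mul_inv_cancel₀ hρ0.ne',
        Real.rpow_one]
    have h2 : ((I.card : ℝ) ^ (ρ - 1)) ^ ρ⁻¹ = (I.card : ℝ) ^ (1 - ρ⁻¹) := by
      rw [← Real.rpow_mul (Nat.cast_nonneg _), sub_mul, mul_inv_cancel₀ hρ0.ne', one_mul]
    rw [h1, ← h2, ← Real.mul_rpow (Real.rpow_nonneg (Nat.cast_nonneg _) _)
      (Finset.sum_nonneg fun i _ => Real.rpow_nonneg (abs_nonneg (b i)) _)]
    refine Real.rpow_le_rpow (Real.rpow_nonneg (Finset.sum_nonneg fun i _ => hb i) _)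
      (hJ.trans ?_) (inv_nonneg.2 hρ0.le)
    refine mul_le_mul_of_nonneg_left ?_ (Real.rpow_nonneg (Nat.cast_nonneg _) _)
    refine (Finset.sum_le_sum_of_subset_of_nonneg (Finset.subset_univ I)
      fun i _ _ => Real.rpow_nonneg (hb i) _).trans_eq ?_
    simp [abs_of_nonneg (hb _)]

end pnorm

/-- After stabilisation, more than m levels with c_i > ε b_i would give a tree on m of them that
contradicts the bound on θ. On the exceptional levels c_i ≤ R b_i, and Hölder's inequality bounds
their sum. -/
theorem eventualBound_of_theta_le {A : X →L[𝕜] Y} {R : ℝ} (hA : ‖A‖ ≤ R) {r s : ℝ≥0∞} (hr : 1 ≤ r)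
    (hrs : r⁻¹ + s⁻¹ = 1) {ζ : Ordinal.{w}} {m : ℕ} {ε : ℝ} (hm : 1 ≤ m) (hε : 0 ≤ ε)
    (hθ : theta ζ m (dualBall A) ≤ ENNReal.ofReal ε) {n : ℕ} (hn : 1 ≤ n) {b : Fin n → ℝ}
    (hb : ∀ i, 0 ≤ b i) : EventualBound A ζ (fun i => (b i : 𝕜))
      (ε * ∑ i, b i + R * (m : ℝ) ^ (s⁻¹).toReal * pnorm r b) := by
  intro D _ _ _ x hx hball ε' hε' hcof
  set N := ε * ∑ i, b i + R * (m : ℝ) ^ (s⁻¹).toReal * pnorm r b with hN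
  have hR : 0 ≤ R := (norm_nonneg _).trans hA
  obtain ⟨k, c, hc, hstab⟩ := exists_stable hn (fun i => (b i : 𝕜)) hx hball
    (G := fun _ _ => True) (fun _ _ _ => trivial) (fun _ => ()) hcof (sub_pos.2 hε')
  -- The extracted tree has a maximal branch, and on it c_i is at most the norm of the image of b_i
  -- times an average.
  have hcR : ∀ i, c i ≤ R * b i := by
    obtain ⟨D', _, _, _, x', hx', hball', -, ht⟩ := exists_tree_of_mem_stableSet
      (by rw [ne_eq, ← List.length_eq_zero_iff, List.length_finRange]; omega) hstab
    obtain ⟨t, htm⟩ := maxDot_nonempty (D := D') ζ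
      (show 1 ≤ (List.finRange n).length by simpa using hn)
    obtain ⟨y, hy, h⟩ := ht t htm
    intro i
    have h1 := h i (by simp)
    simp only [List.getElem_finRange, Fin.eta, Fin.cast_mk] at h1
    refine h1.trans ((re_le_of_norm_le_one hy _).trans ((A.le_opNorm _).trans ?_))
    rw [norm_smul, RCLike.norm_ofReal, abs_of_nonneg (hb i)]
    have := norm_zvec_le (𝕜 := 𝕜) (i := i) (by simp) hball' htm
    calc ‖A‖ * (b i * _) ≤ R * (b i * 1) := by
          gcongr
          · exact mul_nonneg (hb i) (norm_nonneg _)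
          · exact hb i
      _ = R * b i := by ring
  set I : Finset (Fin n) := Finset.univ.filter fun i => ε * b i < c i with hI
  have hIpos : ∀ i ∈ I, 0 < b i := by
    intro i hi
    rcases (hb i).lt_or_eq with h | h
    · exact h
    · have h1 := (Finset.mem_filter.1 hi).2
      have h2 := hcR i
      rw [← h] at h1 h2
      simp only [mul_zero] at h1 h2
      linarith
  have hcard : I.card ≤ m := by
    by_contra! hlt
    obtain ⟨J, hJI, hJ⟩ := Finset.exists_subset_card_eq hlt.le
    set L : List (Fin n) := (List.finRange n).filter (· ∈ J) with hL
    have hLJ : ∀ i, i ∈ L ↔ i ∈ J := by simp [hL]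
    have hlen : L.length = m := by
      rw [← hJ, ← List.toFinset_card_of_nodup ((List.nodup_finRange n).filter _)]
      congr 1
      ext i
      simp
    have hL0 : L ≠ [] := by
      rw [ne_eq, ← List.length_eq_zero_iff]
      omega
    -- The least relative excess over J is a gap common to all selected levels.
    obtain ⟨i₀, hi₀, hmin⟩ := Finset.exists_min_image J (fun i => c i / b i - ε)
      (Finset.card_pos.1 (by omega))
    have hη : 0 < c i₀ / b i₀ - ε := by
      rw [sub_pos, lt_div_iff₀ (hIpos _ (hJI hi₀))]
      exact (Finset.mem_filter.1 (hJI hi₀)).2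
    refine false_of_theta_le hL0 (IterDer_sublist List.filter_sublist hstab) hε hη
      (by rwa [hlen]) fun i hi => ⟨hIpos i (hJI ((hLJ i).1 hi)), ?_⟩
    rw [← le_div_iff₀ (hIpos i (hJI ((hLJ i).1 hi)))]
    have := hmin i ((hLJ i).1 hi)
    linarith
  have hsum : ∑ i, c i ≤ N := by
    calc ∑ i, c i ≤ ∑ i, (ε * b i + if i ∈ I then R * b i else 0) := by
          refine Finset.sum_le_sum fun i _ => ?_
          split_ifs with h
          · have := mul_nonneg hε (hb i)
            linarith [hcR i]
          · simpa [hI] using h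
      _ = ε * ∑ i, b i + R * ∑ i ∈ I, b i := by
          rw [Finset.sum_add_distrib, ← Finset.mul_sum, Finset.sum_ite_mem, Finset.univ_inter,
            ← Finset.mul_sum]
      _ ≤ N := by
          rw [hN, mul_assoc R]
          gcongr
          exact sum_le_card_rpow_mul_pnorm hr hrs hb I hcard
  linarith

/-- A cofinal failure stabilises to a tree, in general over another directed set, on which every
maximal branch fails. Since α is defined with all directed sets, its bound on infima applies to this
tree. -/
theorem eventualBound_of_alphaN_le {A : X →L[𝕜] Y} {γ : ℝ≥0∞} (hγ : 1 ≤ γ)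
    {ξ : Ordinal.{w}} {n : ℕ} (hn : 1 ≤ n) {α : ℝ} (hα : 0 ≤ α)
    (h : alphaN ξ γ n (dualBall A) ≤ ENNReal.ofReal α) (a : Fin n → 𝕜) :
    EventualBound A ξ a (α * pnorm γ fun i => ‖a i‖) := by
  intro D _ _ _ x hx hball ε' hε' hcof
  set N := α * pnorm γ fun i => ‖a i‖ with hN
  set δ := (ε' - N) / 2 with hδ
  have hδ0 : 0 < δ := by
    rw [hδ]
    linarith
  obtain ⟨k, c, hc, hstab⟩ := exists_stable hn a hx hball
    (G := fun _ _ => True) (fun _ _ _ => trivial) (fun _ => ()) hcof hδ0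
  obtain ⟨D', _, _, _, x', hx', hball', -, ht⟩ := exists_tree_of_mem_stableSet
    (by rw [ne_eq, ← List.length_eq_zero_iff, List.length_finRange]; omega) hstab
  have hlen : (List.finRange n).length = n := List.length_finRange
  rw [hlen] at hx' hball'
  have hP := pnorm_nonneg hγ fun i => ‖a i‖
  -- Chosen so that η times the norm of a is below δ; the summand 1 covers a = 0.
  have hη : 0 < δ / (pnorm γ (fun i => ‖a i‖) + 1) := by positivity
  have h1 := iInf_le_of_alphaN_le h hα hη a hx' hball' (by rw [pnorm_norm hγ]; exact hP)
  rw [pnorm_norm hγ] at h1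
  have := (maxDot_nonempty (D := D') ξ hn).to_subtype
  have h2 : ∑ i, c i ≤ ⨅ t : maxDot D' ξ n,
      ‖A (∑ i : Fin n, a i • zvec 𝕜 ξ n (i + 1) x' t)‖ := by
    refine le_ciInf fun t => ?_
    obtain ⟨y, hy, hyt⟩ := ht t (by rw [hlen]; exact t.2)
    refine le_trans ?_ (re_le_of_norm_le_one hy _)
    rw [map_sum, map_sum, map_sum]
    refine Finset.sum_le_sum fun i _ => ?_
    have := hyt i (by simp)
    simpa only [List.getElem_finRange, Fin.eta, Fin.cast_mk, hlen] using this
  have h3 : δ / (pnorm γ (fun i => ‖a i‖) + 1) * pnorm γ (fun i => ‖a i‖) < δ := by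
    rw [div_mul_eq_mul_div, div_lt_iff₀ (by positivity)]
    nlinarith
  rw [add_mul] at h1
  linarith

/-- Trees that are not in the unit ball, but bounded by `d_i` on the level `i`. -/
theorem EventualBound.rescale {Z : Type u} [NormedAddCommGroup Z] [NormedSpace 𝕜 Z] (Q : Z →L[𝕜] X)
    {A : X →L[𝕜] Y} {ξ : Ordinal.{w}} {n : ℕ} (hn : 1 ≤ n) {a : Fin n → 𝕜} {d : Fin n → ℝ}
    (hd : ∀ i, 0 < d i) {N : ℝ} (h : EventualBound A ξ (fun i => a i * (d i : 𝕜)) N)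
    {D : Type u} [Preorder D] [IsDirectedOrder D] [Nonempty D] {x : List (Ordinal.{w} × D) → Z}
    (hx : IsWeaklyNull 𝕜 ξ n x)
    (hxd : ∀ i : Fin n, ∀ t ∈ dot D (Lambda ξ n (i + 1)), ‖Q (x t)‖ ≤ d i) {ε' : ℝ} (hε' : N < ε') :
    ¬ cofinalOf ξ (cofinal1 D ξ) n {t | t ∈ maxDot D ξ n ∧
        ε' < ‖A (Q (∑ i : Fin n, a i • zvec 𝕜 ξ n (i + 1) x t))‖} := by
  -- The scaling factor is read off the last ordinal, so it is constant along each net of successors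
  -- and weak nullity is preserved.
  let x' : List (Ordinal.{w} × D) → X := fun s => match s.getLast? with
    | none => 0
    | some q => ((labelOf ξ (List.ofFn d) q.1 : ℝ) : 𝕜)⁻¹ • Q (x s)
  have hx' : ∀ i : Fin n, ∀ t ∈ dot D (Lambda ξ n (i + 1)), x' t = ((d i : ℝ) : 𝕜)⁻¹ • Q (x t) := by
    intro i t ht
    obtain ⟨r, q, rfl⟩ : ∃ r q, t = r ++ [q] := by
      rcases List.eq_nil_or_concat t with h | ⟨r, b, h⟩
      · subst h
        exact absurd rfl (Gamma_ne_nil (Lambda_lt ht))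
      · exact ⟨r, b, by simpa using h⟩
    rw [mem_dot, List.map_append] at ht
    obtain ⟨-, ρ, hρ, hq⟩ := Lambda_last ht
    have := labelOf_eq (L := List.ofFn d) (i := i) (by simp) hρ
    simp only [List.length_ofFn, List.getElem_ofFn, Fin.eta, ← hq] at this
    simp [x', this]
  have hz : ∀ (i : Fin n) t, zvec 𝕜 ξ n (i + 1) x' t =
      ((d i : ℝ) : 𝕜)⁻¹ • Q (zvec 𝕜 ξ n (i + 1) x t) := by
    intro i t
    rw [zvec, zvec, map_sum, Finset.smul_sum]
    refine Finset.sum_congr rfl fun k _ => ?_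
    split_ifs with hk
    · rw [hx' i _ hk, map_smul, smul_comm]
    · simp
  refine fun hcof => h D x' ?_ ?_ ε' hε' ((isGrill_cofinal ξ hn).mono ?_ hcof)
  · refine isWeaklyNull_iff.2 fun s ζ hs => ?_
    have h1 : (fun u : D => x' (s ++ [(ζ, u)])) =
        (((labelOf ξ (List.ofFn d) ζ : ℝ) : 𝕜)⁻¹ • Q) ∘ fun u => x (s ++ [(ζ, u)]) := by
      ext u
      simp [x']
    rw [h1]
    exact (tendsto_clm_weakZero _).comp (isWeaklyNull_iff.1 hx s ζ hs)
  · intro t ht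
    obtain ⟨i, h1, h2, hi⟩ := mem_Gamma_iff.1 ht
    obtain ⟨i, rfl⟩ : ∃ j, i = j + 1 := ⟨i - 1, by omega⟩
    rw [hx' ⟨i, by omega⟩ t hi, norm_smul, norm_inv, RCLike.norm_ofReal, abs_of_pos (hd _),
      inv_mul_le_iff₀ (hd _), mul_one]
    exact hxd ⟨i, by omega⟩ t hi
  · rintro t ⟨ht, h1⟩
    refine ⟨ht, h1.trans_eq ?_⟩
    rw [map_sum]
    congr 2
    refine Finset.sum_congr rfl fun i _ => ?_
    have : ((d i : ℝ) : 𝕜) ≠ 0 := by exact_mod_cast (hd i).ne'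
    rw [hz, map_smul, smul_smul, mul_assoc, mul_inv_cancel₀ this, mul_one]

end SzTree

end

noncomputable section

namespace SzTree

/-! ### Inequalities for finite `ℓ_p` norms -/

section pnorm

variable {ι κ : Type*} [Fintype ι] [Fintype κ]

theorem pnorm_add_le {p : ℝ≥0∞} (h1 : 1 ≤ p) (f g : ι → ℝ) :
    pnorm p (fun i => f i + g i) ≤ pnorm p f + pnorm p g := by
  have := Fact.mk h1
  exact norm_add_le (WithLp.toLp p f : PiLp p fun _ : ι => ℝ) (WithLp.toLp p g)

theorem pnorm_sum_le {p : ℝ≥0∞} (h1 : 1 ≤ p) (f : κ → ι → ℝ) :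
    pnorm p (fun i => ∑ k, f k i) ≤ ∑ k, pnorm p (f k) := by
  have := Fact.mk h1
  have h := norm_sum_le Finset.univ fun k => (WithLp.toLp p (f k) : PiLp p fun _ : ι => ℝ)
  refine le_trans (le_of_eq ?_) h
  rw [pnorm]
  congr 1
  ext i
  simp

theorem pnorm_smul {p : ℝ≥0∞} (h1 : 1 ≤ p) (c : ℝ) (f : ι → ℝ) :
    pnorm p (fun i => c * f i) = |c| * pnorm p f := by
  have := Fact.mk h1
  exact norm_smul c (WithLp.toLp p f : PiLp p fun _ : ι => ℝ)

theorem pnorm_anti {p r : ℝ≥0∞} (h1 : 1 ≤ p) (hpr : p ≤ r) (f : ι → ℝ) :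
    pnorm r f ≤ pnorm p f := by
  have hM := pnorm_nonneg h1 f
  rcases eq_or_ne r ∞ with rfl | hr
  · rw [pnorm_top]
    exact Real.iSup_le (abs_le_pnorm h1 f) hM
  · have hp : p ≠ ∞ := ne_top_of_le_ne_top hr hpr
    have hp0 : p ≠ 0 := (zero_lt_one.trans_le h1).ne'
    have hr0 : r ≠ 0 := (zero_lt_one.trans_le (h1.trans hpr)).ne'
    have hpp := ENNReal.toReal_pos hp0 hp
    have hrr := ENNReal.toReal_pos hr0 hr
    have hle : p.toReal ≤ r.toReal := ENNReal.toReal_mono hr hpr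
    have hMp : pnorm p f ^ p.toReal = ∑ i, |f i| ^ p.toReal := by
      rw [pnorm_eq hp0 hp, ← Real.rpow_mul (Finset.sum_nonneg fun i _ => by positivity),
        one_div, inv_mul_cancel₀ hpp.ne', Real.rpow_one]
    rcases hM.eq_or_lt with h0 | h0
    · have hf : ∀ i, |f i| = 0 := fun i =>
        le_antisymm ((abs_le_pnorm h1 f i).trans h0.ge) (abs_nonneg _)
      rw [← h0, pnorm_eq hr0 hr]
      simp [hf, hrr.ne']
    · rw [pnorm_eq hr0 hr, one_div, Real.rpow_inv_le_iff_of_pos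
        (Finset.sum_nonneg fun i _ => by positivity) hM hrr]
      calc ∑ i, |f i| ^ r.toReal
          ≤ ∑ i, |f i| ^ p.toReal * pnorm p f ^ (r.toReal - p.toReal) := by
            refine Finset.sum_le_sum fun i _ => ?_
            rcases (abs_nonneg (f i)).eq_or_lt with h | h
            · rw [← h, Real.zero_rpow hrr.ne', Real.zero_rpow hpp.ne', zero_mul]
            · calc |f i| ^ r.toReal = |f i| ^ p.toReal * |f i| ^ (r.toReal - p.toReal) := by
                    rw [← Real.rpow_add h, add_sub_cancel]
                _ ≤ _ := by
                    gcongr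
                    exact abs_le_pnorm h1 f i
        _ = pnorm p f ^ r.toReal := by
            rw [← Finset.sum_mul, ← hMp, ← Real.rpow_add h0, add_sub_cancel]

theorem pnorm_const_le {p : ℝ≥0∞} (h1 : 1 ≤ p) {c : ℝ} (hc : 0 ≤ c) :
    pnorm p (fun _ : ι => c) ≤ Fintype.card ι * c := by
  refine (pnorm_anti le_rfl h1 _).trans (le_of_eq ?_)
  rw [pnorm_eq one_ne_zero ENNReal.one_ne_top]
  simp [abs_of_nonneg hc]

/-- Passing to γ-th powers turns the ℓ_r norm into an ℓ_{r/γ} norm, in which the mixed Minkowski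
inequality is a triangle inequality. -/
theorem pnorm_rpow {γ r : ℝ≥0∞} (hγ : 1 ≤ γ) (hγr : γ ≤ r) (hγ' : γ ≠ ∞) {g : ι → ℝ}
    (hg : ∀ i, 0 ≤ g i) :
    pnorm (r / γ) (fun i => g i ^ γ.toReal) = pnorm r g ^ γ.toReal := by
  have hγ0 : γ ≠ 0 := (zero_lt_one.trans_le hγ).ne'
  have hγγ := ENNReal.toReal_pos hγ0 hγ'
  rcases eq_or_ne r ∞ with rfl | hr
  · rw [ENNReal.top_div_of_ne_top hγ', pnorm_top, pnorm_top]
    rcases isEmpty_or_nonempty ι with h | h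
    · simp [hγγ.ne']
    · simp only [abs_of_nonneg (hg _), abs_of_nonneg (Real.rpow_nonneg (hg _) _)]
      obtain ⟨i, hi⟩ := Finite.exists_max g
      have h1 : ⨆ i, g i = g i := le_antisymm (ciSup_le hi)
        (le_ciSup (Set.finite_range g).bddAbove i)
      rw [h1]
      refine le_antisymm (ciSup_le fun j => Real.rpow_le_rpow (hg j) (hi j) hγγ.le) ?_
      exact le_ciSup (Set.finite_range fun j => g j ^ γ.toReal).bddAbove i
  · have hr0 : r ≠ 0 := (zero_lt_one.trans_le (hγ.trans hγr)).ne'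
    have hrr := ENNReal.toReal_pos hr0 hr
    have h0 : r / γ ≠ 0 := by simp [hr0, hγ']
    have h1 : r / γ ≠ ∞ := ENNReal.div_ne_top hr hγ0
    rw [pnorm_eq h0 h1, pnorm_eq hr0 hr, ENNReal.toReal_div,
      ← Real.rpow_mul (Finset.sum_nonneg fun i _ => by positivity)]
    congr 1
    · refine Finset.sum_congr rfl fun i _ => ?_
      rw [abs_of_nonneg (hg i), abs_of_nonneg (Real.rpow_nonneg (hg i) _),
        ← Real.rpow_mul (hg i), mul_div_cancel₀ _ hγγ.ne']
    · field_simp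

theorem pnorm_pow_eq {γ : ℝ≥0∞} (hγ : 1 ≤ γ) (hγ' : γ ≠ ∞) {g : ι → ℝ} (hg : ∀ i, 0 ≤ g i) :
    pnorm γ g ^ γ.toReal = ∑ i, g i ^ γ.toReal := by
  have hγ0 : γ ≠ 0 := (zero_lt_one.trans_le hγ).ne'
  have hγγ := ENNReal.toReal_pos hγ0 hγ'
  rw [pnorm_eq hγ0 hγ', ← Real.rpow_mul (Finset.sum_nonneg fun i _ => by positivity), one_div,
    inv_mul_cancel₀ hγγ.ne', Real.rpow_one]
  simp [abs_of_nonneg (hg _)]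

/-- Minkowski's inequality for mixed norms. -/
theorem pnorm_pnorm_le {γ r : ℝ≥0∞} (hγ : 1 ≤ γ) (hγr : γ ≤ r) {e : ι → κ → ℝ}
    (he : ∀ l i, 0 ≤ e l i) :
    pnorm r (fun l => pnorm γ (e l)) ≤ pnorm γ fun i => pnorm r fun l => e l i := by
  have hr : 1 ≤ r := hγ.trans hγr
  rcases eq_or_ne γ ∞ with rfl | hγ'
  · obtain rfl := top_le_iff.1 hγr
    rw [pnorm_top]
    refine Real.iSup_le (fun l => ?_) (pnorm_nonneg le_top _)
    rw [abs_of_nonneg (pnorm_nonneg le_top _), pnorm_top]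
    refine Real.iSup_le (fun i => ?_) (pnorm_nonneg le_top _)
    exact (abs_le_pnorm le_top (fun l => e l i) l).trans
      ((le_abs_self _).trans (abs_le_pnorm le_top (fun i => pnorm ∞ fun l => e l i) i))
  · have hγ0 : γ ≠ 0 := (zero_lt_one.trans_le hγ).ne'
    have hγγ := ENNReal.toReal_pos hγ0 hγ'
    refine (Real.rpow_le_rpow_iff (pnorm_nonneg hr _) (pnorm_nonneg hγ _) hγγ).1 ?_
    have h1 : 1 ≤ r / γ := by
      rw [ENNReal.le_div_iff_mul_le (Or.inl hγ0) (Or.inl hγ'), one_mul]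
      exact hγr
    rw [← pnorm_rpow hγ hγr hγ' fun l => pnorm_nonneg hγ _,
      pnorm_pow_eq hγ hγ' fun i => pnorm_nonneg hr _]
    simp_rw [pnorm_pow_eq hγ hγ' (he _), ← pnorm_rpow hγ hγr hγ' fun l => he l _]
    exact pnorm_sum_le h1 fun i l => e l i ^ γ.toReal

/-- The case γ = ∞ is excluded because its real value is 0; there s = r, and it is treated
separately. -/
theorem holderTriple_toReal {r γ s : ℝ≥0∞} (hr : 1 ≤ r) (hγ : r < γ) (hγ' : γ ≠ ∞)
    (hs : γ⁻¹ + s⁻¹ = r⁻¹) : Real.HolderTriple s.toReal γ.toReal r.toReal := by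
  have hr0 : r ≠ 0 := (zero_lt_one.trans_le hr).ne'
  have hγ0 : γ ≠ 0 := (zero_lt_one.trans_le (hr.trans hγ.le)).ne'
  have hs0 : s ≠ 0 := by
    rintro rfl
    simp [eq_comm, hr0] at hs
  have hs' : s ≠ ∞ := by
    rintro rfl
    simp only [ENNReal.inv_top, add_zero, inv_inj] at hs
    exact hγ.ne' hs
  refine ⟨?_, ENNReal.toReal_pos hs0 hs', ENNReal.toReal_pos hγ0 hγ'⟩
  have := congrArg ENNReal.toReal hs
  rw [ENNReal.toReal_add (ENNReal.inv_ne_top.2 hγ0) (ENNReal.inv_ne_top.2 hs0),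
    ENNReal.toReal_inv, ENNReal.toReal_inv, ENNReal.toReal_inv] at this
  linarith

theorem pnorm_mul_le {r γ s : ℝ≥0∞} (hr : 1 ≤ r) (hγ : r < γ) (hs : γ⁻¹ + s⁻¹ = r⁻¹)
    {f g : ι → ℝ} (hf : ∀ i, 0 ≤ f i) (hg : ∀ i, 0 ≤ g i) :
    pnorm r (fun i => f i * g i) ≤ (∑ i, f i ^ s.toReal) ^ s.toReal⁻¹ * pnorm γ g := by
  have hr' : r ≠ ∞ := hγ.ne_top
  have hr0 : r ≠ 0 := (zero_lt_one.trans_le hr).ne'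
  have hrr := ENNReal.toReal_pos hr0 hr'
  rcases eq_or_ne γ ∞ with rfl | hγ'
  · obtain rfl : s = r := by simpa using hs
    have h1 : ∀ i, |f i * g i| ≤ |pnorm ∞ g * f i| := by
      intro i
      rw [abs_mul, abs_mul, mul_comm, abs_of_nonneg (pnorm_nonneg le_top g)]
      exact mul_le_mul_of_nonneg_right (abs_le_pnorm le_top g i) (abs_nonneg _)
    refine (pnorm_mono hr h1).trans_eq ?_
    rw [pnorm_smul hr, abs_of_nonneg (pnorm_nonneg le_top g), mul_comm, pnorm_eq hr0 hr']
    simp [abs_of_nonneg (hf _)]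
  · have hγ0 : γ ≠ 0 := (zero_lt_one.trans_le (hr.trans hγ.le)).ne'
    have ht := holderTriple_toReal hr hγ hγ' hs
    have hH := Real.Lr_rpow_le_Lp_mul_Lq_of_nonneg Finset.univ ht (f := f) (g := g)
      (fun i _ => hf i) fun i _ => hg i
    have hfs : 0 ≤ ∑ i, f i ^ s.toReal := Finset.sum_nonneg fun i _ => Real.rpow_nonneg (hf i) _
    have hgs : 0 ≤ ∑ i, g i ^ γ.toReal := Finset.sum_nonneg fun i _ => Real.rpow_nonneg (hg i) _
    rw [pnorm_eq hr0 hr', one_div, Real.rpow_inv_le_iff_of_pos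
      (Finset.sum_nonneg fun i _ => by positivity)
      (mul_nonneg (Real.rpow_nonneg hfs _) (pnorm_nonneg (hr.trans hγ.le) _)) hrr,
      Real.mul_rpow (Real.rpow_nonneg hfs _) (pnorm_nonneg (hr.trans hγ.le) _),
      pnorm_eq hγ0 hγ', ← Real.rpow_mul hfs, ← Real.rpow_mul (Finset.sum_nonneg fun i _ => by positivity)]
    simp only [abs_mul, abs_of_nonneg (hf _), abs_of_nonneg (hg _)]
    refine hH.trans_eq ?_
    congr 2
    · field_simp
    · field_simp

end pnorm

/-! ### Norms in infinite direct sums -/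

section Diagonal

theorem pnorm_le_norm {ι : Type*} {X : ι → Type*} [∀ l, NormedAddCommGroup (X l)]
    {p : ℝ≥0∞} [hp : Fact (1 ≤ p)] (Υ : Finset ι) (x : lp X p) :
    pnorm p (fun l : Υ => ‖x l‖) ≤ ‖x‖ := by
  rcases eq_or_ne p ∞ with rfl | hp'
  · rw [pnorm_top]
    refine Real.iSup_le (fun l => ?_) (norm_nonneg _)
    rw [abs_norm]
    exact lp.norm_apply_le_norm (by simp) x l
  · have hp0 : p ≠ 0 := (zero_lt_one.trans_le hp.out).ne'
    have hpp := ENNReal.toReal_pos hp0 hp'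
    rw [pnorm_eq hp0 hp', one_div, Real.rpow_inv_le_iff_of_pos
      (Finset.sum_nonneg fun i _ => by positivity) (norm_nonneg _) hpp]
    simp only [abs_norm]
    rw [Finset.sum_coe_sort Υ fun l => ‖x l‖ ^ p.toReal]
    exact lp.sum_rpow_le_norm_rpow hpp x Υ

variable {𝕜 : Type v} [RCLike 𝕜] {ι : Type u} {X Y : ι → Type u}
  [∀ l, NormedAddCommGroup (X l)] [∀ l, NormedSpace 𝕜 (X l)]
  [∀ l, NormedAddCommGroup (Y l)] [∀ l, NormedSpace 𝕜 (Y l)]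

theorem norm_diagOp {p r : ℝ≥0∞} [Fact (1 ≤ p)] [hr : Fact (1 ≤ r)] (A : ∀ l, X l →L[𝕜] Y l)
    (Υ : Finset ι) (x : lp X p) :
    ‖diagOp p r A Υ x‖ = pnorm r fun l : Υ => ‖A l (x l)‖ := by
  classical
  refine le_antisymm ?_ ?_
  · rcases eq_or_ne r ∞ with rfl | hr'
    · refine lp.norm_le_of_forall_le (pnorm_nonneg le_top _) fun l => ?_
      rw [diagOp_apply]
      split_ifs with h
      · exact (le_abs_self _).trans (abs_le_pnorm le_top (fun l : Υ => ‖A l (x l)‖) ⟨l, h⟩)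
      · simpa using pnorm_nonneg le_top _
    · have hr0 : r ≠ 0 := (zero_lt_one.trans_le hr.out).ne'
      have hrr := ENNReal.toReal_pos hr0 hr'
      refine le_of_eq ?_
      rw [pnorm_eq hr0 hr', lp.norm_eq_tsum_rpow hrr, tsum_eq_sum (s := Υ)]
      · simp only [abs_norm]
        rw [Finset.sum_coe_sort Υ fun l => ‖A l (x l)‖ ^ r.toReal]
        congr 1
        refine Finset.sum_congr rfl fun l hl => ?_
        rw [diagOp_apply, if_pos hl]
      · intro l hl
        rw [diagOp_apply, if_neg hl, norm_zero, Real.zero_rpow hrr.ne']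
  · refine le_trans (le_of_eq ?_) (pnorm_le_norm Υ (diagOp p r A Υ x))
    congr 1
    ext l
    rw [diagOp_apply, if_pos l.2]

end Diagonal

end SzTree

end

/-! ### Eventual bounds and upper estimates for diagonal operators -/

noncomputable section

namespace SzTree

section Operator

variable {𝕜 : Type v} [RCLike 𝕜] {X : Type u} [NormedAddCommGroup X] [NormedSpace 𝕜 X]
  {Y : Type*} [NormedAddCommGroup Y] [NormedSpace 𝕜 Y]

theorem exists_tree_of_mem_stableSet_finRange {A : X →L[𝕜] Y} {n : ℕ} (hn : 1 ≤ n)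
    {a : Fin n → 𝕜} {c : Fin n → ℝ} {G : Fin n → X → Prop} {ξ : Ordinal.{w}}
    (h : [] ∈ IterDer (weakZero 𝕜 X) ξ (List.finRange n) (StableSet A a c G)) :
    ∃ (D : Type u) (_ : Preorder D) (_ : IsDirectedOrder D) (_ : Nonempty D)
      (x : List (Ordinal.{w} × D) → X), IsWeaklyNull 𝕜 ξ n x ∧ InUnitBall ξ n x ∧
      (∀ i : Fin n, ∀ s ∈ dot D (Lambda ξ n (i + 1)), G i (x s)) ∧
      ∀ t ∈ maxDot D ξ n, ∑ i, c i ≤ ‖A (∑ i : Fin n, a i • zvec 𝕜 ξ n (i + 1) x t)‖ := by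
  obtain ⟨D, i1, i2, i3, x, hx, hb, hG, ht⟩ := exists_tree_of_mem_stableSet
    (by rw [ne_eq, ← List.length_eq_zero_iff, List.length_finRange]; omega) h
  have hlen : (List.finRange n).length = n := List.length_finRange
  rw [hlen] at hx hb
  refine ⟨D, i1, i2, i3, x, hx, hb, fun i s hs => ?_, fun t htm => ?_⟩
  · have := hG i (by simp) s (by rwa [hlen])
    simpa only [List.getElem_finRange, Fin.eta, Fin.cast_mk] using this
  · obtain ⟨y, hy, hyt⟩ := ht t (by rwa [hlen])
    refine le_trans ?_ (re_le_of_norm_le_one hy _)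
    rw [map_sum, map_sum, map_sum]
    refine Finset.sum_le_sum fun i _ => ?_
    have := hyt i (by simp)
    simpa only [List.getElem_finRange, Fin.eta, Fin.cast_mk, hlen] using this

theorem EventualBound.isEventualIn {A : X →L[𝕜] Y} {ξ : Ordinal.{w}} {n : ℕ} {a : Fin n → 𝕜}
    {N : ℝ} (h : EventualBound A ξ a N) {D : Type u} [Preorder D] [IsDirectedOrder D] [Nonempty D]
    {x : List (Ordinal.{w} × D) → X} (hx : IsWeaklyNull 𝕜 ξ n x) (hb : InUnitBall ξ n x) {ε' : ℝ}
    (hε' : N < ε') : IsEventualIn D ξ n {t | t ∈ maxDot D ξ n ∧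
      ‖A (∑ i : Fin n, a i • zvec 𝕜 ξ n (i + 1) x t)‖ ≤ ε'} := by
  rw [isEventualIn_setOf]
  simpa only [not_le] using h D x hx hb ε' hε'

theorem EventualBound.iInf_le {A : X →L[𝕜] Y} {ξ : Ordinal.{w}} {n : ℕ} (hn : 1 ≤ n)
    {a : Fin n → 𝕜} {N : ℝ} (h : EventualBound A ξ a N) {D : Type u} [Preorder D]
    [IsDirectedOrder D] [Nonempty D] {x : List (Ordinal.{w} × D) → X} (hx : IsWeaklyNull 𝕜 ξ n x)
    (hb : InUnitBall ξ n x) :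
    (⨅ t : maxDot D ξ n, ‖A (∑ i : Fin n, a i • zvec 𝕜 ξ n (i + 1) x t)‖) ≤ N := by
  refine le_of_forall_pos_le_add fun δ hδ => ?_
  obtain ⟨t, ht, h1⟩ := exists_forall_of_isEventualIn (D := D) (ξ := ξ) hn ({()} : Finset Unit)
    (P := fun _ t => ‖A (∑ i : Fin n, a i • zvec 𝕜 ξ n (i + 1) x t)‖ ≤ N + δ)
    fun _ _ => h.isEventualIn hx hb (lt_add_of_pos_right N hδ)
  have hbdd : BddBelow (range fun t : maxDot D ξ n =>
      ‖A (∑ i : Fin n, a i • zvec 𝕜 ξ n (i + 1) x t)‖) :=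
    ⟨0, by rintro _ ⟨t, rfl⟩; exact norm_nonneg _⟩
  exact (ciInf_le hbdd ⟨t, ht⟩).trans (h1 () (Finset.mem_singleton_self _))

theorem alphaN_le_of_eventualBound {A : X →L[𝕜] Y} {ξ : Ordinal.{w}} {γ : ℝ≥0∞} (hγ : 1 ≤ γ)
    {n : ℕ} (hn : 1 ≤ n) {C : ℝ} (hC : 0 ≤ C)
    (h : ∀ a : Fin n → 𝕜, EventualBound A ξ a (C * pnorm γ fun i => ‖a i‖)) :
    alphaN ξ γ n (dualBall A) ≤ ENNReal.ofReal C := by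
  refine ENNReal.le_of_forall_pos_le_add fun η hη _ => ?_
  have : ENNReal.ofReal C + η = ENNReal.ofReal (C + η) := by
    rw [ENNReal.ofReal_add hC NNReal.zero_le_coe, ENNReal.ofReal_coe_nnreal]
  rw [this]
  have hη0 : (0 : ℝ) < η := hη
  refine sInf_le ⟨C + η, by positivity, rfl, fun D _ _ _ a x hx hb => ?_⟩
  simp only [rK_dualBall]
  rw [pnorm_norm hγ]
  refine ((h a).iInf_le hn hx hb).trans ?_
  have := pnorm_nonneg hγ fun i => ‖a i‖
  nlinarith

end Operator

section Diagonal

variable {𝕜 : Type v} [RCLike 𝕜] {ι : Type u} {X Y : ι → Type u}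
  [∀ l, NormedAddCommGroup (X l)] [∀ l, NormedSpace 𝕜 (X l)]
  [∀ l, NormedAddCommGroup (Y l)] [∀ l, NormedSpace 𝕜 (Y l)]
  {p r : ℝ≥0∞} [hp : Fact (1 ≤ p)] [hr : Fact (1 ≤ r)] {A : ∀ l, X l →L[𝕜] Y l}

/-- Eventual bounds for the coordinates, and trees with bounded coordinates, give an eventual bound
for the diagonal operator. -/
theorem eventualBound_diagOp {Υ : Finset ι} {ξ : Ordinal.{w}} {n : ℕ} (hn : 1 ≤ n) {a : Fin n → 𝕜}
    {N : ι → (Fin n → ℝ) → ℝ} {C : ℝ} (hN : ∀ l ∈ Υ, ∀ d : Fin n → ℝ, 0 ≤ N l d)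
    (h1 : ∀ l ∈ Υ, ∀ d : Fin n → ℝ, (∀ i, 0 < d i) →
      EventualBound (A l) ξ (fun i => a i * (d i : 𝕜)) (N l d))
    (h2 : ∀ d : ι → Fin n → ℝ, (∀ l i, 0 < d l i) → ∀ τ : ℝ, 0 < τ →
      (∀ i, pnorm p (fun l : Υ => d l i) ≤ 1 + τ) →
      pnorm r (fun l : Υ => N l (d l)) ≤ (1 + τ) * C) :
    EventualBound (diagOp p r A Υ) ξ a C := by
  classical
  intro D _ _ _ x hx hb ε' hε' hcof
  -- The gap σ is spent in quarters: stabilisation, the inflation by 1 + τ, and the errors η of the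
  -- coordinates. The quarter left over gives the contradiction.
  set σ : ℝ := ε' - C with hσ
  have hσ0 : 0 < σ := sub_pos.2 hε'
  set τ : ℝ := σ / (4 * (|C| + 1)) with hτ
  have hτ0 : 0 < τ := by positivity
  have hτC : τ * C ≤ σ / 4 := by
    have : τ * (|C| + 1) = σ / 4 := by rw [hτ]; field_simp
    nlinarith [le_abs_self C]
  set η : ℝ := σ / (4 * (Υ.card + 1)) with hη
  have hη0 : 0 < η := by positivity
  have hηΥ : Υ.card * η ≤ σ / 4 := by
    have : (Υ.card + 1) * η = σ / 4 := by rw [hη]; field_simp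
    linarith
  obtain ⟨K, hK⟩ := exists_nat_gt (Υ.card / τ)
  have hK0 : (0 : ℝ) < K := lt_of_le_of_lt (by positivity) hK
  -- The colour lists the coordinate norms on Υ, rounded down to multiples of 1/K. The cap at K
  -- makes the colouring total; on the unit ball it has no effect.
  let χ : lp X p → Υ → Fin (K + 1) := fun v l =>
    ⟨min ⌊‖v l‖ * K⌋₊ K, Nat.lt_succ_of_le (min_le_right _ _)⟩
  have hχ : ∀ v : lp X p, ‖v‖ ≤ 1 → ∀ l : Υ, ((χ v l : ℕ) : ℝ) / K ≤ ‖v l‖ ∧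
      ‖v l‖ ≤ ((χ v l : ℕ) + 1 : ℝ) / K := by
    intro v hv l
    have hvl : ‖v l‖ ≤ 1 := (lp.norm_apply_le_norm (zero_lt_one.trans_le hp.out).ne' v l).trans hv
    have hfl : ⌊‖v l‖ * K⌋₊ ≤ K := by
      refine Nat.floor_le_of_le ?_
      exact mul_le_of_le_one_left hK0.le hvl
    simp only [χ, min_eq_left hfl]
    constructor
    · rw [div_le_iff₀ hK0]
      exact Nat.floor_le (by positivity)
    · rw [le_div_iff₀ hK0]
      exact (Nat.lt_floor_add_one _).le
  obtain ⟨k, c, hc, hstab⟩ := exists_stable hn a hx hb (G := fun _ v => ‖v‖ ≤ 1)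
    (fun i t ht => hb t (Lambda_lt ht)) χ hcof (show 0 < σ / 4 by positivity)
  obtain ⟨D', _, _, _, x', hx', hb', hG, ht⟩ := exists_tree_of_mem_stableSet_finRange hn hstab
  -- The coordinate norms on level i, rounded up; they depend only on the colour of the level. The
  -- value 1 outside Υ only provides positivity.
  let d : ι → Fin n → ℝ := fun l i => if h : l ∈ Υ then ((k i ⟨l, h⟩ : ℕ) + 1 : ℝ) / K else 1
  have hd : ∀ l i, 0 < d l i := by
    intro l i
    simp only [d]
    split_ifs
    · positivity
    · exact one_pos
  have hdΥ : ∀ (l : Υ) i, d l i = ((k i l : ℕ) + 1 : ℝ) / K := fun l i => by simp [d]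
  -- Compare with any node of level i: rounding adds at most 1/K per coordinate, hence at most |Υ|/K
  -- < τ to the ℓ_p norm.
  have hdp : ∀ i, pnorm p (fun l : Υ => d l i) ≤ 1 + τ := by
    intro i
    obtain ⟨s, hs⟩ := exists_mem_level (D := D') (ξ := ξ) i.2
    obtain ⟨hs1, hs2⟩ := hG i s hs
    have hle : ∀ l : Υ, |d l i| ≤ |‖x' s l‖ + 1 / K| := by
      intro l
      rw [abs_of_pos (hd l i), abs_of_nonneg (by positivity), hdΥ, ← hs2, add_div]
      gcongr
      exact (hχ _ hs1 l).1
    refine (pnorm_mono hp.out hle).trans ((pnorm_add_le hp.out _ _).trans ?_)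
    refine add_le_add ((pnorm_le_norm Υ (x' s)).trans hs1)
      ((pnorm_const_le hp.out (by positivity)).trans ?_)
    rw [Fintype.card_coe, mul_one_div, div_le_iff₀ hK0]
    rw [div_lt_iff₀ hτ0] at hK
    linarith
  -- All coordinates must be small on the same branch. This needs eventual bounds; bounds on the
  -- separate infima would not suffice.
  obtain ⟨t, htm, hbound⟩ := exists_forall_of_isEventualIn hn Υ (P := fun l t =>
    ‖A l ((∑ i : Fin n, a i • zvec 𝕜 ξ n (i + 1) x' t : lp X p) l)‖ ≤ N l (d l) + η)
    (fun l hl => by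
      rw [isEventualIn_setOf]
      have := (h1 l hl (d l) (hd l)).rescale (lp.evalCLM 𝕜 X p l) hn (hd l) hx' (fun i s hs => by
        obtain ⟨hs1, hs2⟩ := hG i s hs
        have := (hχ _ hs1 ⟨l, hl⟩).2
        rw [hs2, ← hdΥ] at this
        exact this) (lt_add_of_pos_right (N l (d l)) hη0)
      simp only [not_le]
      exact this)
  have hlow := ht t htm
  rw [norm_diagOp] at hlow
  have hup : pnorm r (fun l : Υ => ‖A l ((∑ i : Fin n, a i • zvec 𝕜 ξ n (i + 1) x' t : lp X p) l)‖) ≤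
      (1 + τ) * C + Υ.card * η := by
    have hle : ∀ l : Υ, |‖A l ((∑ i : Fin n, a i • zvec 𝕜 ξ n (i + 1) x' t : lp X p) l)‖| ≤
        |N l (d l) + η| := by
      intro l
      rw [abs_norm, abs_of_nonneg (add_nonneg (hN l l.2 _) hη0.le)]
      exact hbound l l.2
    refine (pnorm_mono hr.out hle).trans ((pnorm_add_le hr.out _ _).trans ?_)
    refine add_le_add (h2 d hd τ hτ0 hdp) ((pnorm_const_le hr.out hη0.le).trans_eq ?_)
    rw [Fintype.card_coe]
  nlinarith

/-- Minkowski's inequality brings the norm over l inside, where the ℓ_q norm of a column is at most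
its ℓ_p norm. -/
theorem pnorm_pnorm_mul_le {κ κ' : Type*} [Fintype κ] [Fintype κ'] {γ q : ℝ≥0∞} {p : ℝ≥0∞}
    (hp : 1 ≤ p) (hpq : p ≤ q) (hγ : 1 ≤ γ) (hγq : γ ≤ q) {v : κ → ℝ} (hv : ∀ i, 0 ≤ v i)
    {d : κ' → κ → ℝ} (hd : ∀ l i, 0 ≤ d l i) {τ : ℝ}
    (h : ∀ i, pnorm p (fun l => d l i) ≤ 1 + τ) :
    pnorm q (fun l => pnorm γ fun i => v i * d l i) ≤ (1 + τ) * pnorm γ v := by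
  have hq : 1 ≤ q := hp.trans hpq
  refine (pnorm_pnorm_le hγ hγq fun l i => mul_nonneg (hv i) (hd l i)).trans ?_
  simp_rw [pnorm_smul hq]
  -- Without columns the hypothesis does not give 1 + τ ≥ 0, but both sides vanish.
  rcases isEmpty_or_nonempty κ with hκ | ⟨⟨i₀⟩⟩
  · have h0 : ∀ f : κ → ℝ, pnorm γ f = 0 := fun f => le_antisymm
      ((pnorm_anti le_rfl hγ f).trans_eq (by simp [pnorm_eq])) (pnorm_nonneg hγ f)
    simp [h0]
  · have hτ : 0 ≤ 1 + τ := (pnorm_nonneg hp _).trans (h i₀)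
    have hle : ∀ i, |(|v i| * pnorm q fun l => d l i)| ≤ |(1 + τ) * v i| := by
      intro i
      rw [abs_mul, abs_mul, abs_abs, abs_of_nonneg hτ, abs_of_nonneg (pnorm_nonneg hq _), mul_comm]
      exact mul_le_mul_of_nonneg_right ((pnorm_anti hp hpq _).trans (h i)) (abs_nonneg _)
    refine (pnorm_mono hγ hle).trans_eq ?_
    rw [pnorm_smul hγ, abs_of_nonneg hτ]

theorem norm_diagOp_singleton_le {R : ℝ} (l : ι) (hA : ‖A l‖ ≤ R) : ‖diagOp p r A {l}‖ ≤ R := by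
  refine ContinuousLinearMap.opNorm_le_bound _ ((norm_nonneg _).trans hA) fun x => ?_
  rw [norm_diagOp]
  refine (pnorm_anti le_rfl hr.out _).trans ?_
  rw [pnorm_eq one_ne_zero ENNReal.one_ne_top]
  simp only [abs_norm, ENNReal.toReal_one, Real.rpow_one, ne_eq, one_ne_zero, not_false_eq_true,
    div_self]
  rw [Finset.sum_coe_sort {l} fun l => ‖A l (x l)‖, Finset.sum_singleton]
  refine ((A l).le_opNorm _).trans ?_
  gcongr
  · exact (norm_nonneg _).trans hA
  · exact lp.norm_apply_le_norm (zero_lt_one.trans_le hp.out).ne' x l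

/-- The operator sees only the coordinate l, so the tree may be replaced by its projection, whose
levels are bounded by the a_i. -/
theorem isEventualIn_diagOp_singleton {R : ℝ} {s : ℝ≥0∞} (hrs : r⁻¹ + s⁻¹ = 1)
    {ζ : Ordinal.{w}} {m : ℕ} {ε : ℝ} (hm : 1 ≤ m) (hε : 0 ≤ ε) {l : ι} (hA : ‖A l‖ ≤ R)
    (hθ : theta ζ m (dualBall (diagOp p r A {l})) ≤ ENNReal.ofReal ε)
    {D : Type u} [Preorder D] [IsDirectedOrder D] [Nonempty D] {n : ℕ} (hn : 1 ≤ n)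
    {b : Fin n → ℝ} (hb : ∀ i, 0 ≤ b i) {x : List (Ordinal.{w} × D) → lp X p}
    (hx : IsWeaklyNull 𝕜 ζ n x) {a : Fin n → ℝ} (ha : ∀ i, 0 < a i)
    (hxa : ∀ i : Fin n, ∀ t ∈ dot D (Lambda ζ n (i + 1)), ‖(x t : ∀ l, X l) l‖ ≤ a i) {ε' : ℝ}
    (hε' : ε * ∑ i, b i * a i + R * (m : ℝ) ^ (s⁻¹).toReal * pnorm r (b * a) < ε') :
    IsEventualIn D ζ n {t | t ∈ maxDot D ζ n ∧
      ‖diagOp p r A {l} (∑ i : Fin n, (b i : 𝕜) • zvec 𝕜 ζ n (i + 1) x t)‖ ≤ ε'} := by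
  classical
  have h := eventualBound_of_theta_le (norm_diagOp_singleton_le (p := p) (r := r) l hA) hr.out hrs
    hm hε hθ hn (b := b * a) fun i => mul_nonneg (hb i) (ha i).le
  have h' : EventualBound (diagOp p r A {l}) ζ (fun i => (b i : 𝕜) * (a i : 𝕜))
      (ε * ∑ i, b i * a i + R * (m : ℝ) ^ (s⁻¹).toReal * pnorm r (b * a)) := by
    simpa only [Pi.mul_apply, RCLike.ofReal_mul] using h
  have h2 := h'.rescale
    ((lp.singleContinuousLinearMap 𝕜 X p l).comp (lp.evalCLM 𝕜 X p l)) hn ha hx (fun i t ht => by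
      refine le_trans (le_of_eq ?_) (hxa i t ht)
      exact lp.norm_single (zero_lt_one.trans_le hp.out) l _) hε'
  rw [isEventualIn_setOf]
  simp only [not_le]
  refine fun h3 => h2 ((isGrill_cofinal ζ hn).mono ?_ h3)
  rintro t ⟨ht, h4⟩
  refine ⟨ht, h4.trans_eq ?_⟩
  congr 1
  ext l'
  rw [diagOp_apply, diagOp_apply]
  split_ifs with h5
  · obtain rfl := Finset.mem_singleton.1 h5
    congr 1
    simp only [ContinuousLinearMap.comp_apply, lp.singleContinuousLinearMap_apply]
    rw [lp.single_apply_self]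
    rfl
  · rfl

/-- The coordinate bounds for level sizes d are combined in ℓ_r: the ℓ_1 part by the triangle
inequality, the ℓ_r part by interchanging the two norms. Both use that the ℓ_r norm is at most the
ℓ_p norm. -/
theorem eventualBound_diagOp_of_theta_le {R : ℝ} (hR : 0 ≤ R) (hA : ∀ l, ‖A l‖ ≤ R) (hpr : p ≤ r)
    {Υ : Finset ι} {s : ℝ≥0∞} (hrs : r⁻¹ + s⁻¹ = 1)
    {ζ : Ordinal.{w}} {m : ℕ} {ε : ℝ} (hm : 1 ≤ m) (hε : 0 ≤ ε)
    (hθ : ∀ l ∈ Υ, theta ζ m (dualBall (A l)) ≤ ENNReal.ofReal ε) {n : ℕ} (hn : 1 ≤ n)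
    {b : Fin n → ℝ} (hb : ∀ i, 0 ≤ b i) :
    EventualBound (diagOp p r A Υ) ζ (fun i => (b i : 𝕜))
      (ε * ∑ i, b i + R * (m : ℝ) ^ (s⁻¹).toReal * pnorm r b) := by
  set Rm := R * (m : ℝ) ^ (s⁻¹).toReal with hRm
  have hRm0 : 0 ≤ Rm := by positivity
  -- The absolute value makes the bound nonnegative for every d, and it changes nothing when d is
  -- positive.
  refine eventualBound_diagOp hn (N := fun _ d => ε * |∑ i, b i * d i| + Rm * pnorm r (b * d))
    (fun l _ d => ?_) (fun l hl d hd => ?_) fun d hd τ hτ hdp => ?_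
  · have := pnorm_nonneg hr.out (b * d)
    positivity
  · have h := eventualBound_of_theta_le (hA l) hr.out hrs hm hε (hθ l hl) hn (b := b * d)
      fun i => mul_nonneg (hb i) (hd i).le
    have h0 : 0 ≤ ∑ i, b i * d i := Finset.sum_nonneg fun i _ => mul_nonneg (hb i) (hd i).le
    rw [abs_of_nonneg h0]
    simpa only [Pi.mul_apply, RCLike.ofReal_mul] using h
  · refine (pnorm_add_le hr.out _ _).trans ?_
    rw [mul_add, pnorm_smul hr.out, pnorm_smul hr.out, abs_of_nonneg hε, abs_of_nonneg hRm0,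
      mul_left_comm _ ε, mul_left_comm _ Rm]
    refine add_le_add (mul_le_mul_of_nonneg_left ?_ hε) (mul_le_mul_of_nonneg_left ?_ hRm0)
    · have h1 : ∀ l : Υ, |(|∑ i, b i * d l i|)| ≤ |∑ i, b i * d l i| := fun l => (abs_abs _).le
      refine (pnorm_mono hr.out h1).trans ((pnorm_sum_le hr.out fun i (l : Υ) => b i * d l i).trans ?_)
      rw [Finset.mul_sum]
      refine Finset.sum_le_sum fun i _ => ?_
      rw [pnorm_smul hr.out, abs_of_nonneg (hb i), mul_comm]
      exact mul_le_mul_of_nonneg_right ((pnorm_anti hp.out hpr _).trans (hdp i)) (hb i)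
    · exact pnorm_pnorm_mul_le hp.out hpr hr.out le_rfl hb (d := fun (l : Υ) i => d l i)
        (fun l i => (hd l i).le) hdp

/-- The hypothesis h is the Hölder step left open to treat both cases of (iii): q = r with the
supremum of the α's if γ ≤ r, and q = γ with their ℓ_s norm if γ > r. -/
theorem eventualBound_diagOp_of_alphaN_le {γ : ℝ≥0∞} (hγ : 1 ≤ γ)
    {Υ : Finset ι} {ξ : Ordinal.{w}} {n : ℕ} (hn : 1 ≤ n) {α : ι → ℝ} (hα0 : ∀ l, 0 ≤ α l)
    (hα : ∀ l ∈ Υ, alphaN ξ γ n (dualBall (A l)) ≤ ENNReal.ofReal (α l)) {q : ℝ≥0∞}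
    (hpq : p ≤ q) (hγq : γ ≤ q) {C : ℝ} (hC : 0 ≤ C)
    (h : ∀ f : Υ → ℝ, (∀ l, 0 ≤ f l) → pnorm r (fun l : Υ => α l * f l) ≤ C * pnorm q f)
    (a : Fin n → 𝕜) :
    EventualBound (diagOp p r A Υ) ξ a (C * pnorm γ fun i => ‖a i‖) := by
  refine eventualBound_diagOp hn (N := fun l d => α l * pnorm γ fun i => ‖a i‖ * d i)
    (fun l _ d => mul_nonneg (hα0 l) (pnorm_nonneg hγ _)) (fun l hl d hd => ?_)
    fun d hd τ hτ hdp => ?_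
  · have := eventualBound_of_alphaN_le hγ hn (hα0 l) (hα l hl) fun i => a i * (d i : 𝕜)
    simpa only [norm_mul, RCLike.norm_ofReal, abs_of_pos (hd _)] using this
  · refine (h _ fun l => pnorm_nonneg hγ _).trans ?_
    rw [mul_left_comm]
    refine mul_le_mul_of_nonneg_left ?_ hC
    exact pnorm_pnorm_mul_le hp.out hpq hγ hγq (fun i => norm_nonneg (a i))
      (d := fun (l : Υ) i => d l i) (fun l i => (hd l i).le) hdp

theorem alphaN_le_alpha {E : Type u} [NormedAddCommGroup E] [NormedSpace 𝕜 E] {ξ : Ordinal.{w}}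
    {γ : ℝ≥0∞} {n : ℕ} (hn : 1 ≤ n) (K : Set (StrongDual 𝕜 E)) : alphaN ξ γ n K ≤ alpha ξ γ K :=
  le_iSup₂ (f := fun n (_ : 1 ≤ n) => alphaN ξ γ n K) n hn

theorem alpha_diagOp_le_iSup {γ : ℝ≥0∞} (hγ : 1 ≤ γ) (hpr : p ≤ r) (Υ : Finset ι)
    (ξ : Ordinal.{w}) (hγr : γ ≤ r) :
    alpha ξ γ (dualBall (diagOp p r A Υ)) ≤ ⨆ l ∈ Υ, alpha ξ γ (dualBall (A l)) := by
  rcases eq_or_ne (⨆ l ∈ Υ, alpha ξ γ (dualBall (A l))) ∞ with h | h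
  · rw [h]
    exact le_top
  · set M := (⨆ l ∈ Υ, alpha ξ γ (dualBall (A l))).toReal with hM
    refine iSup₂_le fun n hn => ?_
    rw [← ENNReal.ofReal_toReal h]
    refine alphaN_le_of_eventualBound hγ hn ENNReal.toReal_nonneg
      (eventualBound_diagOp_of_alphaN_le hγ hn (α := fun _ => M)
        (fun _ => ENNReal.toReal_nonneg) (fun l hl => ?_) hpr hγr ENNReal.toReal_nonneg
        fun f _ => ?_)
    · rw [hM, ENNReal.ofReal_toReal h]
      exact (alphaN_le_alpha hn _).trans
        (le_iSup₂ (f := fun l (_ : l ∈ Υ) => alpha ξ γ (dualBall (A l))) l hl)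
    · exact (pnorm_smul hr.out M f).le.trans_eq (by rw [abs_of_nonneg ENNReal.toReal_nonneg])

theorem alpha_diagOp_le_sum {γ s : ℝ≥0∞} (hpr : p ≤ r) (Υ : Finset ι)
    (ξ : Ordinal.{w}) (hγr : r < γ) (hs : γ⁻¹ + s⁻¹ = r⁻¹) (hs0 : 0 < s.toReal) :
    alpha ξ γ (dualBall (diagOp p r A Υ)) ≤
      (∑ l ∈ Υ, alpha ξ γ (dualBall (A l)) ^ s.toReal) ^ s.toReal⁻¹ := by
  have hγ : 1 ≤ γ := hr.out.trans hγr.le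
  by_cases h : ∀ l ∈ Υ, alpha ξ γ (dualBall (A l)) ≠ ∞
  · set α : ι → ℝ := fun l => (alpha ξ γ (dualBall (A l))).toReal with hα
    have hα0 : ∀ l, 0 ≤ α l := fun l => ENNReal.toReal_nonneg
    have hsum : (∑ l ∈ Υ, alpha ξ γ (dualBall (A l)) ^ s.toReal) ^ s.toReal⁻¹ =
        ENNReal.ofReal ((∑ l : Υ, α l ^ s.toReal) ^ s.toReal⁻¹) := by
      rw [Finset.sum_coe_sort Υ fun l => α l ^ s.toReal, ← ENNReal.ofReal_rpow_of_nonneg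
        (Finset.sum_nonneg fun l _ => Real.rpow_nonneg (hα0 l) _) (inv_nonneg.2 hs0.le),
        ENNReal.ofReal_sum_of_nonneg fun l _ => Real.rpow_nonneg (hα0 l) _]
      congr 1
      refine Finset.sum_congr rfl fun l hl => ?_
      rw [← ENNReal.ofReal_rpow_of_nonneg (hα0 l) hs0.le, ENNReal.ofReal_toReal (h l hl)]
    rw [hsum]
    have hS : 0 ≤ (∑ l : Υ, α l ^ s.toReal) ^ s.toReal⁻¹ :=
      Real.rpow_nonneg (Finset.sum_nonneg fun (l : Υ) _ => Real.rpow_nonneg (hα0 l) _) _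
    refine iSup₂_le fun n hn => ?_
    refine alphaN_le_of_eventualBound hγ hn hS
      (eventualBound_diagOp_of_alphaN_le hγ hn (α := α) hα0 (fun l hl => ?_)
        (hpr.trans hγr.le) le_rfl hS fun f hf => ?_)
    · rw [hα, ENNReal.ofReal_toReal (h l hl)]
      exact alphaN_le_alpha hn _
    · exact pnorm_mul_le hr.out hγr hs (fun l => hα0 l) hf
  -- One infinite term makes the right-hand side infinite.
  · push Not at h
    obtain ⟨l, hl, h⟩ := h
    have : ∑ l ∈ Υ, alpha ξ γ (dualBall (A l)) ^ s.toReal = ∞ := by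
      rw [ENNReal.sum_eq_top]
      exact ⟨l, hl, by rw [h, ENNReal.top_rpow_of_pos hs0]⟩
    rw [this, ENNReal.top_rpow_of_pos (inv_pos.2 hs0)]
    exact le_top

end Diagonal

end SzTree

end

/-! ### Lower estimates: stable sets in complementary subspaces -/

noncomputable section

namespace SzTree

section Lower

variable {𝕜 : Type v} [RCLike 𝕜] {X X₁ X₂ : Type u} [NormedAddCommGroup X] [NormedSpace 𝕜 X]
  [NormedAddCommGroup X₁] [NormedSpace 𝕜 X₁] [NormedAddCommGroup X₂] [NormedSpace 𝕜 X₂]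
  {Y : Type*} [NormedAddCommGroup Y] [NormedSpace 𝕜 Y]
  {Y₁ Y₂ : Type*} [NormedAddCommGroup Y₁] [NormedSpace 𝕜 Y₁]
  [NormedAddCommGroup Y₂] [NormedSpace 𝕜 Y₂]

theorem zvec_comp {D : Type u} (T : X →L[𝕜] X₁) (ξ : Ordinal.{w}) (n i : ℕ)
    (x : List (Ordinal.{w} × D) → X) (t : List (Ordinal.{w} × D)) :
    zvec 𝕜 ξ n i (fun s => T (x s)) t = T (zvec 𝕜 ξ n i x t) := by
  rw [zvec, zvec, map_sum]
  refine Finset.sum_congr rfl fun k _ => ?_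
  split_ifs
  · rw [map_smul]
  · rw [map_zero]

theorem apply_zvec_eq_zero {D : Type u} (T : X →L[𝕜] Y) {ξ : Ordinal.{w}} {n i : ℕ}
    {x : List (Ordinal.{w} × D) → X} (h : ∀ s ∈ dot D (Lambda ξ n i), T (x s) = 0)
    (t : List (Ordinal.{w} × D)) : T (zvec 𝕜 ξ n i x t) = 0 := by
  rw [zvec, map_sum]
  refine Finset.sum_eq_zero fun k _ => ?_
  split_ifs with hk
  · rw [map_smul, h _ hk, smul_zero]
  · rw [map_zero]

/-- The image under T of a weakly null tree in the unit ball is again one, with images of larger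
norm. It is used for the inclusion of a summand and for the enlargement of Υ. -/
theorem alpha_mono {A : X →L[𝕜] Y} {A₁ : X₁ →L[𝕜] Y₁} (T : X →L[𝕜] X₁) (hT : ∀ x, ‖T x‖ ≤ ‖x‖)
    (hA : ∀ x, ‖A x‖ ≤ ‖A₁ (T x)‖) (ξ : Ordinal.{w}) (γ : ℝ≥0∞) :
    alpha ξ γ (dualBall A) ≤ alpha ξ γ (dualBall A₁) := by
  refine iSup₂_mono fun n _ => le_sInf ?_
  rintro _ ⟨α, hα, rfl, h⟩
  refine sInf_le ⟨α, hα, rfl, fun D _ _ _ a x hx hb => ?_⟩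
  refine le_trans ?_ (h D a (fun s => T (x s))
    (fun s ζ hs f => hx s ζ hs (f.comp T)) fun t ht => (hT _).trans (hb t ht))
  simp only [rK_dualBall]
  refine ciInf_mono ⟨0, by rintro _ ⟨t, rfl⟩; exact norm_nonneg _⟩ fun t => ?_
  simp only [zvec_comp, ← map_smul, ← map_sum]
  exact hA _

/-- Numbers that are less than `α_{ξ,γ}(A)` give stable sets of large rank. -/
theorem exists_stableSet_of_lt_alpha {A : X →L[𝕜] Y} {ξ : Ordinal.{w}} {γ : ℝ≥0∞} (hγ : 1 ≤ γ)
    {β : ℝ} (hβ : 0 ≤ β) (h : ENNReal.ofReal β < alpha ξ γ (dualBall A)) :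
    ∃ n, 1 ≤ n ∧ ∃ (a : Fin n → 𝕜) (c : Fin n → ℝ), pnorm γ (fun i => ‖a i‖) = 1 ∧ β < ∑ i, c i ∧
      [] ∈ IterDer (weakZero 𝕜 X) ξ (List.finRange n) (StableSet A a c fun _ _ => True) := by
  obtain ⟨n, h⟩ := lt_iSup_iff.1 h
  obtain ⟨hn, h⟩ := lt_iSup_iff.1 h
  obtain ⟨β', h1, h2⟩ := ENNReal.lt_iff_exists_nnreal_btwn.1 h
  have hβ' : β < β' := (ENNReal.ofReal_lt_coe_iff hβ).1 h1
  by_contra hcon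
  refine h2.not_ge (sInf_le ⟨β', hβ.trans_lt hβ', by simp, fun D _ _ _ a x hx hb => ?_⟩)
  by_contra! hlt
  simp only [rK_dualBall] at hlt
  rw [pnorm_norm hγ] at hlt
  set N := pnorm γ fun i => ‖a i‖ with hN
  have hle : ∀ t ∈ maxDot D ξ n,
      β' * N < ‖A (∑ i : Fin n, a i • zvec 𝕜 ξ n (i + 1) x t)‖ := fun t ht =>
    hlt.trans_le (ciInf_le (f := fun t : maxDot D ξ n =>
      ‖A (∑ i : Fin n, a i • zvec 𝕜 ξ n (i + 1) x t)‖)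
      ⟨0, by rintro _ ⟨t, rfl⟩; exact norm_nonneg _⟩ ⟨t, ht⟩)
  -- The strict inequality on a branch excludes zero coefficients, so they can be normalised.
  have hN0 : 0 < N := by
    refine (pnorm_nonneg hγ _).lt_of_ne fun h0 => ?_
    obtain ⟨t, ht⟩ := maxDot_nonempty (D := D) ξ hn
    have ha : ∀ i, a i = 0 := fun i => by
      have : |‖a i‖| ≤ pnorm γ fun i => ‖a i‖ := abs_le_pnorm hγ (fun i => ‖a i‖) i
      rw [← h0, abs_norm] at this
      exact norm_le_zero_iff.1 this
    have := hle t ht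
    simp only [ha, zero_smul, Finset.sum_const_zero, map_zero, norm_zero] at this
    rw [hN, ← h0, mul_zero] at this
    exact lt_irrefl _ this
  obtain ⟨_, c, hc, hs⟩ := exists_stable (A := A) hn (fun i => ((N : ℝ) : 𝕜)⁻¹ * a i) hx hb
    (G := fun _ _ => True) (fun _ _ _ => trivial) (fun _ => ()) (ε' := β')
    ((isGrill_cofinal ξ hn).mono (fun t ht => ⟨ht, by
      have := hle t ht
      simp only [mul_smul, ← Finset.smul_sum, map_smul, norm_smul, norm_inv, RCLike.norm_ofReal,
        abs_of_pos hN0]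
      rwa [lt_inv_mul_iff₀ hN0, mul_comm]⟩) (cofinalOf_maxDot ξ hn)) (sub_pos.2 hβ')
  refine hcon ⟨n, hn, _, c, ?_, by linarith, by simpa using hs⟩
  simp only [norm_mul, norm_inv, RCLike.norm_ofReal, abs_of_pos hN0]
  rw [pnorm_smul hγ, abs_of_pos (inv_pos.2 hN0), ← hN, inv_mul_cancel₀ hN0.ne']

/-- Two stable sets in complementary subspaces give a tree in the whole space. -/
theorem exists_tree_append {A₁ : X₁ →L[𝕜] Y₁} {A₂ : X₂ →L[𝕜] Y₂} {J₁ : X₁ →L[𝕜] X}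
    {J₂ : X₂ →L[𝕜] X} {B₁ : X →L[𝕜] Y₁} {B₂ : X →L[𝕜] Y₂} (hJ₁ : ∀ x, ‖J₁ x‖ ≤ ‖x‖)
    (hJ₂ : ∀ x, ‖J₂ x‖ ≤ ‖x‖) (h11 : ∀ x, B₁ (J₁ x) = A₁ x) (h12 : ∀ x, B₁ (J₂ x) = 0)
    (h21 : ∀ x, B₂ (J₁ x) = 0) (h22 : ∀ x, B₂ (J₂ x) = A₂ x) {ξ : Ordinal.{w}} {n₁ n₂ : ℕ}
    (hn : 1 ≤ n₁) {a₁ : Fin n₁ → 𝕜} {a₂ : Fin n₂ → 𝕜} {c₁ : Fin n₁ → ℝ} {c₂ : Fin n₂ → ℝ}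
    (h₁ : [] ∈ IterDer (weakZero 𝕜 X₁) ξ (List.finRange n₁) (StableSet A₁ a₁ c₁ fun _ _ => True))
    (h₂ : [] ∈ IterDer (weakZero 𝕜 X₂) ξ (List.finRange n₂) (StableSet A₂ a₂ c₂ fun _ _ => True)) :
    ∃ (D : Type u) (_ : Preorder D) (_ : IsDirectedOrder D) (_ : Nonempty D)
      (x : List (Ordinal.{w} × D) → X), IsWeaklyNull 𝕜 ξ (n₁ + n₂) x ∧
      InUnitBall ξ (n₁ + n₂) x ∧ ∀ t ∈ maxDot D ξ (n₁ + n₂), ∀ τ₁ τ₂ : ℝ, 0 ≤ τ₁ → 0 ≤ τ₂ →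
        τ₁ * ∑ i, c₁ i ≤ ‖B₁ (∑ i : Fin (n₁ + n₂), Fin.append (fun i => (τ₁ : 𝕜) * a₁ i)
          (fun i => (τ₂ : 𝕜) * a₂ i) i • zvec 𝕜 ξ (n₁ + n₂) (i + 1) x t)‖ ∧
        τ₂ * ∑ i, c₂ i ≤ ‖B₂ (∑ i : Fin (n₁ + n₂), Fin.append (fun i => (τ₁ : 𝕜) * a₁ i)
          (fun i => (τ₂ : 𝕜) * a₂ i) i • zvec 𝕜 ξ (n₁ + n₂) (i + 1) x t)‖ := by
  -- Two functionals certify the two families of labels, and the points of each family are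
  -- annihilated by the operator of the other.
  let T : Set (List ((Fin n₁ ⊕ Fin n₂) × X)) := {l | ∃ (y₁ : StrongDual 𝕜 Y₁) (y₂ : StrongDual 𝕜 Y₂),
    ‖y₁‖ ≤ 1 ∧ ‖y₂‖ ≤ 1 ∧ (∀ q ∈ l, ‖q.2‖ ≤ 1) ∧
    (∀ i v, (Sum.inl i, v) ∈ l → B₂ v = 0 ∧ c₁ i ≤ RCLike.re (y₁ (B₁ (a₁ i • v)))) ∧
    ∀ i v, (Sum.inr i, v) ∈ l → B₁ v = 0 ∧ c₂ i ≤ RCLike.re (y₂ (B₂ (a₂ i • v)))}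
  let L : List (Fin n₁ ⊕ Fin n₂) := (List.finRange n₁).map Sum.inl ++ (List.finRange n₂).map Sum.inr
  have hlen : L.length = n₁ + n₂ := by simp [L]
  have hL1 : ∀ (i : Fin n₁) (hi : (i : ℕ) < L.length), L[(i : ℕ)] = Sum.inl i := by
    intro i hi
    simp only [L]
    rw [List.getElem_append_left (by simp)]
    simp
  have hL2 : ∀ (i : Fin n₂) (hi : n₁ + (i : ℕ) < L.length), L[n₁ + (i : ℕ)] = Sum.inr i := by
    intro i hi
    simp only [L]
    rw [List.getElem_append_right (by simp)]
    simp
  -- The second family follows the first: a sequence of the first stable set is a fixed prefix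
  -- during the derivations of the second.
  have hmem : [] ∈ IterDer (weakZero 𝕜 X) ξ L T := by
    rw [IterDer_append]
    refine IterDer_map Sum.inl J₁ (tendsto_clm_weakZero J₁) [] (fun l₁ hl₁ => ?_) ξ _ _ h₁
    have := IterDer_map (T' := T) Sum.inr J₂ (tendsto_clm_weakZero J₂)
      ([] ++ l₁.map (Prod.map Sum.inl J₁)) (fun l₂ hl₂ => ?_) ξ _ _ h₂
    · simpa using this
    · obtain ⟨y₁, hy₁, hl₁⟩ := hl₁
      obtain ⟨y₂, hy₂, hl₂⟩ := hl₂
      refine ⟨y₁, y₂, hy₁, hy₂, fun q hq => ?_, fun i v hv => ?_, fun i v hv => ?_⟩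
      · rcases List.mem_append.1 hq with hq | hq
        · obtain ⟨q', hq', rfl⟩ := List.mem_map.1 hq
          exact (hJ₁ _).trans (hl₁ _ hq').2.1
        · obtain ⟨q', hq', rfl⟩ := List.mem_map.1 hq
          exact (hJ₂ _).trans (hl₂ _ hq').2.1
      · rcases List.mem_append.1 hv with hv | hv
        · obtain ⟨⟨i', v'⟩, hq', h⟩ := List.mem_map.1 hv
          obtain ⟨h', rfl⟩ := Prod.mk.inj h
          obtain rfl := Sum.inl.inj h'
          refine ⟨h21 _, ?_⟩
          rw [← map_smul, h11]
          exact (hl₁ _ hq').2.2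
        · obtain ⟨⟨i', v'⟩, hq', h⟩ := List.mem_map.1 hv
          cases (Prod.mk.inj h).1
      · rcases List.mem_append.1 hv with hv | hv
        · obtain ⟨⟨i', v'⟩, hq', h⟩ := List.mem_map.1 hv
          cases (Prod.mk.inj h).1
        · obtain ⟨⟨i', v'⟩, hq', h⟩ := List.mem_map.1 hv
          obtain ⟨h', rfl⟩ := Prod.mk.inj h
          obtain rfl := Sum.inr.inj h'
          refine ⟨h12 _, ?_⟩
          rw [← map_smul, h22]
          exact (hl₂ _ hq').2.2
  have hL0 : L ≠ [] := by
    rw [ne_eq, ← List.length_eq_zero_iff]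
    omega
  obtain ⟨x, hx, ht'⟩ := exists_tree_of_mem_IterDer hL0 hmem
  rw [hlen] at hx
  have ht : ∀ t ∈ dot (FilterIndex (weakZero 𝕜 X)) (Gamma ξ (n₁ + n₂)), ∃ l ∈ T, ∀ i,
      ∀ hi : i < L.length, ∀ s, s <+: t →
      s ∈ dot (FilterIndex (weakZero 𝕜 X)) (Lambda ξ (n₁ + n₂) (i + 1)) → (L[i], x s) ∈ l := by
    intro t ht
    obtain ⟨l, hl, h⟩ := ht' t (by rwa [hlen])
    exact ⟨l, hl, fun i hi s hs hs' => h i hi s hs (by rwa [hlen])⟩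
  have hz1 : ∀ (i : Fin n₁) t, B₂ (zvec 𝕜 ξ (n₁ + n₂) (i + 1) x t) = 0 := fun i =>
    apply_zvec_eq_zero B₂ fun s hs => by
      obtain ⟨l, ⟨y₁, y₂, -, -, -, hl, -⟩, h⟩ := ht s (Lambda_lt hs)
      have := h i (by omega) s List.prefix_rfl hs
      rw [hL1] at this
      exact (hl _ _ this).1
  have hz2 : ∀ (i : Fin n₂) t, B₁ (zvec 𝕜 ξ (n₁ + n₂) (n₁ + i + 1) x t) = 0 := fun i =>
    apply_zvec_eq_zero B₁ fun s hs => by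
      obtain ⟨l, ⟨y₁, y₂, -, -, -, -, hl⟩, h⟩ := ht s (Lambda_lt hs)
      have := h (n₁ + i) (by omega) s List.prefix_rfl hs
      rw [hL2] at this
      exact (hl _ _ this).1
  refine ⟨_, inferInstance, inferInstance, inferInstance, x, isWeaklyNull_iff.2 hx,
    fun s hs => ?_, fun t htm τ₁ τ₂ hτ₁ hτ₂ => ?_⟩
  · obtain ⟨l, ⟨y₁, y₂, -, -, hl, -, -⟩, h⟩ := ht s hs
    obtain ⟨i, h1, h2, hi⟩ := mem_Gamma_iff.1 hs
    obtain ⟨i, rfl⟩ : ∃ j, i = j + 1 := ⟨i - 1, by omega⟩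
    exact hl _ (h i (by omega) s List.prefix_rfl hi)
  · obtain ⟨l, ⟨y₁, y₂, hy₁, hy₂, -, hl1, hl2⟩, h⟩ := ht t htm.1
    rw [Fin.sum_univ_add]
    simp only [Fin.append_left, Fin.append_right, Fin.val_castAdd, Fin.val_natAdd, map_add, map_sum,
      map_smul, hz1, hz2, smul_zero, Finset.sum_const_zero, add_zero, zero_add, mul_smul,
      ← Finset.smul_sum, norm_smul, RCLike.norm_ofReal, abs_of_nonneg hτ₁, abs_of_nonneg hτ₂]
    refine ⟨mul_le_mul_of_nonneg_left ?_ hτ₁, mul_le_mul_of_nonneg_left ?_ hτ₂⟩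
    · refine le_trans ?_ (re_le_of_norm_le_one hy₁ _)
      rw [map_sum, map_sum]
      refine Finset.sum_le_sum fun i _ => ?_
      refine (le_re_apply_zvec (y := y₁.comp (a₁ i • B₁)) (i := i) (by omega) (x := x) htm
        (c := c₁ i) fun s hs hs' => ?_).trans_eq (by simp)
      have := h i (by omega) s hs hs'
      rw [hL1] at this
      simpa using (hl1 _ _ this).2
    · refine le_trans ?_ (re_le_of_norm_le_one hy₂ _)
      rw [map_sum, map_sum]
      refine Finset.sum_le_sum fun i _ => ?_
      refine (le_re_apply_zvec (y := y₂.comp (a₂ i • B₂)) (i := n₁ + i) (by omega) (x := x)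
        htm (c := c₂ i) fun s hs hs' => ?_).trans_eq (by simp)
      have := h (n₁ + i) (by omega) s hs hs'
      rw [hL2] at this
      simpa using (hl2 _ _ this).2

end Lower

end SzTree

end

/-! ### Equality in Hölder's inequality and superadditivity -/

noncomputable section

namespace SzTree

theorem toReal_pos_of_inv_add_inv {r γ s : ℝ≥0∞} (hr : 1 ≤ r) (hγ : r < γ)
    (hs : γ⁻¹ + s⁻¹ = r⁻¹) : 0 < s.toReal := by
  rcases eq_or_ne γ ∞ with rfl | hγ'
  · obtain rfl : s = r := by simpa using hs
    exact ENNReal.toReal_pos (zero_lt_one.trans_le hr).ne' hγ.ne_top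
  · exact (holderTriple_toReal hr hγ hγ' hs).pos

/-- The equality case of Hölder's inequality. -/
theorem rpow_add_rpow_le {r γ s : ℝ≥0∞} (hr : 1 ≤ r) (hγ : r < γ) (hs : γ⁻¹ + s⁻¹ = r⁻¹)
    {β₁ β₂ α : ℝ} (h1 : 0 ≤ β₁) (h2 : 0 ≤ β₂) (hα : 0 ≤ α)
    (h : ∀ τ₁ τ₂ : ℝ, 0 ≤ τ₁ → 0 ≤ τ₂ →
      (τ₁ * β₁) ^ r.toReal + (τ₂ * β₂) ^ r.toReal ≤ (α * pnorm γ ![τ₁, τ₂]) ^ r.toReal) :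
    β₁ ^ s.toReal + β₂ ^ s.toReal ≤ α ^ s.toReal := by
  rcases eq_or_ne γ ∞ with rfl | hγ'
  · obtain rfl : s = r := by simpa using hs
    have := h 1 1 zero_le_one zero_le_one
    have hp : pnorm ∞ ![(1 : ℝ), 1] = 1 := by
      rw [pnorm_top]
      have : ∀ i : Fin 2, |(![(1 : ℝ), 1] i)| = 1 := by
        intro i
        fin_cases i <;> simp
      simp only [this, ciSup_const]
    simpa only [hp, one_mul, mul_one] using this
  · have ht := holderTriple_toReal hr hγ hγ' hs
    have hγ0 : γ ≠ 0 := (zero_lt_one.trans_le (hr.trans hγ.le)).ne'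
    have hinv := ht.inv_add_inv_eq_inv
    have hσ := ht.pos
    have hg := ht.symm.pos
    have hρ : 0 < r.toReal := ENNReal.toReal_pos (zero_lt_one.trans_le hr).ne' hγ.ne_top
    set σ := s.toReal
    set g := γ.toReal with hgdef
    set ρ := r.toReal
    have e1 : (σ / g + 1) * ρ = σ := by
      have : σ / g + 1 = σ * ρ⁻¹ := by
        rw [← hinv]
        field_simp
        ring
      rw [this, mul_assoc, inv_mul_cancel₀ hρ.ne', mul_one]
    have e2 : σ / g * g = σ := div_mul_cancel₀ _ hg.ne'
    have e3 : g⁻¹ * ρ + ρ / σ = 1 := by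
      rw [div_eq_mul_inv, mul_comm ρ, ← add_mul, add_comm, hinv, inv_mul_cancel₀ hρ.ne']
    have hpow : ∀ β : ℝ, 0 ≤ β → (β ^ (σ / g) * β) ^ ρ = β ^ σ := by
      intro β hβ
      have : β ^ (σ / g) * β = β ^ (σ / g + 1) := by
        rw [Real.rpow_add_one' hβ (by positivity)]
      rw [this, ← Real.rpow_mul hβ, e1]
    -- These are the coefficients of equality in Hölder's inequality: both sides become powers of
    -- the same sum S, which then cancel.
    have hS := h (β₁ ^ (σ / g)) (β₂ ^ (σ / g)) (Real.rpow_nonneg h1 _) (Real.rpow_nonneg h2 _)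
    rw [hpow _ h1, hpow _ h2, pnorm_eq hγ0 hγ', Fin.sum_univ_two] at hS
    simp only [Matrix.cons_val_zero, Matrix.cons_val_one, abs_of_nonneg (Real.rpow_nonneg h1 _),
      abs_of_nonneg (Real.rpow_nonneg h2 _), ← hgdef, ← Real.rpow_mul h1, ← Real.rpow_mul h2, e2]
      at hS
    set S := β₁ ^ σ + β₂ ^ σ with hSdef
    have hS0 : 0 ≤ S := add_nonneg (Real.rpow_nonneg h1 _) (Real.rpow_nonneg h2 _)
    rcases hS0.eq_or_lt with h0 | h0
    · rw [← h0]
      exact Real.rpow_nonneg hα _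
    · rw [Real.mul_rpow hα (Real.rpow_nonneg hS0 _), ← Real.rpow_mul hS0, one_div] at hS
      have hS' : S ^ (g⁻¹ * ρ) * S ^ (ρ / σ) ≤ S ^ (g⁻¹ * ρ) * α ^ ρ := by
        rw [← Real.rpow_add h0, e3, Real.rpow_one, mul_comm]
        exact hS
      have h3 := le_of_mul_le_mul_left hS' (Real.rpow_pos_of_pos h0 _)
      have h4 := Real.rpow_le_rpow (Real.rpow_nonneg hS0 _) h3 (show 0 ≤ σ / ρ by positivity)
      rw [← Real.rpow_mul hS0, ← Real.rpow_mul hα] at h4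
      have e4 : ρ / σ * (σ / ρ) = 1 := by field_simp
      have e5 : ρ * (σ / ρ) = σ := by field_simp
      rwa [e4, e5, Real.rpow_one] at h4

/-- Let θ increase to 1 in the pair θα₁, θα₂. Positivity keeps these numbers strictly below α₁ and
α₂. -/
theorem rpow_add_rpow_le_of_forall_lt {α₁ α₂ C σ : ℝ} (hσ : 0 < σ) (h1 : 0 < α₁) (h2 : 0 < α₂)
    (h : ∀ β₁ β₂ : ℝ, 0 ≤ β₁ → β₁ < α₁ → 0 ≤ β₂ → β₂ < α₂ → β₁ ^ σ + β₂ ^ σ ≤ C) :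
    α₁ ^ σ + α₂ ^ σ ≤ C := by
  have hc : Tendsto (fun θ : ℝ => (θ * α₁) ^ σ + (θ * α₂) ^ σ) (𝓝[<] 1)
      (𝓝 ((1 * α₁) ^ σ + (1 * α₂) ^ σ)) := by
    refine Tendsto.mono_left ?_ nhdsWithin_le_nhds
    exact (((continuous_id.mul continuous_const).rpow_const fun _ => Or.inr hσ.le).add
      ((continuous_id.mul continuous_const).rpow_const fun _ => Or.inr hσ.le)).tendsto 1
  rw [one_mul, one_mul] at hc
  refine le_of_tendsto hc ?_
  filter_upwards [Ioo_mem_nhdsLT (show (0 : ℝ) < 1 from one_pos)] with θ hθ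
  exact h _ _ (by have := hθ.1; positivity) (mul_lt_of_lt_one_left h1 hθ.2)
    (by have := hθ.1; positivity) (mul_lt_of_lt_one_left h2 hθ.2)

/-- Both blocks have ℓ_γ norm 1, so the norm of the joined vector is controlled by that of the two
scalars. -/
theorem pnorm_append_le {𝕜 : Type*} [RCLike 𝕜] {γ : ℝ≥0∞} (hγ : 1 ≤ γ) {n₁ n₂ : ℕ}
    {a₁ : Fin n₁ → 𝕜} {a₂ : Fin n₂ → 𝕜} (h1 : pnorm γ (fun i => ‖a₁ i‖) = 1)
    (h2 : pnorm γ (fun i => ‖a₂ i‖) = 1) (τ₁ τ₂ : ℝ) :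
    pnorm γ (fun i => ‖Fin.append (fun i => (τ₁ : 𝕜) * a₁ i) (fun i => (τ₂ : 𝕜) * a₂ i) i‖) ≤
      pnorm γ ![τ₁, τ₂] := by
  rcases eq_or_ne γ ∞ with rfl | hγ'
  · rw [pnorm_top]
    refine Real.iSup_le (fun i => ?_) (pnorm_nonneg hγ _)
    rw [abs_norm]
    induction i using Fin.addCases with
    | left i =>
      rw [Fin.append_left, norm_mul, RCLike.norm_ofReal]
      have h3 := abs_le_pnorm hγ (fun i => ‖a₁ i‖) i
      rw [h1, abs_norm] at h3
      exact (mul_le_of_le_one_right (abs_nonneg _) h3).trans (abs_le_pnorm hγ ![τ₁, τ₂] 0)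
    | right i =>
      rw [Fin.append_right, norm_mul, RCLike.norm_ofReal]
      have h3 := abs_le_pnorm hγ (fun i => ‖a₂ i‖) i
      rw [h2, abs_norm] at h3
      exact (mul_le_of_le_one_right (abs_nonneg _) h3).trans (abs_le_pnorm hγ ![τ₁, τ₂] 1)
  · have hγ0 : γ ≠ 0 := (zero_lt_one.trans_le hγ).ne'
    have h3 := pnorm_pow_eq hγ hγ' (g := fun i => ‖a₁ i‖) fun i => norm_nonneg _
    have h4 := pnorm_pow_eq hγ hγ' (g := fun i => ‖a₂ i‖) fun i => norm_nonneg _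
    rw [h1, Real.one_rpow] at h3
    rw [h2, Real.one_rpow] at h4
    rw [pnorm_eq hγ0 hγ', pnorm_eq hγ0 hγ', Fin.sum_univ_add, Fin.sum_univ_two]
    simp only [Fin.append_left, Fin.append_right, norm_mul, RCLike.norm_ofReal, abs_mul, abs_abs,
      abs_norm, Real.mul_rpow (abs_nonneg _) (norm_nonneg _), ← Finset.mul_sum, ← h3, ← h4, mul_one,
      Matrix.cons_val_zero, Matrix.cons_val_one, le_refl]

section Diagonal

variable {𝕜 : Type v} [RCLike 𝕜] {ι : Type u} {X Y : ι → Type u}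
  [∀ l, NormedAddCommGroup (X l)] [∀ l, NormedSpace 𝕜 (X l)]
  [∀ l, NormedAddCommGroup (Y l)] [∀ l, NormedSpace 𝕜 (Y l)]
  {p r : ℝ≥0∞} [hp : Fact (1 ≤ p)] [hr : Fact (1 ≤ r)] {A : ∀ l, X l →L[𝕜] Y l}

theorem norm_diagOp_mono {Υ Υ' : Finset ι} (h : Υ ⊆ Υ') (x : lp X p) :
    ‖diagOp p r A Υ x‖ ≤ ‖diagOp p r A Υ' x‖ := by
  refine lp.norm_mono (zero_lt_one.trans_le hr.out).ne' fun l => ?_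
  rw [diagOp_apply, diagOp_apply]
  split_ifs with h1 h2 h2
  · rfl
  · exact absurd (h h1) h2
  · simp
  · rfl

open Classical in
theorem norm_apply_le_norm_diagOp_single {Υ : Finset ι} {l : ι} (hl : l ∈ Υ) (x : X l) :
    ‖A l x‖ ≤ ‖diagOp p r A Υ (lp.singleContinuousLinearMap 𝕜 X p l x)‖ := by
  refine le_trans (le_of_eq ?_)
    (lp.norm_apply_le_norm (zero_lt_one.trans_le hr.out).ne' (diagOp p r A Υ _) l)
  rw [diagOp_apply, if_pos hl, lp.singleContinuousLinearMap_apply, lp.single_apply_self]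

theorem alpha_le_alpha_diagOp (γ : ℝ≥0∞) (ξ : Ordinal.{w}) {Υ : Finset ι} {l : ι} (hl : l ∈ Υ) :
    alpha ξ γ (dualBall (A l)) ≤ alpha ξ γ (dualBall (diagOp p r A Υ)) := by
  classical
  exact alpha_mono (lp.singleContinuousLinearMap 𝕜 X p l)
    (fun x => (lp.norm_single (zero_lt_one.trans_le hp.out) l x).le)
    (norm_apply_le_norm_diagOp_single hl) ξ γ

theorem alpha_diagOp_mono (γ : ℝ≥0∞) (ξ : Ordinal.{w}) {Υ Υ' : Finset ι} (h : Υ ⊆ Υ') :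
    alpha ξ γ (dualBall (diagOp p r A Υ)) ≤ alpha ξ γ (dualBall (diagOp p r A Υ')) :=
  alpha_mono (ContinuousLinearMap.id 𝕜 _) (fun _ => le_rfl) (norm_diagOp_mono h) ξ γ

open Classical in
theorem norm_diagOp_insert {Υ : Finset ι} {l : ι} (hl : l ∉ Υ) (hr' : r ≠ ∞) (x : lp X p) :
    ‖diagOp p r A (insert l Υ) x‖ ^ r.toReal =
      ‖A l (x l)‖ ^ r.toReal + ‖diagOp p r A Υ x‖ ^ r.toReal := by
  have h : ∀ Υ : Finset ι, ‖diagOp p r A Υ x‖ ^ r.toReal = ∑ l ∈ Υ, ‖A l (x l)‖ ^ r.toReal := by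
    intro Υ
    rw [norm_diagOp, pnorm_pow_eq hr.out hr' fun l => norm_nonneg _,
      Finset.sum_coe_sort Υ fun l => ‖A l (x l)‖ ^ r.toReal]
  rw [h, h, Finset.sum_insert hl]

open Classical in
-- Stable sets for A_l and for D_Υ are joined into one tree. There the r-th powers of the two norms
-- add, while α bounds the infimum by the ℓ_γ norm of the scalars; `rpow_add_rpow_le` optimises the
-- scalars.
theorem rpow_add_rpow_le_alpha_diagOp {γ s : ℝ≥0∞} (hγr : r < γ) (hs : γ⁻¹ + s⁻¹ = r⁻¹)
    {Υ : Finset ι} {l : ι} (hl : l ∉ Υ) {ξ : Ordinal.{w}} {α β₁ β₂ : ℝ} (hα : 0 ≤ α)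
    (h : alpha ξ γ (dualBall (diagOp p r A (insert l Υ))) ≤ ENNReal.ofReal α)
    (hβ₁ : 0 ≤ β₁) (h1 : ENNReal.ofReal β₁ < alpha ξ γ (dualBall (A l)))
    (hβ₂ : 0 ≤ β₂) (h2 : ENNReal.ofReal β₂ < alpha ξ γ (dualBall (diagOp p r A Υ))) :
    β₁ ^ s.toReal + β₂ ^ s.toReal ≤ α ^ s.toReal := by
  have hγ : 1 ≤ γ := hr.out.trans hγr.le
  have hp0 : p ≠ 0 := (zero_lt_one.trans_le hp.out).ne'
  obtain ⟨n₁, hn₁, a₁, c₁, ha₁, hc₁, hs₁⟩ := exists_stableSet_of_lt_alpha hγ hβ₁ h1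
  obtain ⟨n₂, hn₂, a₂, c₂, ha₂, hc₂, hs₂⟩ := exists_stableSet_of_lt_alpha hγ hβ₂ h2
  let J : X l →L[𝕜] lp X p := lp.singleContinuousLinearMap 𝕜 X p l
  let Q : lp X p →L[𝕜] X l := lp.evalCLM 𝕜 X p l
  have hJ : ∀ x, ‖J x‖ = ‖x‖ := fun x => lp.norm_single (zero_lt_one.trans_le hp.out) l x
  have hQJ : ∀ x, Q (J x) = x := fun x => by
    change (lp.singleContinuousLinearMap 𝕜 X p l x : ∀ l, X l) l = x
    rw [lp.singleContinuousLinearMap_apply, lp.single_apply_self]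
  have hJl : ∀ x l', l' ≠ l → (J x : ∀ l, X l) l' = 0 := fun x l' hl' => by
    simp only [J, lp.singleContinuousLinearMap_apply, lp.single_apply]
    rw [Pi.single_eq_of_ne hl']
  have hDJ : ∀ x, diagOp p r A Υ (J x) = 0 := fun x => by
    ext l'
    rw [diagOp_apply]
    split_ifs with h'
    · rw [hJl x l' fun h'' => hl (h'' ▸ h'), map_zero]
      rfl
    · rfl
  -- The second embedding erases the coordinate l. It is contractive, and D_Υ does not notice it
  -- because l is not in Υ.
  obtain ⟨D, _, _, _, x, hx, hb, ht⟩ := exists_tree_append (J₁ := J)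
    (J₂ := ContinuousLinearMap.id 𝕜 (lp X p) - J.comp Q) (B₁ := (A l).comp Q) (B₂ := diagOp p r A Υ)
    (fun x => (hJ x).le)
    (fun x => lp.norm_mono hp0 fun l' => by
      change ‖(x : ∀ l, X l) l' - (J (Q x) : ∀ l, X l) l'‖ ≤ _
      by_cases h' : l' = l
      · subst h'
        have : (J (Q x) : ∀ l, X l) l' = (x : ∀ l, X l) l' := hQJ (Q x)
        rw [this, sub_self, norm_zero]
        exact norm_nonneg _
      · rw [hJl _ l' h', sub_zero])
    (fun x => by rw [ContinuousLinearMap.comp_apply, hQJ])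
    (fun x => by
      have : Q (x - J (Q x)) = 0 := by rw [map_sub, hQJ, sub_self]
      change A l (Q (x - J (Q x))) = 0
      rw [this, map_zero])
    hDJ
    (fun x => by
      change diagOp p r A Υ (x - J (Q x)) = _
      rw [map_sub, hDJ, sub_zero]) hn₁ hs₁ hs₂
  have hn : 1 ≤ n₁ + n₂ := by omega
  have := (maxDot_nonempty (D := D) ξ hn).to_subtype
  refine rpow_add_rpow_le hr.out hγr hs hβ₁ hβ₂ hα fun τ₁ τ₂ hτ₁ hτ₂ => ?_
  set a := Fin.append (fun i => (τ₁ : 𝕜) * a₁ i) fun i => (τ₂ : 𝕜) * a₂ i with ha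
  have hρ : 0 < r.toReal := ENNReal.toReal_pos (zero_lt_one.trans_le hr.out).ne' hγr.ne_top
  set S := (τ₁ * β₁) ^ r.toReal + (τ₂ * β₂) ^ r.toReal with hS
  have hS0 : 0 ≤ S := by positivity
  have hlow : S ^ r.toReal⁻¹ ≤ ⨅ t : maxDot D ξ (n₁ + n₂),
      ‖diagOp p r A (insert l Υ) (∑ i, a i • zvec 𝕜 ξ (n₁ + n₂) (i + 1) x t)‖ := by
    refine le_ciInf fun t => ?_
    rw [Real.rpow_inv_le_iff_of_pos hS0 (norm_nonneg _) hρ, norm_diagOp_insert hl hγr.ne_top]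
    obtain ⟨h3, h4⟩ := ht t t.2 τ₁ τ₂ hτ₁ hτ₂
    refine add_le_add (Real.rpow_le_rpow (by positivity) ?_ hρ.le)
      (Real.rpow_le_rpow (by positivity) ?_ hρ.le)
    · exact (mul_le_mul_of_nonneg_left hc₁.le hτ₁).trans h3
    · exact (mul_le_mul_of_nonneg_left hc₂.le hτ₂).trans h4
  have hup : ∀ η : ℝ, 0 < η → S ^ r.toReal⁻¹ ≤ (α + η) * pnorm γ ![τ₁, τ₂] := fun η hη => by
    have h5 := iInf_le_of_alphaN_le ((alphaN_le_alpha hn _).trans h) hα hη a hx hb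
      (by rw [pnorm_norm hγ]; exact pnorm_nonneg hγ _)
    rw [pnorm_norm hγ] at h5
    exact (hlow.trans h5).trans
      (mul_le_mul_of_nonneg_left (pnorm_append_le hγ ha₁ ha₂ τ₁ τ₂) (by positivity))
  rw [← Real.rpow_inv_le_iff_of_pos hS0 (mul_nonneg hα (pnorm_nonneg hγ _)) hρ]
  have hlim : Tendsto (fun η : ℝ => (α + η) * pnorm γ ![τ₁, τ₂]) (𝓝[>] 0)
      (𝓝 ((α + 0) * pnorm γ ![τ₁, τ₂])) :=
    ((continuous_const.add continuous_id).mul continuous_const).tendsto 0 |>.mono_left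
      nhdsWithin_le_nhds
  rw [add_zero] at hlim
  exact ge_of_tendsto hlim (eventually_mem_nhdsWithin.mono hup)

open Classical in
-- Infinite and zero values are split off first: no nonnegative β lies strictly below 0, and
-- monotonicity settles that case.
theorem alpha_rpow_add_le {γ s : ℝ≥0∞} (hγr : r < γ) (hs : γ⁻¹ + s⁻¹ = r⁻¹)
    {Υ : Finset ι} {l : ι} (hl : l ∉ Υ) (ξ : Ordinal.{w}) :
    alpha ξ γ (dualBall (A l)) ^ s.toReal + alpha ξ γ (dualBall (diagOp p r A Υ)) ^ s.toReal ≤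
      alpha ξ γ (dualBall (diagOp p r A (insert l Υ))) ^ s.toReal := by
  have hs0 := toReal_pos_of_inv_add_inv hr.out hγr hs
  have h1 := alpha_le_alpha_diagOp (A := A) (p := p) (r := r) γ ξ (Finset.mem_insert_self l Υ)
  have h2 := alpha_diagOp_mono (A := A) (p := p) (r := r) γ ξ (Finset.subset_insert l Υ)
  set α₁ := alpha ξ γ (dualBall (A l))
  set α₂ := alpha ξ γ (dualBall (diagOp p r A Υ))
  set α := alpha ξ γ (dualBall (diagOp p r A (insert l Υ))) with hα
  rcases eq_or_ne α ∞ with h | h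
  · rw [h, ENNReal.top_rpow_of_pos hs0]
    exact le_top
  rcases eq_or_ne α₁ 0 with h01 | h01
  · rw [h01, ENNReal.zero_rpow_of_pos hs0, zero_add]
    exact ENNReal.rpow_le_rpow h2 hs0.le
  rcases eq_or_ne α₂ 0 with h02 | h02
  · rw [h02, ENNReal.zero_rpow_of_pos hs0, add_zero]
    exact ENNReal.rpow_le_rpow h1 hs0.le
  have h1' := ne_top_of_le_ne_top h h1
  have h2' := ne_top_of_le_ne_top h h2
  have key := rpow_add_rpow_le_of_forall_lt (C := α.toReal ^ s.toReal) hs0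
    (ENNReal.toReal_pos h01 h1') (ENNReal.toReal_pos h02 h2') fun β₁ β₂ hβ₁ hb₁ hβ₂ hb₂ =>
    rpow_add_rpow_le_alpha_diagOp (A := A) (p := p) hγr hs hl ENNReal.toReal_nonneg
      (by rw [ENNReal.ofReal_toReal h]) hβ₁ ((ENNReal.ofReal_lt_iff_lt_toReal hβ₁ h1').2 hb₁) hβ₂
      ((ENNReal.ofReal_lt_iff_lt_toReal hβ₂ h2').2 hb₂)
  have := ENNReal.ofReal_le_ofReal key
  rwa [ENNReal.ofReal_add (by positivity) (by positivity),
    ← ENNReal.ofReal_rpow_of_nonneg ENNReal.toReal_nonneg hs0.le,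
    ← ENNReal.ofReal_rpow_of_nonneg ENNReal.toReal_nonneg hs0.le,
    ← ENNReal.ofReal_rpow_of_nonneg ENNReal.toReal_nonneg hs0.le, ENNReal.ofReal_toReal h,
    ENNReal.ofReal_toReal h1', ENNReal.ofReal_toReal h2'] at this

theorem sum_rpow_le_alpha_diagOp {γ s : ℝ≥0∞} (hγr : r < γ) (hs : γ⁻¹ + s⁻¹ = r⁻¹)
    (Υ : Finset ι) (ξ : Ordinal.{w}) :
    ∑ l ∈ Υ, alpha ξ γ (dualBall (A l)) ^ s.toReal ≤
      alpha ξ γ (dualBall (diagOp p r A Υ)) ^ s.toReal := by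
  classical
  induction Υ using Finset.induction_on with
  | empty => simp
  | insert l Υ hl ih =>
    rw [Finset.sum_insert hl]
    exact (add_le_add le_rfl ih).trans (alpha_rpow_add_le hγr hs hl ξ)

end Diagonal

end SzTree

end

/-! ### The three statements assembled -/

theorem mainTheorem8 {𝕜 : Type v} [RCLike 𝕜] {ι : Type u} {X Y : ι → Type u}
    [∀ l, NormedAddCommGroup (X l)] [∀ l, NormedSpace 𝕜 (X l)] [∀ l, CompleteSpace (X l)]
    [∀ l, NormedAddCommGroup (Y l)] [∀ l, NormedSpace 𝕜 (Y l)] [∀ l, CompleteSpace (Y l)]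
    (A : ∀ l, X l →L[𝕜] Y l) (R : ℝ) (hR : 0 ≤ R) (hA : ∀ l, ‖A l‖ ≤ R) (Υ : Finset ι)
    (p r γ : ℝ≥0∞) [Fact (1 ≤ p)] [Fact (1 ≤ r)] (hγ : 1 ≤ γ) (hpr : p ≤ r) :
    -- part (i)
    (∀ s : ℝ≥0∞, r⁻¹ + s⁻¹ = 1 →
      ∀ (ζ : Ordinal.{w}) (m : ℕ) (ε : ℝ), 1 ≤ m → 0 ≤ ε →
      ∀ l : ι, theta ζ m (dualBall (diagOp p r A {l})) ≤ ENNReal.ofReal ε →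
      ∀ (D : Type u) [Preorder D] [IsDirectedOrder D] [Nonempty D] (n : ℕ), 1 ≤ n →
      ∀ b : Fin n → ℝ, (∀ i, 0 ≤ b i) →
      ∀ x : List (Ordinal.{w} × D) → lp X p, IsWeaklyNull 𝕜 ζ n x → InUnitBall ζ n x →
      ∀ a : Fin n → ℝ, (∀ i, 0 < a i) →
        (∀ i : Fin n, ∀ t ∈ dot D (Lambda ζ n (i + 1)), ‖(x t : ∀ l, X l) l‖ ≤ a i) →
      ∀ ε' : ℝ, ε * ∑ i, b i * a i +
          R * (m : ℝ) ^ (s⁻¹).toReal * ‖(WithLp.toLp r (b * a) : PiLp r fun _ : Fin n => ℝ)‖ < ε' →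
        IsEventualIn D ζ n {t | t ∈ maxDot D ζ n ∧
          ‖diagOp p r A {l} (∑ i : Fin n, (b i : 𝕜) • zvec 𝕜 ζ n (i + 1) x t)‖ ≤ ε'}) ∧
    -- part (ii)
    (∀ s : ℝ≥0∞, r⁻¹ + s⁻¹ = 1 →
      ∀ (ζ : Ordinal.{w}) (m : ℕ) (ε : ℝ), 1 ≤ m → 0 ≤ ε →
      (∀ l ∈ Υ, theta ζ m (dualBall (A l)) ≤ ENNReal.ofReal ε) →
      ∀ (D : Type u) [Preorder D] [IsDirectedOrder D] [Nonempty D] (n : ℕ), 1 ≤ n →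
      ∀ x : List (Ordinal.{w} × D) → lp X p, IsWeaklyNull 𝕜 ζ n x → InUnitBall ζ n x →
      ∀ b : Fin n → ℝ, (∀ i, 0 ≤ b i) →
        (⨅ t : maxDot D ζ n, ‖diagOp p r A Υ (∑ i : Fin n, (b i : 𝕜) • zvec 𝕜 ζ n (i + 1) x t)‖) ≤
          ε * ∑ i, b i +
            R * (m : ℝ) ^ (s⁻¹).toReal * ‖(WithLp.toLp r b : PiLp r fun _ : Fin n => ℝ)‖ ∧
        ∀ ε₁ : ℝ, ε * ∑ i, b i +
            R * (m : ℝ) ^ (s⁻¹).toReal * ‖(WithLp.toLp r b : PiLp r fun _ : Fin n => ℝ)‖ < ε₁ →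
          IsEventualIn D ζ n {t | t ∈ maxDot D ζ n ∧
            ‖diagOp p r A Υ (∑ i : Fin n, (b i : 𝕜) • zvec 𝕜 ζ n (i + 1) x t)‖ ≤ ε₁}) ∧
    -- part (iii)
    (∀ ξ : Ordinal.{w},
      (γ ≤ r → alpha ξ γ (dualBall (diagOp p r A Υ)) = ⨆ l ∈ Υ, alpha ξ γ (dualBall (A l))) ∧
      (r < γ → ∀ s : ℝ≥0∞, γ⁻¹ + s⁻¹ = r⁻¹ →
        alpha ξ γ (dualBall (diagOp p r A Υ)) =
          (∑ l ∈ Υ, alpha ξ γ (dualBall (A l)) ^ s.toReal) ^ s.toReal⁻¹)) := by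
  refine ⟨fun s hrs ζ m ε hm hε l hθ D _ _ _ n hn b hb x hx hxb a ha hxa ε' hε' =>
      isEventualIn_diagOp_singleton hrs hm hε (hA l) hθ hn hb hx ha hxa hε',
    fun s hrs ζ m ε hm hε hθ D _ _ _ n hn x hx hxb b hb => ?_,
    fun ξ => ⟨fun hγr => ?_, fun hγr s hs => ?_⟩⟩
  · have h := eventualBound_diagOp_of_theta_le (p := p) hR hA hpr hrs hm hε hθ hn hb
    exact ⟨h.iInf_le hn hx hxb, fun ε₁ hε₁ => h.isEventualIn hx hxb hε₁⟩
  · exact le_antisymm (alpha_diagOp_le_iSup hγ hpr Υ ξ hγr)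
      (iSup₂_le fun l hl => alpha_le_alpha_diagOp γ ξ hl)
  · have hs0 := toReal_pos_of_inv_add_inv Fact.out hγr hs
    refine le_antisymm (alpha_diagOp_le_sum hpr Υ ξ hγr hs hs0) ?_
    rw [ENNReal.rpow_inv_le_iff hs0]
    exact sum_rpow_le_alpha_diagOp hγr hs Υ ξ
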